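/- Let $\bar L>0$. For each $v\ge 1$ let $L_1,\dots,L_v$ (depending on $v$) be real numbers in $[\bar L,\bar L+\Delta L]$, $\Delta L=\Delta L(v)$, that are linearly independent over $\mathbb Q$, and assume $v\,\Delta L\to 0$ as $v\to\infty$. Consider the star graph with $v$ bonds $[0,L_j]$ glued at the central vertex $x=0$, and on it the operator $-d^2/dx^2$ with the conditions $\psi_i(0)=\psi_j(0)$ for all $i,j$, $\sum_{j}\psi_j'(0)=0$, and $\psi_j'(L_j)=0$ for all $j$. Let $0=k_0<k_1<k_2<\cdots$ be the numbers $k\ge 0$ such that $k^2$ is an eigenvalue, let $\psi^{(n)}$ be the real eigenfunction for $k_n^2$ (unique up to sign) normalised by $\sum_{j=1}^v\int_0^{L_j}|\psi^{(n)}_j(x)|^2\,dx=1$, and let $$A_i(n)=\sup_{x\in[0,L_i]}|\psi^{(n)}_i(x)|^2 .$$ For each $v\ge 3$ and each bond $i$ there is a probability density $Q_v=Q_{v,i}$ on $(0,\infty)$ such that, for every $R>0$, $$\lim_{N\to\infty}\frac1N\#\{n\in\{1,\dots,N\}: v^2A_i(n)<R\}=\int_0^R Q_v(\eta)\,d\eta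 .$$ Moreover, for every choice of one bond $i=i_v$ in each of the graphs and each $R>0$, $$\int_0^R Q_v(\eta)\,d\eta\to\int_0^R Q(\eta)\,d\eta\qquad(v\to\infty),$$ where, for $\eta>0$, $$Q(\eta)=\frac{1}{2\pi^{3/2}\eta}\,\mathrm{Im}\int_{-\infty}^{\infty}\exp\Big(-\frac{\xi^2}{4}-\frac{\bar L\eta\, m(\xi)^2}{8}\Big)\,\mathrm{erfc}\Big(\frac{\sqrt{\bar L\eta}\,m(\xi)}{2\mathrm i\sqrt2}\Big)d\xi,\qquad m(\xi)=\frac{2}{\sqrt\pi}e^{-\xi^2/4}+\xi\,\mathrm{erf}(\xi/2).$$ The function $Q$ is a probability density on $(0,\infty)$ and is continuous there. As $\eta\to\infty$, $$Q(\eta)=\frac{\sqrt2}{\sqrt{\bar L}\,\pi^2\eta^{3/2}}\int_{-\infty}^{\infty}\frac{e^{-\xi^2/4}}{m(\xi)}\,d\xi+O(\eta^{-5/2}).$$ In particular the Porter–Thomas ($\chi^2_1$) density $(2\pi\eta)^{-1/2}e^{-\eta/2}$ is $o(Q(\eta))$ as $\eta\to\infty$. -/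

import Mathlib

open Filter Topology MeasureTheory Asymptotics
open scoped Real

noncomputable section

namespace StarGraph

/-- `IsEigenfunction L k ψ`: the family `ψ j : [0, L j] → ℝ` is a nonzero eigenfunction, with
eigenvalue `k ^ 2`, of `-d²/dx²` on the star graph with bond lengths `L`. The central vertex
is `x = 0` on every bond. The functions are twice differentiable on the closed bonds (one-sided at
the end points, `φ j` is the derivative of `ψ j`), they agree at the central vertex, their outgoing
derivatives at the central vertex add up to zero, and the derivatives vanish at the outlying
vertices. The values of `ψ j` outside `[0, L j]` play no role. -/
def IsEigenfunction {v : ℕ} (L : Fin v → ℝ) (k : ℝ) (ψ : Fin v → ℝ → ℝ) : Prop :=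
  (∃ φ : Fin v → ℝ → ℝ,
    (∀ j, ∀ x ∈ Set.Icc 0 (L j), HasDerivWithinAt (ψ j) (φ j x) (Set.Icc 0 (L j)) x) ∧
    (∀ j, ∀ x ∈ Set.Icc 0 (L j),
      HasDerivWithinAt (φ j) (-(k ^ 2 * ψ j x)) (Set.Icc 0 (L j)) x) ∧
    (∀ i j, ψ i 0 = ψ j 0) ∧
    ∑ j, φ j 0 = 0 ∧
    (∀ j, φ j (L j) = 0)) ∧
  ∃ j, ∃ x ∈ Set.Icc 0 (L j), ψ j x ≠ 0

/-- The set of wavenumbers `k ≥ 0` such that `k ^ 2` is an eigenvalue. -/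
def spectralSet {v : ℕ} (L : Fin v → ℝ) : Set ℝ :=
  {k | 0 ≤ k ∧ ∃ ψ, IsEigenfunction L k ψ}

/-- The wavenumbers `k_0 < k_1 < k_2 < ⋯` in increasing order: `k_0` is the least one and
`k_{n+1}` is the least one beyond `k_n`. (For bond lengths that are linearly independent over `ℚ`
all eigenvalues are simple, so that listing them with multiplicity gives the same sequence.) -/
def wavenumber {v : ℕ} (L : Fin v → ℝ) : ℕ → ℝ
  | 0 => sInf (spectralSet L)
  | n + 1 => sInf {k | k ∈ spectralSet L ∧ wavenumber L n < k}

/-- Eigenfunctions of unit `L²` norm on the graph. -/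
def IsNormalisedEigenfunction {v : ℕ} (L : Fin v → ℝ) (k : ℝ) (ψ : Fin v → ℝ → ℝ) : Prop :=
  IsEigenfunction L k ψ ∧ ∑ j, ∫ x in (0 : ℝ)..(L j), |ψ j x| ^ 2 = 1

/-- The maximum amplitude squared `A_i(n, L; v)`, the supremum over `[0, L_i]` of `|ψ_i^{(n)}|²`,
where `ψ^{(n)}` is the normalised eigenfunction with eigenvalue `k_n ^ 2`. For simple eigenvalues
the normalised eigenfunction is unique up to a sign, which does not affect the supremum. -/
def maxAmplitudeSq {v : ℕ} (L : Fin v → ℝ) (i : Fin v) (n : ℕ) : ℝ :=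
  sSup {a | ∃ ψ, IsNormalisedEigenfunction L (wavenumber L n) ψ ∧
    ∃ x ∈ Set.Icc 0 (L i), a = |ψ i x| ^ 2}

/-- `q` is a probability density on `(0, ∞)`. -/
def IsProbDensity (q : ℝ → ℝ) : Prop :=
  (∀ x, 0 < x → 0 ≤ q x) ∧ IntegrableOn q (Set.Ioi 0) ∧ ∫ x in Set.Ioi (0 : ℝ), q x = 1

open scoped Classical in
/-- `q` is the probability density `Q_v` of the limiting distribution, as `N → ∞`, of
`v² A_i(n, L; v)` over `n ∈ {1, …, N}`. -/
def IsAmplitudeDensity {v : ℕ} (L : Fin v → ℝ) (i : Fin v) (q : ℝ → ℝ) : Prop :=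
  IsProbDensity q ∧ ∀ R : ℝ, 0 < R →
    Tendsto (fun N : ℕ =>
        (((Finset.Icc 1 N).filter
          (fun n => (v : ℝ) ^ 2 * maxAmplitudeSq L i n < R)).card : ℝ) / (N : ℝ))
      atTop (𝓝 (∫ η in (0 : ℝ)..R, q η))

/-- The error function of a real argument. -/
def erf (x : ℝ) : ℝ := 2 / √π * ∫ t in (0 : ℝ)..x, Real.exp (-t ^ 2)

/-- The complementary error function of a complex argument,
`erfc z = 1 - (2 / √π) ∫_0^z exp (-w²) dw`, the integral being along the segment `w = t z`. -/
def cerfc (z : ℂ) : ℂ :=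
  1 - 2 / ((√π : ℝ) : ℂ) * ∫ t in (0 : ℝ)..1, z * Complex.exp (-((t : ℂ) * z) ^ 2)

/-- `m(ξ) = (2 / √π) exp (-ξ² / 4) + ξ erf (ξ / 2)`. -/
def m (ξ : ℝ) : ℝ := 2 / √π * Real.exp (-ξ ^ 2 / 4) + ξ * erf (ξ / 2)

/-- The limiting density `Q(η)`. -/
def Q (Lbar η : ℝ) : ℝ :=
  1 / (2 * π ^ (3 / 2 : ℝ) * η) *
    (∫ ξ : ℝ, ((Real.exp (-ξ ^ 2 / 4 - Lbar * η * m ξ ^ 2 / 8) : ℝ) : ℂ) *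
      cerfc (((√(Lbar * η) * m ξ : ℝ) : ℂ) / (2 * Complex.I * ((√2 : ℝ) : ℂ)))).im

end StarGraph

end

noncomputable section

namespace StarGraph

/-! On each bond an eigenfunction with k > 0 is c cos(k(x - L_j)) / cos(k L_j), where c is its value
at the centre, and the derivative condition at the centre becomes Σ tan(k L_j) = 0. Put y_j = tan(k
L_j). Normalisation gives c² Σ L_j (1 + y_j²) = 2, so v² A_i is the explicit function `ampl` of a
point of the hyperplane Σ y_j = 0 (`maxAmplitudeSq_eq`).

Many eigenvalues, v fixed. Since the lengths are independent over ℚ, the curve k ↦ (tan(k L_j))_j is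
equidistributed with respect to the product of Cauchy laws (`tendsto_mean_tan`). Eigenvalues are its
crossings of the hyperplane, at speed Σ L_j (1 + y_j²), so a sum over eigenvalues is a flux: the
k-integral of an approximate delta function of Σ y_j times the speed. The increasing argument
`phase` of Π cos(k L_j) · (1 + i Σ tan(k L_j)), equal to nπ at the n-th eigenvalue, cuts the line
into branches on which that product integrates to exactly 1 (`integral_fluxFn_branch_le`). This
yields lower bounds for empirical means; applied to h and to 1 - h they give the limit
(`tendsto_amplMean`). In the flux the factor 1 + y_l² cancels the Cauchy density of y_l. What
remains is a mixture over l, with weights L_l / Σ L_j: the other coordinates are independent Cauchy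
variables and y_l is determined by them (`limLaw`). For three or more bonds this law is absolutely
continuous (`limLaw_absolutelyContinuous`), which gives Q_v.

Many bonds. Lengths in [a, b] sandwich the limit law between models with equal lengths
(`limLaw_bounds`). With y_i = y fixed, the law of S = Σ (1 + y_j²) / v² is needed. In exp(-sS) the
square of the sum in the eliminated coordinate is linearised by a Gaussian variable ξ of variance 2
(`integral_exp_neg_scaledSum`). The free bonds then decouple, and each contributes 1 - b m(ξ) + o(b)
with b = √s / v, because π m(ξ) = ∫ (1 - exp(-u²) cos(ξu)) / u² du (`integral_mKernel`). The product
tends to exp(-√s m(ξ)), the Laplace transform of m(ξ)² / (2x²) for a standard Gaussian x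
(`integral_exp_neg_div_sq_gaussianReal`). Laplace transforms at natural numbers are moments of
exp(-S), which suffice for convergence in law (`tendsto_integral_of_moments`). Hence v² A_i
converges in law to 4 (1 + y²) x² / (Lbar m(ξ)²), with y Cauchy and ξ, x Gaussian, all independent.

The function Q. Integrating out x and y turns the density of that variable into a Gaussian average
of the Dawson function D, and the imaginary part of the complementary error function in Q is the
same average (`Q_eq`, `setLIntegral_Q`). Nonnegativity, total mass and continuity follow, and the
tail comes from D(a) = 1/(2a) + O(a⁻³) (`Q_tail`). -/

/-! ### The Cauchy law as the law of the tangent of a uniform angle. -/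

/-- The standard Cauchy distribution. -/
def stdCauchy : Measure ℝ := ProbabilityTheory.cauchyMeasure 0 1

instance : IsProbabilityMeasure stdCauchy := by unfold stdCauchy; infer_instance

theorem stdCauchy_eq :
    stdCauchy = volume.withDensity (fun y => ENNReal.ofReal ((π * (1 + y ^ 2))⁻¹)) := by
  rw [stdCauchy, ProbabilityTheory.cauchyMeasure_of_scale_ne_zero _ one_ne_zero]
  congr 1
  ext y
  simp only [ProbabilityTheory.cauchyPDF, ProbabilityTheory.cauchyPDFReal_def]
  congr 1
  simp
  ring_nf

theorem lintegral_stdCauchy (f : ℝ → ENNReal) :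
    ∫⁻ y, f y ∂stdCauchy = ∫⁻ y, ENNReal.ofReal ((π * (1 + y ^ 2))⁻¹) * f y := by
  rw [stdCauchy_eq, lintegral_withDensity_eq_lintegral_mul_non_measurable _ (by fun_prop)]
  · rfl
  · exact ae_of_all _ fun y => ENNReal.ofReal_lt_top

theorem integral_stdCauchy (f : ℝ → ℝ) :
    ∫ y, f y ∂stdCauchy = ∫ y, (π * (1 + y ^ 2))⁻¹ * f y := by
  rw [stdCauchy_eq, integral_withDensity_eq_integral_toReal_smul (by fun_prop)
    (ae_of_all _ fun y => ENNReal.ofReal_lt_top)]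
  refine integral_congr_ae (ae_of_all _ fun y => ?_)
  have : 0 ≤ (π * (1 + y ^ 2))⁻¹ := by positivity
  simp only [ENNReal.toReal_ofReal this, smul_eq_mul]

theorem stdCauchy_absolutelyContinuous : stdCauchy ≪ volume := by
  rw [stdCauchy_eq]
  exact withDensity_absolutelyContinuous _ _

theorem pi_absolutelyContinuous {μ : Measure ℝ} [IsProbabilityMeasure μ] (h : μ ≪ volume) (n : ℕ) :
    Measure.pi (fun _ : Fin n => μ) ≪ volume := by
  induction n with
  | zero =>
    rw [volume_pi]
    rw [Measure.pi_of_empty (fun _ : Fin 0 => μ) Fin.elim0,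
      Measure.pi_of_empty (fun _ : Fin 0 => (volume : Measure ℝ)) Fin.elim0]
  | succ n ih =>
    have h1 := (measurePreserving_piFinSuccAbove (fun _ : Fin (n + 1) => μ) 0).symm
    have h2 := (volume_preserving_piFinSuccAbove (fun _ : Fin (n + 1) => ℝ) 0).symm
    rw [← h1.map_eq, ← h2.map_eq]
    exact (h.prod ih).map h1.measurable

/-- The uniform distribution on a period. -/
def unifIoc : Measure ℝ := volume.restrict (Set.Ioc (-1 / 2) (1 / 2))

instance : IsProbabilityMeasure unifIoc := ⟨by simp [unifIoc]; norm_num⟩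

theorem measurable_tan : Measurable Real.tan := by
  have : Real.tan = fun x => Real.sin x / Real.cos x := by
    ext x; exact Real.tan_eq_sin_div_cos x
  rw [this]; fun_prop

/-- The inverse map y ↦ arctan(y) / π has the Cauchy density as its derivative. One end point of the
period is dropped so that it becomes a bijection of ℝ onto an open interval. -/
theorem measurePreserving_tan :
    MeasurePreserving (fun x => Real.tan (π * x)) unifIoc stdCauchy := by
  have hm : Measurable (fun x => Real.tan (π * x)) := measurable_tan.comp (by fun_prop)
  refine ⟨hm, ?_⟩
  ext s hs
  rw [Measure.map_apply hm hs, ← lintegral_indicator_one hs, lintegral_stdCauchy,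
    ← lintegral_indicator_one (hm hs), unifIoc, ← restrict_Ioo_eq_restrict_Ioc]
  have himg : (fun y => Real.arctan y / π) '' Set.univ = Set.Ioo (-1 / 2 : ℝ) (1 / 2) := by
    ext x
    simp only [Set.image_univ, Set.mem_range, Set.mem_Ioo]
    have hpi := Real.pi_pos
    constructor
    · rintro ⟨y, rfl⟩
      have := Real.neg_pi_div_two_lt_arctan y
      have := Real.arctan_lt_pi_div_two y
      rw [lt_div_iff₀ hpi, div_lt_iff₀ hpi]
      constructor <;> linarith
    · rintro ⟨h1, h2⟩
      refine ⟨Real.tan (π * x), ?_⟩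
      rw [Real.arctan_tan (by nlinarith) (by nlinarith)]
      field_simp
  rw [← himg, lintegral_image_eq_lintegral_abs_deriv_mul MeasurableSet.univ
    (f' := fun y => 1 / (1 + y ^ 2) / π)]
  · simp only [Measure.restrict_univ]
    refine lintegral_congr fun y => ?_
    congr 1
    · congr 1
      rw [abs_of_nonneg (by positivity)]
      field_simp
    · have : π * (Real.arctan y / π) = Real.arctan y := by field_simp
      have h2 : Real.arctan y / π ∈ (fun x => Real.tan (π * x)) ⁻¹' s ↔ y ∈ s := by
        rw [Set.mem_preimage, this, Real.tan_arctan]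
      by_cases hy : y ∈ s
      · rw [Set.indicator_of_mem hy, Set.indicator_of_mem (h2.mpr hy)]; rfl
      · rw [Set.indicator_of_notMem hy, Set.indicator_of_notMem (mt h2.mp hy)]
  · intro y _
    exact ((Real.hasDerivAt_arctan y).div_const π).hasDerivWithinAt
  · intro a _ b _ hab
    have : Real.arctan a = Real.arctan b := by
      have hpi := Real.pi_pos.ne'
      simpa [div_left_inj' hpi] using hab
    exact Real.arctan_injective this

/-! ### Kronecker–Weyl equidistribution on the torus. -/

section Weyl

variable {v : ℕ}

/-- The Cesàro mean of `F` along a line on the torus. -/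
def lineMean (ω : Fin v → ℝ) (F : C(UnitAddTorus (Fin v), ℂ)) (K : ℝ) : ℂ :=
  (K : ℂ)⁻¹ * ∫ t in (0 : ℝ)..K, F (fun j => ((t * ω j : ℝ) : UnitAddCircle))

/-- The mean of `F` over the torus. -/
def torusMean (F : C(UnitAddTorus (Fin v), ℂ)) : ℂ :=
  ∫ x, F (fun j => ((x j : ℝ) : UnitAddCircle)) ∂(Measure.pi fun _ : Fin v => unifIoc)

theorem continuous_torus_mk :
    Continuous (fun x : Fin v → ℝ => (fun j => ((x j : ℝ) : UnitAddCircle) : UnitAddTorus (Fin v))) :=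
  continuous_pi fun j => (AddCircle.continuous_mk' 1).comp (continuous_apply j)

theorem continuous_line (ω : Fin v → ℝ) (F : C(UnitAddTorus (Fin v), ℂ)) :
    Continuous (fun t : ℝ => F (fun j => ((t * ω j : ℝ) : UnitAddCircle))) :=
  F.continuous.comp (continuous_torus_mk.comp
    (continuous_pi fun _ => continuous_id.mul continuous_const))

/-- Contractivity in the sup norm, uniform in K, is what lets the limit pass from trigonometric
polynomials to their closure. -/
theorem norm_lineMean_sub_le (ω : Fin v → ℝ) (F G : C(UnitAddTorus (Fin v), ℂ)) {K : ℝ} (hK : 0 < K) :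
    ‖lineMean ω F K - lineMean ω G K‖ ≤ ‖F - G‖ := by
  unfold lineMean
  rw [← mul_sub, ← intervalIntegral.integral_sub
    ((continuous_line ω F).intervalIntegrable _ _) ((continuous_line ω G).intervalIntegrable _ _)]
  rw [norm_mul, norm_inv, Complex.norm_real, Real.norm_of_nonneg hK.le, inv_mul_le_iff₀ hK]
  refine (intervalIntegral.norm_integral_le_of_norm_le_const (C := ‖F - G‖) fun t _ => ?_).trans ?_
  · exact (F - G).norm_coe_le_norm _
  · rw [sub_zero, abs_of_pos hK, mul_comm]

theorem integrable_torus (F : C(UnitAddTorus (Fin v), ℂ)) :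
    Integrable (fun x : Fin v → ℝ => F (fun j => ((x j : ℝ) : UnitAddCircle)))
      (Measure.pi fun _ : Fin v => unifIoc) := by
  refine Integrable.of_bound (F.continuous.comp continuous_torus_mk).aestronglyMeasurable ‖F‖ ?_
  exact ae_of_all _ fun x => F.norm_coe_le_norm _

theorem norm_torusMean_sub_le (F G : C(UnitAddTorus (Fin v), ℂ)) :
    ‖torusMean F - torusMean G‖ ≤ ‖F - G‖ := by
  unfold torusMean
  rw [← integral_sub (integrable_torus F) (integrable_torus G)]
  refine (norm_integral_le_of_norm_le_const (C := ‖F - G‖) (ae_of_all _ fun x =>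
    (F - G).norm_coe_le_norm _)).trans ?_
  simp

theorem torusMean_mFourier (n : Fin v → ℤ) :
    torusMean (UnitAddTorus.mFourier n) = if n = 0 then 1 else 0 := by
  unfold torusMean
  simp only [UnitAddTorus.mFourier, ContinuousMap.coe_mk]
  rw [integral_fintype_prod_eq_prod (fun j (x : ℝ) => (fourier (n j) (x : UnitAddCircle) : ℂ))]
  have key : ∀ m : ℤ, ∫ x, (fourier m ((x : ℝ) : UnitAddCircle) : ℂ) ∂unifIoc
      = if m = 0 then 1 else 0 := by
    intro m
    split_ifs with hm
    · simp [hm]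
    · rw [unifIoc, ← intervalIntegral.integral_of_le (by norm_num)]
      simp only [fourier_coe_apply]
      have hc : (2 * π * Complex.I * m : ℂ) ≠ 0 := by
        simp [hm, Real.pi_ne_zero]
      have := integral_exp_mul_complex (a := -1 / 2) (b := 1 / 2) hc
      simp only [Complex.ofReal_one, div_one]
      rw [this, div_eq_zero_iff]
      left
      rw [sub_eq_zero, Complex.exp_eq_exp_iff_exists_int]
      refine ⟨m, ?_⟩
      push_cast
      ring
  simp only [key]
  split_ifs with h
  · simp [h]
  · obtain ⟨j, hj⟩ := Function.ne_iff.mp h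
    exact Finset.prod_eq_zero (Finset.mem_univ j) (by simpa using hj)

/-- Along the line a character is exp(2πi s t) with s = Σ n_j ω_j. If s ≠ 0 its primitive is
bounded, so the mean is O(1/K). -/
theorem lineMean_mFourier (ω : Fin v → ℝ) (n : Fin v → ℤ) (hn : n = 0 ∨ ∑ j, (n j : ℝ) * ω j ≠ 0) :
    Tendsto (lineMean ω (UnitAddTorus.mFourier n)) atTop
      (𝓝 (torusMean (UnitAddTorus.mFourier n))) := by
  rw [torusMean_mFourier]
  rcases eq_or_ne n 0 with h0 | h0
  · subst h0
    simp only [if_true]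
    refine tendsto_const_nhds.congr' ?_
    filter_upwards [eventually_gt_atTop 0] with K hK
    have : (K : ℂ) ≠ 0 := by exact_mod_cast hK.ne'
    simp [lineMean, UnitAddTorus.mFourier_zero, this]
  · have hs := hn.resolve_left h0
    simp only [h0, if_false]
    set s : ℝ := ∑ j, (n j : ℝ) * ω j
    have hc : (2 * π * Complex.I * s : ℂ) ≠ 0 := by
      simp [hs, Real.pi_ne_zero]
    have hval : ∀ t : ℝ, UnitAddTorus.mFourier n (fun j => ((t * ω j : ℝ) : UnitAddCircle))
        = Complex.exp (2 * π * Complex.I * s * t) := by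
      intro t
      simp only [UnitAddTorus.mFourier, ContinuousMap.coe_mk, fourier_coe_apply]
      rw [← Complex.exp_sum]
      congr 1
      simp only [s, Complex.ofReal_sum, Finset.mul_sum, Finset.sum_mul]
      refine Finset.sum_congr rfl fun j _ => ?_
      push_cast
      ring
    have hl : ∀ K, lineMean ω (UnitAddTorus.mFourier n) K = (K : ℂ)⁻¹ *
        ((Complex.exp (2 * π * Complex.I * s * K) - 1) / (2 * π * Complex.I * s)) := by
      intro K
      simp only [lineMean, hval]
      rw [integral_exp_mul_complex hc]
      simp
    have hz : Tendsto (fun K : ℝ => |K|⁻¹ * (2 / ‖(2 * π * Complex.I * s : ℂ)‖)) atTop (𝓝 0) := by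
      rw [← zero_mul (2 / ‖(2 * π * Complex.I * s : ℂ)‖)]
      exact (tendsto_inv_atTop_zero.comp tendsto_abs_atTop_atTop).mul_const _
    refine squeeze_zero_norm (fun K => ?_) hz
    rw [hl, norm_mul, norm_inv, Complex.norm_real, Real.norm_eq_abs, norm_div]
    gcongr
    refine (norm_sub_le _ _).trans ?_
    have : (2 * π * Complex.I * s * K : ℂ) = ((2 * π * s * K : ℝ) : ℂ) * Complex.I := by
      push_cast; ring
    rw [this, Complex.norm_exp_ofReal_mul_I]
    norm_num

/-- **Kronecker–Weyl**: a line whose direction is linearly independent over `ℤ` is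
equidistributed. -/
theorem tendsto_lineMean (ω : Fin v → ℝ)
    (hω : ∀ n : Fin v → ℤ, n ≠ 0 → ∑ j, (n j : ℝ) * ω j ≠ 0) (F : C(UnitAddTorus (Fin v), ℂ)) :
    Tendsto (lineMean ω F) atTop (𝓝 (torusMean F)) := by
  have hspan : ∀ G ∈ Submodule.span ℂ (Set.range (UnitAddTorus.mFourier (d := Fin v))),
      Tendsto (lineMean ω G) atTop (𝓝 (torusMean G)) := by
    intro G hG
    induction hG using Submodule.span_induction with
    | mem x hx =>
      obtain ⟨n, rfl⟩ := hx
      exact lineMean_mFourier ω n (or_iff_not_imp_left.mpr (hω n))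
    | zero =>
      have : lineMean ω (0 : C(UnitAddTorus (Fin v), ℂ)) = fun _ => 0 := by
        ext K; simp [lineMean]
      rw [this]
      simp [torusMean]
    | add x y _ _ hx hy =>
      have h1 : lineMean ω (x + y) = fun K => lineMean ω x K + lineMean ω y K := by
        ext K
        simp only [lineMean, ContinuousMap.add_apply]
        rw [intervalIntegral.integral_add ((continuous_line ω x).intervalIntegrable _ _)
          ((continuous_line ω y).intervalIntegrable _ _), mul_add]
      have h2 : torusMean (x + y) = torusMean x + torusMean y := by
        simp only [torusMean, ContinuousMap.add_apply]
        exact integral_add (integrable_torus x) (integrable_torus y)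
      rw [h1, h2]
      exact hx.add hy
    | smul a x _ hx =>
      have h1 : lineMean ω (a • x) = fun K => a * lineMean ω x K := by
        ext K
        simp only [lineMean, ContinuousMap.smul_apply, smul_eq_mul]
        rw [intervalIntegral.integral_const_mul]
        ring
      have h2 : torusMean (a • x) = a * torusMean x := by
        simp only [torusMean, ContinuousMap.smul_apply, smul_eq_mul]
        exact integral_const_mul _ _
      rw [h1, h2]
      exact hx.const_mul a
  -- Trigonometric polynomials are dense; the rest is a three-epsilon argument.
  have hF : F ∈ closure
      (Submodule.span ℂ (Set.range (UnitAddTorus.mFourier (d := Fin v))) : Set _) := by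
    rw [← Submodule.topologicalClosure_coe, UnitAddTorus.span_mFourier_closure_eq_top]
    trivial
  rw [Metric.tendsto_atTop]
  intro ε hε
  obtain ⟨G, hG, hFG⟩ := Metric.mem_closure_iff.mp hF (ε / 3) (by positivity)
  obtain ⟨K₀, hK₀⟩ := Metric.tendsto_atTop.mp (hspan G hG) (ε / 3) (by positivity)
  refine ⟨max K₀ 1, fun K hK => ?_⟩
  have hK1 : 0 < K := lt_of_lt_of_le one_pos ((le_max_right _ _).trans hK)
  have h1 := norm_lineMean_sub_le ω F G hK1
  have h2 := norm_torusMean_sub_le G F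
  have h3 := hK₀ K ((le_max_left _ _).trans hK)
  rw [dist_eq_norm] at hFG h3 ⊢
  rw [norm_sub_rev G F] at h2
  calc ‖lineMean ω F K - torusMean F‖
      = ‖(lineMean ω F K - lineMean ω G K) + (lineMean ω G K - torusMean G)
          + (torusMean G - torusMean F)‖ := by congr 1; ring
    _ ≤ _ := norm_add₃_le
    _ < ε := by linarith

end Weyl

/-! ### Equidistribution of the tangents with respect to the product Cauchy law. -/

section Equidistribution

variable {v : ℕ}

theorem countable_cos_eq_zero {a : ℝ} (ha : a ≠ 0) : {k : ℝ | Real.cos (k * a) = 0}.Countable := by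
  refine (Set.countable_range fun n : ℤ => (2 * n + 1) * π / 2 / a).mono fun k hk => ?_
  obtain ⟨n, hn⟩ := Real.cos_eq_zero_iff.mp hk
  exact ⟨n, by simp only [← hn]; field_simp⟩

theorem ae_cos_ne_zero {L : Fin v → ℝ} (hL : ∀ j, L j ≠ 0) :
    ∀ᵐ k : ℝ, ∀ j, Real.cos (k * L j) ≠ 0 := by
  rw [ae_all_iff]
  intro j
  have := (countable_cos_eq_zero (hL j)).measure_zero volume
  rw [ae_iff]
  simpa using this

theorem ae_pi_cos_ne_zero :
    ∀ᵐ x ∂(Measure.pi fun _ : Fin v => unifIoc), ∀ j, Real.cos (π * x j) ≠ 0 := by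
  rw [ae_all_iff]
  intro j
  refine (Measure.tendsto_eval_ae_ae (μ := fun _ : Fin v => unifIoc) (i := j)).eventually
    (p := fun t => Real.cos (π * t) ≠ 0) ?_
  refine ae_mono Measure.restrict_le_self ?_
  have := (countable_cos_eq_zero Real.pi_ne_zero).measure_zero volume
  rw [mem_ae_iff]
  simpa [mul_comm, Set.compl_ofPred] using this

open scoped Classical in
/-- The function `φ ∘ tan` on `ℝ ^ v`, extended by zero at the poles. -/
def tanExt (φ : (Fin v → ℝ) → ℝ) (x : Fin v → ℝ) : ℝ :=
  if ∀ j, Real.cos (π * x j) ≠ 0 then φ (fun j => Real.tan (π * x j)) else 0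

/-- Near a pole some tangent exceeds M in absolute value, where φ vanishes, so extending by zero
creates no discontinuity. -/
theorem continuous_tanExt {φ : (Fin v → ℝ) → ℝ} (hφ : Continuous φ) {M : ℝ}
    (hM : ∀ y, (∃ j, M ≤ |y j|) → φ y = 0) : Continuous (tanExt φ) := by
  rw [continuous_iff_continuousAt]
  intro x
  by_cases hx : ∀ j, Real.cos (π * x j) ≠ 0
  · have hev : ∀ᶠ z in 𝓝 x, ∀ j, Real.cos (π * z j) ≠ 0 := by
      rw [eventually_all]
      intro j
      exact (by fun_prop : Continuous fun z : Fin v → ℝ => Real.cos (π * z j)).continuousAt.eventually_ne (hx j)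
    have : ContinuousAt (fun z : Fin v → ℝ => φ (fun j => Real.tan (π * z j))) x := by
      refine hφ.continuousAt.comp ?_
      refine continuousAt_pi.mpr fun j => ?_
      exact ContinuousAt.comp (f := fun z : Fin v → ℝ => π * z j) (g := Real.tan)
        (Real.continuousAt_tan.mpr (hx j))
        (by fun_prop : Continuous fun z : Fin v → ℝ => π * z j).continuousAt
    refine this.congr ?_
    filter_upwards [hev] with z hz
    simp only [tanExt]
    rw [if_pos hz]
  · have hx0 : tanExt φ x = 0 := by simp only [tanExt]; rw [if_neg hx]
    push Not at hx
    obtain ⟨j, hj⟩ := hx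
    -- Since cos² (1 + tan²) = 1, this bound on cos² forces |tan| ≥ M.
    have hev : ∀ᶠ z in 𝓝 x, Real.cos (π * z j) ^ 2 < 1 / (1 + M ^ 2) := by
      refine (by fun_prop : Continuous fun z : Fin v → ℝ => Real.cos (π * z j) ^ 2).continuousAt.eventually_lt
        continuousAt_const ?_
      rw [hj, zero_pow two_ne_zero]
      positivity
    have : tanExt φ =ᶠ[𝓝 x] fun _ => 0 := by
      filter_upwards [hev] with z hz
      simp only [tanExt]
      split_ifs with h
      · refine hM _ ⟨j, ?_⟩
        have hc := h j
        have h1 : Real.cos (π * z j) ^ 2 * (1 + Real.tan (π * z j) ^ 2) = 1 := by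
          rw [Real.tan_eq_sin_div_cos]
          field_simp
          linarith [Real.sin_sq_add_cos_sq (π * z j)]
        have h2 : M ^ 2 ≤ Real.tan (π * z j) ^ 2 := by
          rw [lt_div_iff₀ (by positivity)] at hz
          have : 0 < Real.cos (π * z j) ^ 2 := by positivity
          nlinarith
        exact (le_abs_self M).trans (sq_le_sq.mp h2)
      · rfl
    exact (continuousAt_const.congr this.symm)

theorem tanExt_periodic (φ : (Fin v → ℝ) → ℝ) {a b : Fin v → ℝ}
    (h : (fun j => ((a j : ℝ) : UnitAddCircle)) = fun j => ((b j : ℝ) : UnitAddCircle)) :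
    tanExt φ a = tanExt φ b := by
  have h1 : ∀ j, ∃ n : ℤ, π * a j = π * b j + n * π := by
    intro j
    have := congrFun h j
    rw [QuotientAddGroup.eq_iff_sub_mem] at this
    obtain ⟨n, hn⟩ := AddSubgroup.mem_zmultiples_iff.mp this
    refine ⟨n, ?_⟩
    have : a j = b j + n := by
      simp at hn
      linarith
    rw [this]; ring
  choose n hn using h1
  have h2 : ∀ j, Real.tan (π * a j) = Real.tan (π * b j) := fun j => by
    rw [hn, Real.tan_add_int_mul_pi]
  have h3 : ∀ j, Real.cos (π * a j) ≠ 0 ↔ Real.cos (π * b j) ≠ 0 := fun j => by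
    rw [hn, Real.cos_add_int_mul_pi]
    have : ((-1 : ℝ)) ^ n j ≠ 0 := zpow_ne_zero _ (by norm_num)
    simp [this]
  simp only [tanExt, h2, h3]

/-- Used to descend the periodic continuous function `tanExt φ` to a continuous function on the
torus. -/
theorem isQuotientMap_torus_mk : IsQuotientMap
    (fun x : Fin v → ℝ => (fun j => ((x j : ℝ) : UnitAddCircle) : UnitAddTorus (Fin v))) :=
  (IsOpenQuotientMap.piMap (f := fun (_ : Fin v) (t : ℝ) => (t : UnitAddCircle))
    fun _ => QuotientAddGroup.isOpenQuotientMap_mk).isQuotientMap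

theorem tanExt_line {L : Fin v → ℝ} (hL : ∀ j, L j ≠ 0) (φ : (Fin v → ℝ) → ℝ) :
    (fun k : ℝ => tanExt φ (fun j => k * (L j / π))) =ᵐ[volume]
      fun k => φ (fun j => Real.tan (k * L j)) := by
  filter_upwards [ae_cos_ne_zero hL] with k hk
  have h2 : ∀ j, π * (k * (L j / π)) = k * L j := fun j => by
    have := Real.pi_ne_zero
    field_simp
  simp only [tanExt, h2]
  rw [if_pos hk]

theorem intervalIntegrable_tan {L : Fin v → ℝ} (hL : ∀ j, L j ≠ 0) {φ : (Fin v → ℝ) → ℝ}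
    (hφ : Continuous φ) {M : ℝ} (hM : ∀ y, (∃ j, M ≤ |y j|) → φ y = 0) (a b : ℝ) :
    IntervalIntegrable (fun k => φ (fun j => Real.tan (k * L j))) volume a b := by
  have h : Continuous fun k : ℝ => tanExt φ (fun j => k * (L j / π)) :=
    (continuous_tanExt hφ hM).comp (by fun_prop)
  exact (h.intervalIntegrable a b).congr_ae (ae_restrict_of_ae (tanExt_line hL φ))

theorem integral_tanExt {φ : (Fin v → ℝ) → ℝ} (hφ : Continuous φ) :
    ∫ x, tanExt φ x ∂(Measure.pi fun _ : Fin v => unifIoc)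
      = ∫ y, φ y ∂(Measure.pi fun _ : Fin v => stdCauchy) := by
  have hmp := measurePreserving_pi (fun _ : Fin v => unifIoc) (fun _ : Fin v => stdCauchy)
    (fun _ => measurePreserving_tan)
  rw [← hmp.map_eq, integral_map hmp.measurable.aemeasurable hφ.aestronglyMeasurable]
  refine integral_congr_ae ?_
  filter_upwards [ae_pi_cos_ne_zero] with x hx
  simp only [tanExt]
  rw [if_pos hx]

/-- Kronecker–Weyl in the direction L_j / π, applied to the descent of `tanExt φ`. The poles met by
the line are countable and do not affect the integral, and `measurePreserving_tan` turns the torus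
mean into a Cauchy integral. -/
theorem tendsto_mean_tan {L : Fin v → ℝ}
    (hL : ∀ n : Fin v → ℤ, n ≠ 0 → ∑ j, (n j : ℝ) * L j ≠ 0)
    {φ : (Fin v → ℝ) → ℝ} (hφ : Continuous φ) {M : ℝ} (hM : ∀ y, (∃ j, M ≤ |y j|) → φ y = 0) :
    Tendsto (fun K : ℝ => K⁻¹ * ∫ k in (0 : ℝ)..K, φ (fun j => Real.tan (k * L j))) atTop
      (𝓝 (∫ y, φ y ∂(Measure.pi fun _ : Fin v => stdCauchy))) := by
  have hL0 : ∀ j, L j ≠ 0 := by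
    intro j
    have := hL (Pi.single j 1) (by simp)
    simpa [Pi.single_apply] using this
  let G : C(Fin v → ℝ, ℂ) := ⟨fun x => (tanExt φ x : ℂ),
    Complex.continuous_ofReal.comp (continuous_tanExt hφ hM)⟩
  have hfac : Function.FactorsThrough G
      (⟨_, continuous_torus_mk⟩ : C(Fin v → ℝ, UnitAddTorus (Fin v))) := fun a b h => by
    have := tanExt_periodic φ h
    simp only [G, ContinuousMap.coe_mk, this]
  let F : C(UnitAddTorus (Fin v), ℂ) := isQuotientMap_torus_mk.lift
    (f := ⟨_, continuous_torus_mk⟩) G hfac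
  have hF : ∀ x : Fin v → ℝ, F (fun j => ((x j : ℝ) : UnitAddCircle)) = (tanExt φ x : ℂ) := by
    intro x
    exact ContinuousMap.congr_fun (IsQuotientMap.lift_comp (f := ⟨_, continuous_torus_mk⟩) isQuotientMap_torus_mk G hfac) x
  have hω : ∀ n : Fin v → ℤ, n ≠ 0 → ∑ j, (n j : ℝ) * (L j / π) ≠ 0 := by
    intro n hn
    have h1 : ∑ j, (n j : ℝ) * (L j / π) = (∑ j, (n j : ℝ) * L j) / π := by
      rw [Finset.sum_div]
      exact Finset.sum_congr rfl fun j _ => by ring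
    rw [h1]
    exact div_ne_zero (hL n hn) Real.pi_ne_zero
  have key := tendsto_lineMean (fun j => L j / π) hω F
  have h1 : ∀ K, lineMean (fun j => L j / π) F K
      = ((K⁻¹ * ∫ k in (0 : ℝ)..K, φ (fun j => Real.tan (k * L j)) : ℝ) : ℂ) := by
    intro K
    simp only [lineMean]
    push_cast
    congr 1
    rw [← intervalIntegral.integral_ofReal]
    refine intervalIntegral.integral_congr_ae ?_
    filter_upwards [tanExt_line hL0 φ] with k hk _
    rw [hF (fun j => k * (L j / π)), hk]
  have h2 : torusMean F = ((∫ y, φ y ∂(Measure.pi fun _ : Fin v => stdCauchy) : ℝ) : ℂ) := by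
    simp only [torusMean, hF]
    rw [integral_complex_ofReal, integral_tanExt hφ]
  rw [h2, funext h1] at key
  have := (Complex.continuous_re.tendsto _).comp key
  simpa [Function.comp_def] using this

end Equidistribution

/-! ### The phase: a continuous increasing function counting the eigenvalues. -/

section Phase

variable {v : ℕ}

/-- No two of the functions `cos (k L_j)` vanish simultaneously. -/
def SimplePoles (L : Fin v → ℝ) : Prop :=
  ∀ (k : ℝ) (i j : Fin v), i ≠ j → Real.cos (k * L i) = 0 → Real.cos (k * L j) ≠ 0

/-- The product of the cosines. -/
def cosProd (L : Fin v → ℝ) (k : ℝ) : ℝ := ∏ j, Real.cos (k * L j)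

/-- The product of the cosines times the sum of the tangents, without poles. -/
def sinSum (L : Fin v → ℝ) (k : ℝ) : ℝ :=
  ∑ j, Real.sin (k * L j) * ∏ i ∈ Finset.univ.erase j, Real.cos (k * L i)

/-- The sum of the tangents. -/
def tanSum (L : Fin v → ℝ) (k : ℝ) : ℝ := ∑ j, Real.tan (k * L j)

/-- A nonvanishing curve in the plane, whose argument counts the eigenvalues. -/
def curve (L : Fin v → ℝ) (k : ℝ) : ℂ := (cosProd L k : ℂ) + (sinSum L k : ℂ) * Complex.I

/-- The continuous argument of `curve`. -/
def phase (L : Fin v → ℝ) (k : ℝ) : ℝ := ∫ t in (0 : ℝ)..k, (deriv (curve L) t / curve L t).im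

/-- The derivative of `phase`. -/
def phaseDeriv (L : Fin v → ℝ) (k : ℝ) : ℝ := (deriv (curve L) k / curve L k).im

theorem cosProd_eq_zero_iff {L : Fin v → ℝ} {k : ℝ} :
    cosProd L k = 0 ↔ ∃ j, Real.cos (k * L j) = 0 := by
  simp [cosProd, Finset.prod_eq_zero_iff]

theorem sinSum_eq {L : Fin v → ℝ} {k : ℝ} (hk : ∀ j, Real.cos (k * L j) ≠ 0) :
    sinSum L k = cosProd L k * tanSum L k := by
  rw [sinSum, cosProd, tanSum, Finset.mul_sum]
  refine Finset.sum_congr rfl fun j _ => ?_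
  rw [← Finset.mul_prod_erase _ _ (Finset.mem_univ j), Real.tan_eq_sin_div_cos]
  field_simp [hk j]

/-- If the real part vanishes, one cosine does, say that of bond l. Then only the l-th term of the
imaginary part survives, and it is nonzero because no other cosine vanishes at k. -/
theorem curve_ne_zero {L : Fin v → ℝ} (hL : SimplePoles L) (k : ℝ) : curve L k ≠ 0 := by
  intro h
  have hre := congrArg Complex.re h
  have him := congrArg Complex.im h
  simp [curve] at hre him
  obtain ⟨l, hl⟩ := cosProd_eq_zero_iff.mp hre
  have : sinSum L k = Real.sin (k * L l) * ∏ i ∈ Finset.univ.erase l, Real.cos (k * L i) := by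
    refine Finset.sum_eq_single l (fun j _ hj => ?_) (by simp)
    rw [Finset.prod_eq_zero (Finset.mem_erase.mpr ⟨hj.symm, Finset.mem_univ l⟩) hl, mul_zero]
  rw [this, mul_eq_zero] at him
  rcases him with h1 | h1
  · have := Real.sin_sq_add_cos_sq (k * L l)
    rw [h1, hl] at this
    norm_num at this
  · obtain ⟨i, hi, hi0⟩ := Finset.prod_eq_zero_iff.mp h1
    exact hL k l i (Finset.ne_of_mem_erase hi).symm hl hi0

theorem contDiff_curve (L : Fin v → ℝ) : ContDiff ℝ 1 (curve L) := by
  have h1 : ContDiff ℝ 1 (cosProd L) := by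
    unfold cosProd
    exact contDiff_prod fun j _ => Real.contDiff_cos.comp (contDiff_id.mul contDiff_const)
  have h2 : ContDiff ℝ 1 (sinSum L) := by
    unfold sinSum
    exact ContDiff.sum fun j _ => (Real.contDiff_sin.comp (contDiff_id.mul contDiff_const)).mul
      (contDiff_prod fun i _ => Real.contDiff_cos.comp (contDiff_id.mul contDiff_const))
  unfold curve
  exact (Complex.ofRealCLM.contDiff.comp h1).add
    ((Complex.ofRealCLM.contDiff.comp h2).mul contDiff_const)

theorem continuous_logDeriv_curve {L : Fin v → ℝ} (hL : SimplePoles L) :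
    Continuous fun t => deriv (curve L) t / curve L t :=
  ((contDiff_curve L).continuous_deriv le_rfl).div (contDiff_curve L).continuous (curve_ne_zero hL)

theorem continuous_phaseDeriv {L : Fin v → ℝ} (hL : SimplePoles L) : Continuous (phaseDeriv L) :=
  Complex.continuous_im.comp (continuous_logDeriv_curve hL)

theorem hasDerivAt_phase {L : Fin v → ℝ} (hL : SimplePoles L) (k : ℝ) :
    HasDerivAt (phase L) (phaseDeriv L k) k :=
  ((continuous_phaseDeriv hL).integral_hasStrictDerivAt 0 k).hasDerivAt

theorem continuous_phase {L : Fin v → ℝ} (hL : SimplePoles L) : Continuous (phase L) :=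
  continuous_iff_continuousAt.mpr fun k => (hasDerivAt_phase hL k).continuousAt

@[simp] theorem phase_zero (L : Fin v → ℝ) : phase L 0 = 0 := by simp [phase]

/-- The curve divided by the exponential of the integrated logarithmic derivative has derivative
zero, and it equals 1 at k = 0. -/
theorem curve_eq_exp {L : Fin v → ℝ} (hL : SimplePoles L) (k : ℝ) :
    curve L k = Complex.exp (∫ t in (0 : ℝ)..k, deriv (curve L) t / curve L t) := by
  set G : ℝ → ℂ := fun k => ∫ t in (0 : ℝ)..k, deriv (curve L) t / curve L t
  have hG : ∀ k, HasDerivAt G (deriv (curve L) k / curve L k) k := fun k =>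
    ((continuous_logDeriv_curve hL).integral_hasStrictDerivAt 0 k).hasDerivAt
  have hE : ∀ k, HasDerivAt (curve L) (deriv (curve L) k) k := fun k =>
    ((contDiff_curve L).differentiable one_ne_zero k).hasDerivAt
  have hq : ∀ k, HasDerivAt (fun k => curve L k * Complex.exp (-G k)) 0 k := by
    intro k
    have h := (hE k).mul ((hG k).neg.cexp)
    refine h.congr_deriv ?_
    have hE0 := curve_ne_zero hL k
    field_simp
    ring
  have hconst : curve L k * Complex.exp (-G k) = curve L 0 * Complex.exp (-G 0) :=
    is_const_of_deriv_eq_zero (fun k => (hq k).differentiableAt) (fun k => (hq k).deriv) k 0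
  have h0 : curve L 0 * Complex.exp (-G 0) = 1 := by
    simp [G, curve, cosProd, sinSum]
  rw [h0] at hconst
  rw [Complex.exp_neg] at hconst
  field_simp [Complex.exp_ne_zero] at hconst
  exact hconst

theorem exists_polar {L : Fin v → ℝ} (hL : SimplePoles L) (k : ℝ) :
    ∃ r : ℝ, 0 < r ∧ cosProd L k = r * Real.cos (phase L k) ∧
      sinSum L k = r * Real.sin (phase L k) := by
  set z : ℂ := ∫ t in (0 : ℝ)..k, deriv (curve L) t / curve L t with hz
  have him : z.im = phase L k := by
    have := Complex.imCLM.intervalIntegral_comp_comm (a := 0) (b := k) (μ := volume)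
      ((continuous_logDeriv_curve hL).intervalIntegrable 0 k)
    exact this.symm
  have h := curve_eq_exp hL k
  rw [← hz] at h
  refine ⟨Real.exp z.re, Real.exp_pos _, ?_, ?_⟩
  · have := congrArg Complex.re h
    rw [Complex.exp_re, him] at this
    simpa [curve] using this
  · have := congrArg Complex.im h
    rw [Complex.exp_im, him] at this
    simpa [curve] using this

theorem cos_phase_eq_zero_iff {L : Fin v → ℝ} (hL : SimplePoles L) {k : ℝ} :
    Real.cos (phase L k) = 0 ↔ ∃ j, Real.cos (k * L j) = 0 := by
  obtain ⟨r, hr, h1, -⟩ := exists_polar hL k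
  rw [← cosProd_eq_zero_iff, h1]
  simp [hr.ne']

theorem tan_phase {L : Fin v → ℝ} (hL : SimplePoles L) {k : ℝ} (hk : ∀ j, Real.cos (k * L j) ≠ 0) :
    Real.tan (phase L k) = tanSum L k := by
  obtain ⟨r, hr, h1, h2⟩ := exists_polar hL k
  have hc : Real.cos (phase L k) ≠ 0 := fun h => by
    obtain ⟨j, hj⟩ := (cos_phase_eq_zero_iff hL).mp h
    exact hk j hj
  rw [sinSum_eq hk, h1] at h2
  rw [Real.tan_eq_sin_div_cos, div_eq_iff hc]
  have := hr.ne'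
  apply mul_left_cancel₀ this
  rw [← h2]; ring

theorem hasDerivAt_tanSum {L : Fin v → ℝ} {k : ℝ} (hk : ∀ j, Real.cos (k * L j) ≠ 0) :
    HasDerivAt (tanSum L) (∑ j, L j * (1 + Real.tan (k * L j) ^ 2)) k := by
  unfold tanSum
  refine HasDerivAt.fun_sum fun j _ => ?_
  have h1 : HasDerivAt (fun k : ℝ => k * L j) (L j) k := by
    simpa using (hasDerivAt_id k).mul_const (L j)
  have h2 := (Real.hasDerivAt_tan (hk j)).comp k h1
  refine h2.congr_deriv ?_
  rw [Real.tan_eq_sin_div_cos]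
  have h3 := Real.sin_sq_add_cos_sq (k * L j)
  have := hk j
  field_simp
  rw [add_comm, h3, mul_one]

theorem eventually_cos_ne_zero {L : Fin v → ℝ} {k : ℝ} (hk : ∀ j, Real.cos (k * L j) ≠ 0) :
    ∀ᶠ t in 𝓝 k, ∀ j, Real.cos (t * L j) ≠ 0 := by
  rw [eventually_all]
  intro j
  exact (by fun_prop : Continuous fun t : ℝ => Real.cos (t * L j)).continuousAt.eventually_ne (hk j)

/-- Differentiate tan(phase) = Σ tan(k L_j). The right-hand side is the speed with which the curve
of tangents crosses the hyperplanes Σ y_j = const, so this identity converts flux into phase. -/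
theorem phaseDeriv_mul {L : Fin v → ℝ} (hL : SimplePoles L) {k : ℝ}
    (hk : ∀ j, Real.cos (k * L j) ≠ 0) :
    phaseDeriv L k * (1 + tanSum L k ^ 2) = ∑ j, L j * (1 + Real.tan (k * L j) ^ 2) := by
  have hc : Real.cos (phase L k) ≠ 0 := fun h => by
    obtain ⟨j, hj⟩ := (cos_phase_eq_zero_iff hL).mp h
    exact hk j hj
  have h1 := (Real.hasDerivAt_tan hc).comp k (hasDerivAt_phase hL k)
  have h2 : (Real.tan ∘ phase L) =ᶠ[𝓝 k] tanSum L := by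
    filter_upwards [eventually_cos_ne_zero hk] with t ht
    exact tan_phase hL ht
  have h3 := (h1.congr_of_eventuallyEq h2.symm).unique (hasDerivAt_tanSum hk)
  rw [← h3, ← tan_phase hL hk, Real.tan_eq_sin_div_cos]
  have h4 := Real.sin_sq_add_cos_sq (phase L k)
  field_simp
  rw [add_comm, h4, mul_one]

theorem dense_cos_ne_zero {L : Fin v → ℝ} (hpos : ∀ j, 0 < L j) :
    Dense {k : ℝ | ∀ j, Real.cos (k * L j) ≠ 0} := by
  have : {k : ℝ | ∀ j, Real.cos (k * L j) ≠ 0} = (⋃ j, {k : ℝ | Real.cos (k * L j) = 0})ᶜ := by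
    ext k; simp
  rw [this]
  exact (Set.countable_iUnion fun j => countable_cos_eq_zero (hpos j).ne').dense_compl ℝ

theorem phaseDeriv_pos [NeZero v] {L : Fin v → ℝ} (hL : SimplePoles L) (hpos : ∀ j, 0 < L j) {k : ℝ}
    (hk : ∀ j, Real.cos (k * L j) ≠ 0) : 0 < phaseDeriv L k := by
  have h := phaseDeriv_mul hL hk
  have h2 : 0 < ∑ j, L j * (1 + Real.tan (k * L j) ^ 2) :=
    Finset.sum_pos (fun j _ => mul_pos (hpos j) (by positivity)) ⟨0, Finset.mem_univ _⟩
  rw [← h] at h2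
  exact pos_of_mul_pos_left h2 (by positivity)

/-- The sign extends to the poles by continuity, as the complement of the poles is dense. -/
theorem phaseDeriv_nonneg [NeZero v] {L : Fin v → ℝ} (hL : SimplePoles L) (hpos : ∀ j, 0 < L j)
    (k : ℝ) : 0 ≤ phaseDeriv L k := by
  have hcl : IsClosed {k | 0 ≤ phaseDeriv L k} :=
    isClosed_le continuous_const (continuous_phaseDeriv hL)
  have hsub : {k : ℝ | ∀ j, Real.cos (k * L j) ≠ 0} ⊆ {k | 0 ≤ phaseDeriv L k} :=
    fun k hk => (phaseDeriv_pos hL hpos hk).le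
  have := hcl.closure_subset_iff.mpr hsub
  rw [(dense_cos_ne_zero hpos).closure_eq] at this
  exact this (Set.mem_univ k)

theorem integral_phaseDeriv {L : Fin v → ℝ} (hL : SimplePoles L) (a b : ℝ) :
    ∫ t in a..b, phaseDeriv L t = phase L b - phase L a :=
  intervalIntegral.integral_eq_sub_of_hasDerivAt (fun t _ => hasDerivAt_phase hL t)
    ((continuous_phaseDeriv hL).intervalIntegrable _ _)

theorem strictMono_phase [NeZero v] {L : Fin v → ℝ} (hL : SimplePoles L) (hpos : ∀ j, 0 < L j) :
    StrictMono (phase L) := by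
  intro a b hab
  rw [← sub_pos, ← integral_phaseDeriv hL]
  obtain ⟨c, hc, hcab⟩ := (dense_cos_ne_zero hpos).exists_mem_open isOpen_Ioo
    (Set.nonempty_Ioo.mpr hab)
  exact intervalIntegral.integral_pos hab (continuous_phaseDeriv hL).continuousOn
    (fun x _ => phaseDeriv_nonneg hL hpos x)
    ⟨c, Set.Ioo_subset_Icc_self hcab, phaseDeriv_pos hL hpos hc⟩

/-- At a pole the phase is an odd multiple of π/2, and distinct poles have distinct phases by
monotonicity. -/
theorem add_pi_le_phase [NeZero v] {L : Fin v → ℝ} (hL : SimplePoles L) (hpos : ∀ j, 0 < L j)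
    {a b : ℝ} (hab : a < b) (ha : ∃ j, Real.cos (a * L j) = 0) (hb : ∃ j, Real.cos (b * L j) = 0) :
    phase L a + π ≤ phase L b := by
  have h := strictMono_phase hL hpos hab
  obtain ⟨m, hm⟩ := Real.cos_eq_zero_iff.mp ((cos_phase_eq_zero_iff hL).mpr ha)
  obtain ⟨n, hn⟩ := Real.cos_eq_zero_iff.mp ((cos_phase_eq_zero_iff hL).mpr hb)
  rw [hm, hn] at h ⊢
  have hpi := Real.pi_pos
  have h2 : (m : ℝ) < n := by nlinarith
  have h3 : (m : ℝ) + 1 ≤ n := by exact_mod_cast (by exact_mod_cast h2 : m < n)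
  nlinarith

theorem tendsto_phase [NeZero v] {L : Fin v → ℝ} (hL : SimplePoles L) (hpos : ∀ j, 0 < L j) :
    Tendsto (phase L) atTop atTop := by
  set p : ℕ → ℝ := fun m => (2 * m + 1) * π / 2 / L 0 with hp
  have hpole : ∀ m, ∃ j, Real.cos (p m * L j) = 0 := by
    intro m
    refine ⟨0, Real.cos_eq_zero_iff.mpr ⟨m, ?_⟩⟩
    have := (hpos 0).ne'
    simp only [hp]
    field_simp
    norm_cast
  have hlt : ∀ m, p m < p (m + 1) := by
    intro m
    simp only [hp]
    have := hpos 0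
    have := Real.pi_pos
    gcongr
    linarith
  have hind : ∀ m : ℕ, m * π + phase L (p 0) ≤ phase L (p m) := by
    intro m
    induction m with
    | zero => simp
    | succ m ih =>
      have := add_pi_le_phase hL hpos (hlt m) (hpole m) (hpole (m + 1))
      push_cast
      linarith
  refine tendsto_atTop_atTop_of_monotone (strictMono_phase hL hpos).monotone fun b => ?_
  obtain ⟨m, hm⟩ := exists_nat_ge ((b - phase L (p 0)) / π)
  refine ⟨p m, ?_⟩
  rw [div_le_iff₀ Real.pi_pos] at hm
  linarith [hind m]

theorem exists_phase_eq [NeZero v] {L : Fin v → ℝ} (hL : SimplePoles L) (hpos : ∀ j, 0 < L j)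
    {θ : ℝ} (hθ : 0 ≤ θ) : ∃ k, 0 ≤ k ∧ phase L k = θ := by
  obtain ⟨b, hb⟩ := (tendsto_atTop.mp (tendsto_phase hL hpos) θ).exists_forall_of_atTop
  have h1 : θ ∈ Set.Icc (phase L 0) (phase L (max b 0)) := by
    rw [phase_zero]
    exact ⟨hθ, hb _ (le_max_left _ _)⟩
  obtain ⟨k, hk, hk2⟩ := intermediate_value_Icc (le_max_right b 0) (continuous_phase hL).continuousOn h1
  exact ⟨k, hk.1, hk2⟩

/-- One half of Weyl's law, by counting poles. Each value (m + 1/2)π of the phase is taken at a pole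
of some tan(k L_j), and bond j has at most K L_j / π + 1 poles in [0, K]. Only this half is needed,
since the flux is nonnegative. -/
theorem phase_le [NeZero v] {L : Fin v → ℝ} (hL : SimplePoles L) (hpos : ∀ j, 0 < L j)
    {K : ℝ} (hK : 0 ≤ K) : phase L K ≤ K * ∑ j, L j + (v + 1) * π := by
  have hpi := Real.pi_pos
  have hΘ : 0 ≤ phase L K := by
    have := (strictMono_phase hL hpos).monotone hK
    rwa [phase_zero] at this
  set N := ⌊phase L K / π + 1 / 2⌋₊ with hN
  have hq : ∀ m : ℕ, ∃ q, 0 ≤ q ∧ phase L q = (m + 1 / 2) * π := fun m =>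
    exists_phase_eq hL hpos (by positivity)
  choose q hq0 hq1 using hq
  have hjp : ∀ m : ℕ, ∃ j, ∃ p : ℕ, q m * L j = (p + 1 / 2) * π := by
    intro m
    have hc : Real.cos (phase L (q m)) = 0 := by
      rw [hq1, Real.cos_eq_zero_iff]
      exact ⟨m, by push_cast; ring⟩
    obtain ⟨j, hj⟩ := (cos_phase_eq_zero_iff hL).mp hc
    obtain ⟨n, hn⟩ := Real.cos_eq_zero_iff.mp hj
    have hn0 : 0 ≤ n := by
      by_contra hneg
      have h1 : (n : ℝ) ≤ -1 := by exact_mod_cast (by omega : n ≤ -1)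
      have h2 : 0 ≤ q m * L j := mul_nonneg (hq0 m) (hpos j).le
      rw [hn] at h2
      nlinarith
    obtain ⟨p, rfl⟩ := Int.eq_ofNat_of_zero_le hn0
    refine ⟨j, p, ?_⟩
    rw [hn]; push_cast; ring
  choose jj pp hjp using hjp
  have hcard : N ≤ ∑ j, (⌊K * L j / π⌋₊ + 1) := by
    have h1 : (Finset.range N).card ≤
        (Finset.univ.sigma fun j : Fin v => Finset.range (⌊K * L j / π⌋₊ + 1)).card := by
      -- Send m to a bond with a pole at phase (m + 1/2)π and to the index of that pole on the bond.
      -- These two data determine k, hence m.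
      refine Finset.card_le_card_of_injOn (fun m => (⟨jj m, pp m⟩ : Σ _ : Fin v, ℕ)) ?_ ?_
      · intro m hm
        rw [Finset.mem_coe, Finset.mem_range] at hm
        simp only [Finset.coe_sigma, Set.mem_sigma_iff, Finset.coe_univ, Set.mem_univ, true_and,
          Finset.coe_range, Set.mem_Iio]
        have h2 : ((m + 1 : ℕ) : ℝ) ≤ phase L K / π + 1 / 2 :=
          (Nat.le_floor_iff (by positivity)).mp hm
        have h3 : phase L (q m) ≤ phase L K := by
          rw [hq1]
          have h4 : (m + 1 / 2 : ℝ) ≤ phase L K / π := by push_cast at h2; linarith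
          rwa [le_div_iff₀ hpi] at h4
        have h5 : q m ≤ K := (strictMono_phase hL hpos).le_iff_le.mp h3
        have h6 : (pp m : ℝ) ≤ K * L (jj m) / π := by
          rw [le_div_iff₀ hpi]
          have := mul_le_mul_of_nonneg_right h5 (hpos (jj m)).le
          have := hjp m
          nlinarith
        exact Nat.lt_succ_of_le (Nat.le_floor h6)
      · intro m _ m' _ h
        simp only [Sigma.mk.injEq, heq_eq_eq] at h
        have h1 := hjp m
        rw [h.1, h.2, ← hjp m'] at h1
        have h2 := mul_right_cancel₀ (hpos _).ne' h1
        have h3 := hq1 m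
        rw [h2, hq1] at h3
        have h4 := mul_right_cancel₀ hpi.ne' h3
        have : (m' : ℝ) = m := by linarith
        exact_mod_cast this.symm
    simpa [Finset.card_sigma] using h1
  have h1 : (N : ℝ) ≤ ∑ j, (K * L j / π + 1) := by
    calc (N : ℝ) ≤ ((∑ j, (⌊K * L j / π⌋₊ + 1) : ℕ) : ℝ) := by exact_mod_cast hcard
      _ = ∑ j, ((⌊K * L j / π⌋₊ : ℝ) + 1) := by push_cast; rfl
      _ ≤ _ := Finset.sum_le_sum fun j _ => by
        have := Nat.floor_le (a := K * L j / π) (by have := hpos j; positivity)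
        linarith
  have h2 : phase L K / π + 1 / 2 < N + 1 := Nat.lt_floor_add_one _
  have h3 : ∑ j, (K * L j / π + 1) = (K * ∑ j, L j) / π + v := by
    rw [Finset.sum_add_distrib, Finset.mul_sum, Finset.sum_div]
    simp
  rw [h3] at h1
  have h4 : phase L K / π ≤ (K * ∑ j, L j) / π + v + 1 := by linarith
  have h5 : phase L K ≤ ((K * ∑ j, L j) / π + v + 1) * π := (div_le_iff₀ hpi).mp h4
  have h6 : ((K * ∑ j, L j) / π + v + 1) * π = K * ∑ j, L j + (v + 1) * π := by
    field_simp
    ring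
  linarith

end Phase

/-! ### Eigenfunctions, wavenumbers and the amplitude in terms of the tangents. -/

section Spectrum

variable {v : ℕ}

theorem eq_cos_of_deriv {ℓ k : ℝ} (hℓ : 0 < ℓ) (hk : 0 < k) {ψ φ : ℝ → ℝ}
    (h1 : ∀ x ∈ Set.Icc 0 ℓ, HasDerivWithinAt ψ (φ x) (Set.Icc 0 ℓ) x)
    (h2 : ∀ x ∈ Set.Icc 0 ℓ, HasDerivWithinAt φ (-(k ^ 2 * ψ x)) (Set.Icc 0 ℓ) x)
    (h3 : φ ℓ = 0) :
    ∀ x ∈ Set.Icc 0 ℓ, ψ x = ψ ℓ * Real.cos (k * (x - ℓ)) ∧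
      φ x = -(k * ψ ℓ * Real.sin (k * (x - ℓ))) := by
  have hc : ∀ x, HasDerivAt (fun x => Real.cos (k * (x - ℓ))) (-(k * Real.sin (k * (x - ℓ)))) x := by
    intro x
    have h := (((hasDerivAt_id x).sub_const ℓ).const_mul k).cos
    refine h.congr_deriv ?_
    simp; ring
  have hs : ∀ x, HasDerivAt (fun x => Real.sin (k * (x - ℓ))) (k * Real.cos (k * (x - ℓ))) x := by
    intro x
    have h := (((hasDerivAt_id x).sub_const ℓ).const_mul k).sin
    refine h.congr_deriv ?_
    simp; ring
  -- The vector (kψ, φ) rotates at constant rate under the equation. Rotating it back gives the two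
  -- constants of motion p and q, evaluated at x = ℓ.
  set p : ℝ → ℝ := fun x => k * ψ x * Real.cos (k * (x - ℓ)) - φ x * Real.sin (k * (x - ℓ)) with hp
  set q : ℝ → ℝ := fun x => k * ψ x * Real.sin (k * (x - ℓ)) + φ x * Real.cos (k * (x - ℓ)) with hq
  have hp' : ∀ x ∈ Set.Icc 0 ℓ, HasDerivWithinAt p 0 (Set.Icc 0 ℓ) x := by
    intro x hx
    have h := (((h1 x hx).const_mul k).mul (hc x).hasDerivWithinAt).sub
      ((h2 x hx).mul (hs x).hasDerivWithinAt)
    exact h.congr_deriv (by ring)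
  have hq' : ∀ x ∈ Set.Icc 0 ℓ, HasDerivWithinAt q 0 (Set.Icc 0 ℓ) x := by
    intro x hx
    have h := (((h1 x hx).const_mul k).mul (hs x).hasDerivWithinAt).add
      ((h2 x hx).mul (hc x).hasDerivWithinAt)
    exact h.congr_deriv (by ring)
  have hconst : ∀ f : ℝ → ℝ, (∀ x ∈ Set.Icc 0 ℓ, HasDerivWithinAt f 0 (Set.Icc 0 ℓ) x) →
      ∀ x ∈ Set.Icc 0 ℓ, f x = f ℓ := by
    intro f hf
    have h := constant_of_derivWithin_zero (f := f) (a := 0) (b := ℓ)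
      (fun x hx => (hf x hx).differentiableWithinAt)
      (fun x hx => (hf x (Set.Ico_subset_Icc_self hx)).derivWithin
        (uniqueDiffOn_Icc hℓ x (Set.Ico_subset_Icc_self hx)))
    intro x hx
    rw [h x hx, h ℓ (Set.right_mem_Icc.mpr hℓ.le)]
  intro x hx
  have hpx : p x = k * ψ ℓ := by rw [hconst p hp' x hx]; simp [hp]
  have hqx : q x = 0 := by rw [hconst q hq' x hx]; simp [hq, h3]
  simp only [hp] at hpx
  simp only [hq] at hqx
  have h4 := Real.sin_sq_add_cos_sq (k * (x - ℓ))
  constructor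
  · apply mul_left_cancel₀ hk.ne'
    linear_combination Real.cos (k * (x - ℓ)) * hpx + Real.sin (k * (x - ℓ)) * hqx - k * ψ x * h4
  · linear_combination Real.cos (k * (x - ℓ)) * hqx - Real.sin (k * (x - ℓ)) * hpx - φ x * h4

theorem isEigenfunction_cos [NeZero v] {L : Fin v → ℝ} (hpos : ∀ j, 0 < L j) {k c : ℝ} (hc : c ≠ 0)
    (hcos : ∀ j, Real.cos (k * L j) ≠ 0) (htan : k * tanSum L k = 0) :
    IsEigenfunction L k (fun j x => c / Real.cos (k * L j) * Real.cos (k * (x - L j))) := by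
  refine ⟨⟨fun j x => c / Real.cos (k * L j) * (-(k * Real.sin (k * (x - L j)))), ?_, ?_, ?_, ?_, ?_⟩, ?_⟩
  · intro j x _
    have h := (((hasDerivAt_id x).sub_const (L j)).const_mul k).cos.const_mul (c / Real.cos (k * L j))
    exact (h.congr_deriv (by simp only [id]; ring)).hasDerivWithinAt
  · intro j x _
    have h := ((((hasDerivAt_id x).sub_const (L j)).const_mul k).sin.const_mul k).neg.const_mul
      (c / Real.cos (k * L j))
    exact (h.congr_deriv (by simp only [id]; ring)).hasDerivWithinAt
  · intro i j
    simp only [zero_sub, mul_neg, Real.cos_neg]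
    rw [div_mul_cancel₀ _ (hcos i), div_mul_cancel₀ _ (hcos j)]
  · have : ∀ j, c / Real.cos (k * L j) * (-(k * Real.sin (k * (0 - L j))))
        = c * (k * Real.tan (k * L j)) := by
      intro j
      rw [Real.tan_eq_sin_div_cos]
      simp only [zero_sub, mul_neg, Real.sin_neg, neg_neg]
      ring
    simp only [this]
    rw [← Finset.mul_sum, ← Finset.mul_sum]
    simp only [tanSum] at htan
    rw [htan, mul_zero]
  · intro j; simp
  · refine ⟨0, L 0, Set.right_mem_Icc.mpr (hpos 0).le, ?_⟩
    simp only [sub_self, mul_zero, Real.cos_zero, mul_one]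
    exact div_ne_zero hc (hcos 0)

theorem IsEigenfunction.exists_eq_cos {L : Fin v → ℝ} (hL : SimplePoles L)
    (hpos : ∀ j, 0 < L j) {k : ℝ} (hk : 0 < k) {ψ : Fin v → ℝ → ℝ} (h : IsEigenfunction L k ψ) :
    (∀ j, Real.cos (k * L j) ≠ 0) ∧ tanSum L k = 0 ∧ ∃ c, ∀ j, ∀ x ∈ Set.Icc 0 (L j),
      ψ j x = c / Real.cos (k * L j) * Real.cos (k * (x - L j)) := by
  obtain ⟨⟨φ, h1, h2, h3, h4, h5⟩, j₀, x₀, hx₀, hne⟩ := h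
  have hsol := fun j => eq_cos_of_deriv (hpos j) hk (h1 j) (h2 j) (h5 j)
  have hψ0 : ∀ j, ψ j 0 = ψ j (L j) * Real.cos (k * L j) := by
    intro j
    rw [(hsol j 0 (Set.left_mem_Icc.mpr (hpos j).le)).1]
    simp
  have hφ0 : ∀ j, φ j 0 = k * ψ j (L j) * Real.sin (k * L j) := by
    intro j
    rw [(hsol j 0 (Set.left_mem_Icc.mpr (hpos j).le)).2]
    simp
  -- A vanishing cosine on bond l forces the central value to be zero. The function then vanishes on
  -- the other bonds, whose cosines do not vanish, and the derivative condition at the centre kills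
  -- it on bond l.
  have hcos : ∀ j, Real.cos (k * L j) ≠ 0 := by
    intro l hl
    have hc0 : ∀ j, ψ j 0 = 0 := fun j => by rw [h3 j l, hψ0 l, hl, mul_zero]
    have ha : ∀ j, j ≠ l → ψ j (L j) = 0 := by
      intro j hj
      have := hψ0 j
      rw [hc0 j] at this
      exact (mul_eq_zero.mp this.symm).resolve_right (hL k l j hj.symm hl)
    have hal : ψ l (L l) = 0 := by
      rw [Finset.sum_eq_single l (fun j _ hj => by rw [hφ0 j, ha j hj]; ring) (by simp), hφ0] at h4
      have hs : Real.sin (k * L l) ≠ 0 := fun hs => by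
        have := Real.sin_sq_add_cos_sq (k * L l)
        rw [hs, hl] at this
        norm_num at this
      simpa [hk.ne', hs] using h4
    refine hne ?_
    rw [(hsol j₀ x₀ hx₀).1]
    rcases eq_or_ne j₀ l with rfl | hj
    · rw [hal, zero_mul]
    · rw [ha _ hj, zero_mul]
  have hψ : ∀ j, ψ j (L j) = ψ j₀ 0 / Real.cos (k * L j) := fun j => by
    rw [eq_div_iff (hcos j), h3 j₀ j, hψ0 j]
  refine ⟨hcos, ?_, ψ j₀ 0, fun j x hx => ?_⟩
  · have hc : ψ j₀ 0 ≠ 0 := by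
      intro hc
      refine hne ?_
      rw [(hsol j₀ x₀ hx₀).1, hψ, hc]
      simp
    have : ∀ j, φ j 0 = (k * ψ j₀ 0) * Real.tan (k * L j) := fun j => by
      rw [hφ0, hψ, Real.tan_eq_sin_div_cos]; ring
    simp only [this] at h4
    rw [← Finset.mul_sum] at h4
    exact (mul_eq_zero.mp h4).resolve_left (mul_ne_zero hk.ne' hc)
  · rw [(hsol j x hx).1, hψ]

theorem mem_spectralSet_iff [NeZero v] {L : Fin v → ℝ} (hL : SimplePoles L) (hpos : ∀ j, 0 < L j)
    {k : ℝ} : k ∈ spectralSet L ↔ 0 ≤ k ∧ ∃ n : ℕ, phase L k = n * π := by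
  constructor
  · rintro ⟨hk, ψ, hψ⟩
    refine ⟨hk, ?_⟩
    rcases hk.eq_or_lt with rfl | hk
    · exact ⟨0, by simp⟩
    · obtain ⟨h1, h2, -⟩ := hψ.exists_eq_cos hL hpos hk
      rw [← tan_phase hL h1] at h2
      have hc : Real.cos (phase L k) ≠ 0 := fun h => by
        obtain ⟨j, hj⟩ := (cos_phase_eq_zero_iff hL).mp h
        exact h1 j hj
      rw [Real.tan_eq_sin_div_cos, div_eq_zero_iff] at h2
      obtain ⟨n, hn⟩ := Real.sin_eq_zero_iff.mp (h2.resolve_right hc)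
      have hp : 0 ≤ phase L k := by
        have := (strictMono_phase hL hpos).monotone hk.le
        rwa [phase_zero] at this
      have hn0 : 0 ≤ n := by
        rw [← hn] at hp
        exact_mod_cast nonneg_of_mul_nonneg_left hp Real.pi_pos
      obtain ⟨m, rfl⟩ := Int.eq_ofNat_of_zero_le hn0
      exact ⟨m, by rw [← hn]; simp⟩
  · rintro ⟨hk, n, hn⟩
    have hc : Real.cos (phase L k) ≠ 0 := by
      rw [hn, Real.cos_nat_mul_pi]
      exact pow_ne_zero _ (by norm_num)
    have hcos : ∀ j, Real.cos (k * L j) ≠ 0 := fun j hj =>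
      hc ((cos_phase_eq_zero_iff hL).mpr ⟨j, hj⟩)
    refine ⟨hk, _, isEigenfunction_cos hpos one_ne_zero hcos ?_⟩
    rw [← tan_phase hL hcos, hn, Real.tan_nat_mul_pi, mul_zero]

/-- The phase maps the spectrum increasingly onto the multiples nπ, n ≥ 0, so each infimum in the
recursion is attained. -/
theorem wavenumber_spec [NeZero v] {L : Fin v → ℝ} (hL : SimplePoles L) (hpos : ∀ j, 0 < L j)
    (n : ℕ) : 0 ≤ wavenumber L n ∧ phase L (wavenumber L n) = n * π := by
  have hmono := strictMono_phase hL hpos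
  have hpi := Real.pi_pos
  induction n with
  | zero =>
    have : IsLeast (spectralSet L) 0 :=
      ⟨(mem_spectralSet_iff hL hpos).mpr ⟨le_rfl, 0, by simp⟩, fun k hk => hk.1⟩
    rw [wavenumber, this.csInf_eq]
    simp
  | succ n ih =>
    obtain ⟨k, hk0, hk⟩ := exists_phase_eq hL hpos (θ := ((n + 1 : ℕ) : ℝ) * π) (by positivity)
    have : IsLeast {k | k ∈ spectralSet L ∧ wavenumber L n < k} k := by
      refine ⟨⟨(mem_spectralSet_iff hL hpos).mpr ⟨hk0, _, hk⟩, ?_⟩, ?_⟩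
      · rw [← hmono.lt_iff_lt, hk, ih.2]
        push_cast
        nlinarith
      · rintro q ⟨hq, hlt⟩
        obtain ⟨-, m, hm⟩ := (mem_spectralSet_iff hL hpos).mp hq
        rw [← hmono.lt_iff_lt, ih.2, hm] at hlt
        rw [← hmono.le_iff_le, hm, hk]
        have : n < m := by exact_mod_cast lt_of_mul_lt_mul_right hlt hpi.le
        have : ((n + 1 : ℕ) : ℝ) ≤ m := by exact_mod_cast this
        gcongr
    rw [wavenumber, this.csInf_eq]
    exact ⟨hk0, hk⟩

theorem integral_cos_sq_bond {k : ℝ} (hk : k ≠ 0) (a ℓ : ℝ) :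
    ∫ x in (0 : ℝ)..ℓ, |a * Real.cos (k * (x - ℓ))| ^ 2
      = a ^ 2 * (ℓ / 2 + Real.sin (k * ℓ) * Real.cos (k * ℓ) / (2 * k)) := by
  have hF : ∀ x, HasDerivAt (fun x => a ^ 2 * (x / 2 + Real.sin (k * (x - ℓ)) * Real.cos (k * (x - ℓ)) / (2 * k)))
      (|a * Real.cos (k * (x - ℓ))| ^ 2) x := by
    intro x
    have h0 := ((hasDerivAt_id x).sub_const ℓ).const_mul k
    have h := (((hasDerivAt_id x).div_const 2).add ((h0.sin.mul h0.cos).div_const (2 * k))).const_mul (a ^ 2)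
    refine h.congr_deriv ?_
    rw [sq_abs]
    have h4 := Real.sin_sq_add_cos_sq (k * (x - ℓ))
    simp only [id]
    field_simp
    linear_combination (-a ^ 2) * h4
  rw [intervalIntegral.integral_eq_sub_of_hasDerivAt (fun x _ => hF x)
    (Continuous.intervalIntegrable (by fun_prop) _ _)]
  simp
  ring

/-- The weight `Σ L_j (1 + y_j²)`. -/
def weight (L : Fin v → ℝ) (y : Fin v → ℝ) : ℝ := ∑ j, L j * (1 + y j ^ 2)

/-- The scaled maximum amplitude as a function of the tangents `y_j`. -/
def ampl (L : Fin v → ℝ) (i : Fin v) (y : Fin v → ℝ) : ℝ :=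
  (v : ℝ) ^ 2 * (2 * (1 + y i ^ 2) / weight L y)

theorem inv_cos_sq {x : ℝ} (hx : Real.cos x ≠ 0) : 1 / Real.cos x ^ 2 = 1 + Real.tan x ^ 2 := by
  rw [Real.tan_eq_sin_div_cos]
  field_simp
  rw [add_comm, Real.sin_sq_add_cos_sq]

/-- The boundary terms of the integrals of cos² add up to a multiple of Σ tan(k L_j), which is zero
at an eigenvalue; the formula is therefore exact, without a 1/k correction. -/
theorem integral_norm_sq {L : Fin v → ℝ} {k c : ℝ} (hk : k ≠ 0)
    (hcos : ∀ j, Real.cos (k * L j) ≠ 0) (htan : tanSum L k = 0) :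
    ∑ j, ∫ x in (0 : ℝ)..(L j), |c / Real.cos (k * L j) * Real.cos (k * (x - L j))| ^ 2
      = c ^ 2 / 2 * weight L (fun j => Real.tan (k * L j)) := by
  simp only [integral_cos_sq_bond hk]
  have : ∀ j, (c / Real.cos (k * L j)) ^ 2 * (L j / 2 + Real.sin (k * L j) * Real.cos (k * L j) / (2 * k))
      = c ^ 2 / 2 * (L j * (1 + Real.tan (k * L j) ^ 2)) + c ^ 2 / (2 * k) * Real.tan (k * L j) := by
    intro j
    rw [← inv_cos_sq (hcos j), Real.tan_eq_sin_div_cos]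
    have := hcos j
    field_simp
  simp only [this]
  rw [Finset.sum_add_distrib, ← Finset.mul_sum, ← Finset.mul_sum]
  simp only [tanSum] at htan
  rw [htan, weight]
  ring

theorem weight_pos [NeZero v] {L : Fin v → ℝ} (hpos : ∀ j, 0 < L j) (y : Fin v → ℝ) :
    0 < weight L y :=
  Finset.sum_pos (fun j _ => mul_pos (hpos j) (by positivity)) ⟨0, Finset.mem_univ _⟩

theorem cos_wavenumber_ne_zero [NeZero v] {L : Fin v → ℝ} (hL : SimplePoles L)
    (hpos : ∀ j, 0 < L j) (n : ℕ) (j : Fin v) : Real.cos (wavenumber L n * L j) ≠ 0 := fun hj => by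
  have h := (cos_phase_eq_zero_iff hL).mpr ⟨j, hj⟩
  rw [(wavenumber_spec hL hpos n).2, Real.cos_nat_mul_pi] at h
  exact pow_ne_zero _ (by norm_num) h

/-- The supremum is attained at the outer vertex x = L_i, where the cosine equals 1. Excluding n = 0
excludes k = 0, for which the trigonometric form is not available. -/
theorem maxAmplitudeSq_eq [NeZero v] {L : Fin v → ℝ} (hL : SimplePoles L) (hpos : ∀ j, 0 < L j)
    (i : Fin v) {n : ℕ} (hn : n ≠ 0) :
    (v : ℝ) ^ 2 * maxAmplitudeSq L i n = ampl L i (fun j => Real.tan (wavenumber L n * L j)) := by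
  obtain ⟨hk0, hk⟩ := wavenumber_spec hL hpos n
  have hkpos : 0 < wavenumber L n := by
    rcases hk0.eq_or_lt with h | h
    · rw [← h, phase_zero] at hk
      exact absurd hk.symm (mul_ne_zero (by exact_mod_cast hn) Real.pi_ne_zero)
    · exact h
  have hcos := cos_wavenumber_ne_zero hL hpos n
  rw [ampl, maxAmplitudeSq]
  congr 1
  set k := wavenumber L n
  set W := weight L (fun j => Real.tan (k * L j)) with hW
  have hWpos : 0 < W := weight_pos hpos _
  have htan : tanSum L k = 0 := by
    rw [← tan_phase hL hcos, hk, Real.tan_nat_mul_pi]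
  have hval : ∀ c : ℝ, c ^ 2 / 2 * W = 1 → (c / Real.cos (k * L i)) ^ 2
      = 2 * (1 + Real.tan (k * L i) ^ 2) / W := by
    intro c hc
    rw [← inv_cos_sq (hcos i), div_pow]
    have := hcos i
    field_simp
    linarith
  refine IsGreatest.csSup_eq ⟨?_, ?_⟩
  · have hc : (√(2 / W)) ^ 2 / 2 * W = 1 := by
      rw [Real.sq_sqrt (by positivity)]
      field_simp
    refine ⟨_, ⟨isEigenfunction_cos hpos (c := √(2 / W)) (by positivity) hcos (by rw [htan, mul_zero]), ?_⟩,
      L i, Set.right_mem_Icc.mpr (hpos i).le, ?_⟩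
    · rw [integral_norm_sq hkpos.ne' hcos htan, ← hW, hc]
    · simp only [sub_self, mul_zero, Real.cos_zero, mul_one, sq_abs]
      exact (hval _ hc).symm
  · rintro a ⟨ψ, ⟨hψ, hnorm⟩, x, hx, rfl⟩
    obtain ⟨-, -, c, hc⟩ := hψ.exists_eq_cos hL hpos hkpos
    have h1 : ∑ j, ∫ x in (0 : ℝ)..(L j), |ψ j x| ^ 2 = c ^ 2 / 2 * W := by
      rw [hW, ← integral_norm_sq hkpos.ne' hcos htan]
      refine Finset.sum_congr rfl fun j _ => intervalIntegral.integral_congr fun x hx => ?_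
      rw [Set.uIcc_of_le (hpos j).le] at hx
      simp only [hc j x hx]
    rw [hnorm] at h1
    rw [← hval c h1.symm, hc i x hx, sq_abs, mul_pow]
    have : Real.cos (k * (x - L i)) ^ 2 ≤ 1 := Real.cos_sq_le_one _
    nlinarith [sq_nonneg (c / Real.cos (k * L i))]

/-- A common zero of two cosines makes L_i / L_j a quotient of odd integers. -/
theorem simplePoles_of_linearIndependent {L : Fin v → ℝ} (h : LinearIndependent ℚ L) :
    SimplePoles L := by
  intro k i j hij hi hj
  obtain ⟨m, hm⟩ := Real.cos_eq_zero_iff.mp hi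
  obtain ⟨n, hn⟩ := Real.cos_eq_zero_iff.mp hj
  have hpair : LinearIndependent ℚ ![L i, L j] := by
    have := h.comp ![i, j] (by
      intro a b hab
      fin_cases a <;> fin_cases b <;> simp_all)
    convert this using 1
    ext a; fin_cases a <;> rfl
  have hk : k ≠ 0 := by
    rintro rfl
    simp at hi
  have hrel : ((2 * n + 1 : ℤ) : ℝ) * L i = ((2 * m + 1 : ℤ) : ℝ) * L j := by
    apply mul_left_cancel₀ hk
    push_cast
    linear_combination (2 * (n : ℝ) + 1) * hm - (2 * (m : ℝ) + 1) * hn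
  have h2 := (LinearIndependent.pair_iff.mp hpair) (((2 * n + 1 : ℤ) : ℚ)) (-((2 * m + 1 : ℤ) : ℚ)) (by
    simp only [Rat.smul_def]
    push_cast at hrel ⊢
    linarith)
  have : (2 * n + 1 : ℤ) = 0 := by exact_mod_cast h2.1
  omega

theorem int_sum_ne_zero_of_linearIndependent {L : Fin v → ℝ} (h : LinearIndependent ℚ L)
    (n : Fin v → ℤ) (hn : n ≠ 0) : ∑ j, (n j : ℝ) * L j ≠ 0 := by
  intro h0
  refine hn (funext fun j => ?_)
  have := Fintype.linearIndependent_iff.mp h (fun j => (n j : ℚ)) (by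
    simpa [Rat.smul_def] using h0) j
  exact_mod_cast this

end Spectrum

/-! ### An approximate delta function and its version in the phase variable. -/

section Bump

/-- The tent function. -/
def tent (u : ℝ) : ℝ := max 0 (1 - |u|)

theorem continuous_tent : Continuous tent := by unfold tent; fun_prop

theorem tent_nonneg (u : ℝ) : 0 ≤ tent u := le_max_left _ _

theorem tent_eq_zero {u : ℝ} (hu : 1 ≤ |u|) : tent u = 0 := max_eq_left (by linarith)

theorem integrable_tent : Integrable tent :=
  continuous_tent.integrable_of_hasCompactSupport
    (HasCompactSupport.intro (isCompact_Icc (a := -1) (b := 1)) fun x hx => tent_eq_zero (by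
      rw [Set.mem_Icc, ← abs_le] at hx
      exact (not_le.mp hx).le))

theorem integral_tent : ∫ u, tent u = 1 := by
  have h1 : ∫ u, tent u = ∫ u in (-1 : ℝ)..1, tent u := by
    rw [intervalIntegral.integral_of_le (by norm_num), ← integral_Icc_eq_integral_Ioc]
    refine (setIntegral_eq_integral_of_forall_compl_eq_zero fun x hx => tent_eq_zero ?_).symm
    rw [Set.mem_Icc, ← abs_le] at hx
    exact (not_le.mp hx).le
  rw [h1, ← intervalIntegral.integral_add_adjacent_intervals (b := 0)
    (continuous_tent.intervalIntegrable _ _) (continuous_tent.intervalIntegrable _ _)]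
  have h2 : ∫ u in (-1 : ℝ)..0, tent u = ∫ u in (-1 : ℝ)..0, (1 + u) := by
    refine intervalIntegral.integral_congr fun u hu => ?_
    rw [Set.uIcc_of_le (by norm_num)] at hu
    simp only [tent]
    rw [abs_of_nonpos hu.2, max_eq_right (by linarith [hu.1])]
    ring
  have h3 : ∫ u in (0 : ℝ)..1, tent u = ∫ u in (0 : ℝ)..1, (1 - u) := by
    refine intervalIntegral.integral_congr fun u hu => ?_
    rw [Set.uIcc_of_le (by norm_num)] at hu
    simp only [tent]
    rw [abs_of_nonneg hu.1, max_eq_right (by linarith [hu.2])]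
  rw [h2, h3, intervalIntegral.integral_add (by simp) (by simp),
    intervalIntegral.integral_sub (by simp) (by simp)]
  simp
  norm_num

/-- An approximate identity. -/
def bump (ε s : ℝ) : ℝ := ε⁻¹ * tent (s / ε)

theorem continuous_bump (ε : ℝ) : Continuous (bump ε) :=
  continuous_const.mul (continuous_tent.comp (continuous_id.div_const ε))

theorem bump_nonneg {ε : ℝ} (hε : 0 < ε) (s : ℝ) : 0 ≤ bump ε s :=
  mul_nonneg (by positivity) (tent_nonneg _)

theorem bump_eq_zero {ε : ℝ} (hε : 0 < ε) {s : ℝ} (hs : ε ≤ |s|) : bump ε s = 0 := by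
  rw [bump, tent_eq_zero, mul_zero]
  rw [abs_div, abs_of_pos hε, le_div_iff₀ hε]
  linarith

theorem integral_bump_mul {ε : ℝ} (hε : 0 < ε) (f : ℝ → ℝ) :
    ∫ s, bump ε s * f s = ∫ u, tent u * f (ε * u) := by
  have h := Measure.integral_comp_mul_left (fun s => bump ε s * f s) ε
  rw [abs_of_pos (inv_pos.mpr hε), smul_eq_mul] at h
  have h2 : ∫ s, bump ε s * f s = ε * ∫ u, bump ε (ε * u) * f (ε * u) := by
    rw [h]; field_simp
  rw [h2, ← integral_const_mul]
  refine integral_congr_ae (ae_of_all _ fun u => ?_)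
  simp only [bump]
  rw [mul_div_cancel_left₀ _ hε.ne']
  field_simp

/-- The bump function in the angular variable. -/
def angularBump (ε θ : ℝ) : ℝ :=
  tanExt (fun y : Fin 1 → ℝ => bump ε (y 0) * (1 + y 0 ^ 2)) (fun _ => θ / π)

theorem continuous_angularBump {ε : ℝ} (hε : 0 < ε) : Continuous (angularBump ε) := by
  unfold angularBump
  refine (continuous_tanExt (M := ε) ?_ ?_).comp (by fun_prop)
  · exact ((continuous_bump ε).comp (continuous_apply 0)).mul (by fun_prop)
  · rintro y ⟨j, hj⟩
    rw [Subsingleton.elim j 0] at hj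
    rw [bump_eq_zero hε hj, zero_mul]

theorem angularBump_eq {ε θ : ℝ} (hθ : Real.cos θ ≠ 0) :
    angularBump ε θ = bump ε (Real.tan θ) * (1 + Real.tan θ ^ 2) := by
  have h : π * (θ / π) = θ := by
    have := Real.pi_ne_zero
    field_simp
  simp only [angularBump, tanExt, h]
  rw [if_pos fun _ => hθ]

theorem periodic_angularBump (ε : ℝ) : Function.Periodic (angularBump ε) π := by
  intro θ
  refine tanExt_periodic _ (funext fun _ => ?_)
  rw [add_div, div_self Real.pi_ne_zero]
  simp

/-- The factor 1 + tan² is the Jacobian of θ ↦ tan θ, so this is the integral of the bump. The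
substitution is the one-dimensional case of `integral_tanExt`. -/
theorem integral_angularBump {ε : ℝ} (hε : 0 < ε) (n : ℤ) :
    ∫ θ in (n * π - π / 2)..(n * π + π / 2), angularBump ε θ = 1 := by
  have h0 : (n * π + π / 2 : ℝ) = (n * π - π / 2) + π := by ring
  rw [h0, (periodic_angularBump ε).intervalIntegral_add_eq _ (-π / 2)]
  have h1 := intervalIntegral.integral_comp_mul_left (a := -1 / 2) (b := 1 / 2)
    (fun θ => angularBump ε θ) Real.pi_ne_zero
  have e1 : π * (-1 / 2) = -π / 2 := by ring
  have e2 : π * (1 / 2) = -π / 2 + π := by ring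
  rw [e1, e2, smul_eq_mul] at h1
  have h2 : ∫ θ in (-π / 2)..(-π / 2 + π), angularBump ε θ
      = π * ∫ x in (-1 / 2 : ℝ)..(1 / 2), angularBump ε (π * x) := by
    rw [h1]
    have := Real.pi_ne_zero
    field_simp
  have hcont : Continuous fun y : Fin 1 → ℝ => bump ε (y 0) * (1 + y 0 ^ 2) :=
    ((continuous_bump ε).comp (continuous_apply 0)).mul (by fun_prop)
  have h3 := integral_tanExt hcont
  have mp1 := measurePreserving_piUnique (fun _ : Fin 1 => unifIoc)
  have mp2 := measurePreserving_piUnique (fun _ : Fin 1 => stdCauchy)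
  have h4 : ∫ x, tanExt (fun y : Fin 1 → ℝ => bump ε (y 0) * (1 + y 0 ^ 2)) x
      ∂(Measure.pi fun _ : Fin 1 => unifIoc) = ∫ x, angularBump ε (π * x) ∂unifIoc := by
    have := mp1.integral_comp' (g := fun x => angularBump ε (π * x))
    rw [← this]
    refine integral_congr_ae (ae_of_all _ fun x => ?_)
    simp only [angularBump]
    congr 1
    ext j
    rw [Subsingleton.elim j default]
    have := Real.pi_ne_zero
    field_simp
    rfl
  have h5 : ∫ y, bump ε (y 0) * (1 + y 0 ^ 2) ∂(Measure.pi fun _ : Fin 1 => stdCauchy)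
      = ∫ y, bump ε y * (1 + y ^ 2) ∂stdCauchy :=
    mp2.integral_comp' (g := fun y => bump ε y * (1 + y ^ 2))
  have h6 : ∫ y, bump ε y * (1 + y ^ 2) ∂stdCauchy = π⁻¹ := by
    rw [integral_stdCauchy]
    have : ∀ y : ℝ, (π * (1 + y ^ 2))⁻¹ * (bump ε y * (1 + y ^ 2)) = π⁻¹ * (bump ε y * 1) := by
      intro y
      have : (1 + y ^ 2) ≠ 0 := by positivity
      have := Real.pi_ne_zero
      field_simp
    simp only [this]
    rw [integral_const_mul, integral_bump_mul hε]
    simp [integral_tent]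
  rw [h2, intervalIntegral.integral_of_le (by norm_num)]
  change π * ∫ x, angularBump ε (π * x) ∂unifIoc = 1
  rw [← h4, h3, h5, h6, mul_inv_cancel₀ Real.pi_ne_zero]

end Bump

/-! ### The smoothed flux through the hyperplane and the continuity of the amplitude. -/

section Flux

variable {v : ℕ}

/-- A continuous cutoff of the box with half side `M`. -/
def cutoff (M : ℝ) (y : Fin v → ℝ) : ℝ := ∏ j, min 1 (max 0 (M - |y j|))

theorem continuous_cutoff (M : ℝ) : Continuous (cutoff M : (Fin v → ℝ) → ℝ) := by
  unfold cutoff; fun_prop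

theorem cutoff_nonneg (M : ℝ) (y : Fin v → ℝ) : 0 ≤ cutoff M y :=
  Finset.prod_nonneg fun _ _ => le_min zero_le_one (le_max_left _ _)

theorem cutoff_le_one (M : ℝ) (y : Fin v → ℝ) : cutoff M y ≤ 1 :=
  Finset.prod_le_one (fun _ _ => le_min zero_le_one (le_max_left _ _)) fun _ _ => min_le_left _ _

theorem cutoff_eq_zero {M : ℝ} {y : Fin v → ℝ} (h : ∃ j, M ≤ |y j|) : cutoff M y = 0 := by
  obtain ⟨j, hj⟩ := h
  refine Finset.prod_eq_zero (Finset.mem_univ j) ?_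
  rw [max_eq_left (by linarith), min_eq_right zero_le_one]

theorem cutoff_eq_one {M : ℝ} {y : Fin v → ℝ} (h : ∀ j, |y j| + 1 ≤ M) : cutoff M y = 1 := by
  refine Finset.prod_eq_one fun j _ => ?_
  rw [min_eq_left]
  exact le_max_of_le_right (by linarith [h j])

/-- The smoothed flux of `h ∘ ampl` through the hypersurface `Σ y_j = 0`. -/
def fluxFn (L : Fin v → ℝ) (i : Fin v) (h : ℝ → ℝ) (ε M : ℝ) (y : Fin v → ℝ) : ℝ :=
  bump ε (∑ j, y j) * weight L y * h (ampl L i y) * cutoff M y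

theorem continuous_weight (L : Fin v → ℝ) : Continuous (weight L) := by
  unfold weight; fun_prop

theorem continuous_ampl [NeZero v] {L : Fin v → ℝ} (hpos : ∀ j, 0 < L j) (i : Fin v) :
    Continuous (ampl L i) := by
  unfold ampl
  exact continuous_const.mul (Continuous.div (by fun_prop) (continuous_weight L)
    fun y => (weight_pos hpos y).ne')

theorem continuous_fluxFn [NeZero v] {L : Fin v → ℝ} (hpos : ∀ j, 0 < L j) (i : Fin v)
    {h : ℝ → ℝ} (hc : Continuous h) (ε M : ℝ) : Continuous (fluxFn L i h ε M) := by
  unfold fluxFn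
  exact ((((continuous_bump ε).comp (by fun_prop)).mul (continuous_weight L)).mul
    (hc.comp (continuous_ampl hpos i))).mul (continuous_cutoff M)

theorem fluxFn_eq_zero (L : Fin v → ℝ) (i : Fin v) (h : ℝ → ℝ) (ε M : ℝ) (y : Fin v → ℝ)
    (hy : ∃ j, M ≤ |y j|) : fluxFn L i h ε M y = 0 := by
  rw [fluxFn, cutoff_eq_zero hy, mul_zero]

theorem fluxFn_nonneg [NeZero v] {L : Fin v → ℝ} (hpos : ∀ j, 0 < L j) (i : Fin v) {h : ℝ → ℝ}
    (hnn : ∀ x, 0 ≤ h x) {ε : ℝ} (hε : 0 < ε) (M : ℝ) (y : Fin v → ℝ) : 0 ≤ fluxFn L i h ε M y :=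
  mul_nonneg (mul_nonneg (mul_nonneg (bump_nonneg hε _) (weight_pos hpos y).le) (hnn _))
    (cutoff_nonneg _ _)

theorem ampl_nonneg [NeZero v] {L : Fin v → ℝ} (hpos : ∀ j, 0 < L j) (i : Fin v) (y : Fin v → ℝ) :
    0 ≤ ampl L i y := by
  have := weight_pos hpos y
  unfold ampl
  positivity

theorem ampl_pos [NeZero v] {L : Fin v → ℝ} (hpos : ∀ j, 0 < L j) (i : Fin v) (y : Fin v → ℝ) :
    0 < ampl L i y := by
  have := weight_pos hpos y
  have : (0 : ℝ) < v := by exact_mod_cast Nat.pos_of_ne_zero (NeZero.ne v)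
  unfold ampl
  positivity

theorem ampl_le [NeZero v] {L : Fin v → ℝ} (hpos : ∀ j, 0 < L j) (i : Fin v) (y : Fin v → ℝ) :
    ampl L i y ≤ (v : ℝ) ^ 2 * (2 / L i) := by
  have hW := weight_pos hpos y
  unfold ampl
  gcongr ?_ * ?_
  rw [div_le_div_iff₀ hW (hpos i)]
  have : L i * (1 + y i ^ 2) ≤ weight L y :=
    Finset.single_le_sum (f := fun j => L j * (1 + y j ^ 2))
      (fun j _ => mul_nonneg (hpos j).le (by positivity)) (Finset.mem_univ i)
  linarith

theorem one_add_sq_le {a b ε : ℝ} (hε : 0 ≤ ε) (h : |a - b| ≤ ε) :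
    1 + a ^ 2 ≤ (1 + ε) ^ 2 * (1 + b ^ 2) := by
  have h1 : |a| ≤ |b| + ε := by
    calc |a| = |b + (a - b)| := by congr 1; ring
      _ ≤ |b| + |a - b| := abs_add_le _ _
      _ ≤ _ := by linarith
  have h2 : a ^ 2 ≤ (|b| + ε) ^ 2 := by
    rw [← sq_abs a]
    exact pow_le_pow_left₀ (abs_nonneg _) h1 2
  rw [← sq_abs b] at *
  nlinarith [sq_nonneg (|b| - 1), abs_nonneg b, mul_nonneg hε (sq_nonneg (|b| - 1)), mul_nonneg (sq_nonneg ε) (sq_nonneg b),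
    sq_nonneg (|b|), mul_nonneg hε (sq_nonneg (|b|))]

/-- Numerator and denominator each change by at most a factor (1 + ε)². A multiplicative estimate is
uniform over the unbounded range of the tangents. -/
theorem ampl_le_mul [NeZero v] {L : Fin v → ℝ} (hpos : ∀ j, 0 < L j) (i : Fin v)
    {y z : Fin v → ℝ} {ε : ℝ} (hε : 0 ≤ ε) (hyz : ∀ j, |y j - z j| ≤ ε) :
    ampl L i y ≤ (1 + ε) ^ 4 * ampl L i z := by
  have hWy := weight_pos hpos y
  have hWz := weight_pos hpos z
  have h1 : 1 + y i ^ 2 ≤ (1 + ε) ^ 2 * (1 + z i ^ 2) := one_add_sq_le hε (hyz i)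
  have h2 : weight L z ≤ (1 + ε) ^ 2 * weight L y := by
    unfold weight
    rw [Finset.mul_sum]
    refine Finset.sum_le_sum fun j _ => ?_
    have := one_add_sq_le hε (by rw [abs_sub_comm]; exact hyz j : |z j - y j| ≤ ε)
    nlinarith [hpos j]
  unfold ampl
  rw [mul_left_comm ((1 + ε) ^ 4)]
  gcongr ?_ * ?_
  rw [← mul_div_assoc, div_le_div_iff₀ hWy hWz]
  calc 2 * (1 + y i ^ 2) * weight L z
      ≤ 2 * ((1 + ε) ^ 2 * (1 + z i ^ 2)) * ((1 + ε) ^ 2 * weight L y) := by gcongr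
    _ = _ := by ring

theorem abs_ampl_sub_le [NeZero v] {L : Fin v → ℝ} (hpos : ∀ j, 0 < L j) (i : Fin v)
    {y z : Fin v → ℝ} {ε : ℝ} (hε : 0 ≤ ε) (hε1 : ε ≤ 1) (hyz : ∀ j, |y j - z j| ≤ ε) :
    |ampl L i y - ampl L i z| ≤ 15 * ((v : ℝ) ^ 2 * (2 / L i)) * ε := by
  have h1 := ampl_le_mul hpos i hε hyz
  have h2 := ampl_le_mul hpos i hε (fun j => by rw [abs_sub_comm]; exact hyz j : ∀ j, |z j - y j| ≤ ε)
  -- Convexity on [0, 1], with 15 = 2⁴ - 1.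
  have h3 : (1 + ε) ^ 4 ≤ 1 + 15 * ε := by
    nlinarith [mul_nonneg hε (sub_nonneg.mpr hε1), mul_nonneg (mul_nonneg hε hε) (sub_nonneg.mpr hε1),
      mul_nonneg (mul_nonneg (mul_nonneg hε hε) hε) (sub_nonneg.mpr hε1)]
  have h4 := ampl_le hpos i y
  have h5 := ampl_le hpos i z
  have h6 := ampl_nonneg hpos i y
  have h7 := ampl_nonneg hpos i z
  rw [abs_le]
  constructor <;> nlinarith

end Flux

/-! ### Flux through one branch, and a lower bound for the empirical means. -/

section FluxBound

variable {v : ℕ}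

theorem tan_le_tan_of_no_poles {L : Fin v → ℝ} (hpos : ∀ j, 0 < L j) {a b : ℝ} (hab : a ≤ b)
    (h : ∀ t ∈ Set.Icc a b, ∀ j, Real.cos (t * L j) ≠ 0) (j : Fin v) :
    Real.tan (a * L j) ≤ Real.tan (b * L j) := by
  have hd : ∀ t ∈ Set.Icc a b, HasDerivAt (fun t => Real.tan (t * L j))
      (1 / Real.cos (t * L j) ^ 2 * L j) t := by
    intro t ht
    have h1 : HasDerivAt (fun t : ℝ => t * L j) (L j) t := by
      simpa using (hasDerivAt_id t).mul_const (L j)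
    exact (Real.hasDerivAt_tan (h t ht j)).comp t h1
  have hmono : MonotoneOn (fun t => Real.tan (t * L j)) (Set.Icc a b) := by
    refine monotoneOn_of_deriv_nonneg (convex_Icc a b)
      (fun t ht => (hd t ht).continuousAt.continuousWithinAt)
      (fun t ht => (hd t (interior_subset ht)).differentiableAt.differentiableWithinAt) fun t ht => ?_
    rw [(hd t (interior_subset ht)).deriv]
    have := hpos j
    positivity
  exact hmono (Set.left_mem_Icc.mpr hab) (Set.right_mem_Icc.mpr hab) hab

theorem cos_ne_zero_of_phase {L : Fin v → ℝ} (hL : SimplePoles L) {t : ℝ} {n : ℤ}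
    (h1 : n * π - π / 2 < phase L t) (h2 : phase L t < n * π + π / 2) (j : Fin v) :
    Real.cos (t * L j) ≠ 0 := by
  intro hj
  have hc := (cos_phase_eq_zero_iff hL).mpr ⟨j, hj⟩
  have h3 : 0 < Real.cos (phase L t - n * π) :=
    Real.cos_pos_of_mem_Ioo ⟨by linarith, by linarith⟩
  rw [Real.cos_sub_int_mul_pi, hc, mul_zero] at h3
  exact lt_irrefl _ h3

/-- Between two consecutive poles all tangents increase, and their sum vanishes at z. The increments
from z thus have one common sign, and each is bounded by their total. -/
theorem abs_tan_sub_le [NeZero v] {L : Fin v → ℝ} (hL : SimplePoles L) (hpos : ∀ j, 0 < L j)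
    {z k : ℝ} {n : ℤ} (hz : phase L z = n * π)
    (h1 : n * π - π / 2 < phase L k) (h2 : phase L k < n * π + π / 2) (j : Fin v) :
    |Real.tan (k * L j) - Real.tan (z * L j)| ≤ |tanSum L k| := by
  have hmono := (strictMono_phase hL hpos).monotone
  have hpi := Real.pi_pos
  have hz0 : tanSum L z = 0 := by
    rw [← tan_phase hL (cos_ne_zero_of_phase hL (n := n) (by linarith) (by linarith)), hz, Real.tan_int_mul_pi]
  have key : tanSum L k = ∑ j, (Real.tan (k * L j) - Real.tan (z * L j)) := by
    rw [Finset.sum_sub_distrib]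
    change _ = tanSum L k - tanSum L z
    rw [hz0, sub_zero]
  rcases le_total z k with hzk | hzk
  · have hle := tan_le_tan_of_no_poles hpos hzk fun t ht j =>
      cos_ne_zero_of_phase hL (n := n) (by linarith [hmono ht.1]) (by linarith [hmono ht.2]) j
    have hnn : ∀ j ∈ Finset.univ, 0 ≤ Real.tan (k * L j) - Real.tan (z * L j) := fun j _ =>
      sub_nonneg.mpr (hle j)
    rw [key, abs_of_nonneg (hnn j (Finset.mem_univ j)), abs_of_nonneg (Finset.sum_nonneg hnn)]
    exact Finset.single_le_sum hnn (Finset.mem_univ j)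
  · have hle := tan_le_tan_of_no_poles hpos hzk fun t ht j =>
      cos_ne_zero_of_phase hL (n := n) (by linarith [hmono ht.1]) (by linarith [hmono ht.2]) j
    have hnn : ∀ j ∈ Finset.univ, 0 ≤ Real.tan (z * L j) - Real.tan (k * L j) := fun j _ =>
      sub_nonneg.mpr (hle j)
    have key2 : -tanSum L k = ∑ j, (Real.tan (z * L j) - Real.tan (k * L j)) := by
      rw [key, ← Finset.sum_neg_distrib]
      exact Finset.sum_congr rfl fun j _ => by ring
    rw [← abs_neg (tanSum L k), key2, abs_sub_comm, abs_of_nonneg (hnn j (Finset.mem_univ j)),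
      abs_of_nonneg (Finset.sum_nonneg hnn)]
    exact Finset.single_le_sum hnn (Finset.mem_univ j)

/-- The constant in the variation of `h ∘ ampl` along a short piece of a branch. -/
def fluxConst (L : Fin v → ℝ) (i : Fin v) (κ : ℝ) : ℝ := κ * (15 * ((v : ℝ) ^ 2 * (2 / L i)))

/-- Bump times weight is the angular bump of the phase times the derivative of the phase, with
integral 1 over a branch. On its support every tangent is within ε of its value at the eigenvalue z,
so h(ampl) is nearly constant there; the cutoff only lowers the left-hand side. -/
theorem integral_fluxFn_branch_le [NeZero v] {L : Fin v → ℝ} (hL : SimplePoles L)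
    (hpos : ∀ j, 0 < L j) (i : Fin v) {h : ℝ → ℝ} (hc : Continuous h) (hnn : ∀ x, 0 ≤ h x) {κ : ℝ}
    (hκ : 0 ≤ κ) (hlip : ∀ x y, |h x - h y| ≤ κ * |x - y|) {ε : ℝ} (hε : 0 < ε) (hε1 : ε ≤ 1) (M : ℝ)
    {z a b : ℝ} {n : ℤ} (hz : phase L z = n * π) (ha : phase L a = n * π - π / 2)
    (hb : phase L b = n * π + π / 2) :
    ∫ k in a..b, fluxFn L i h ε M (fun j => Real.tan (k * L j))
      ≤ h (ampl L i (fun j => Real.tan (z * L j))) + fluxConst L i κ * ε := by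
  have hsm := strictMono_phase hL hpos
  have hpi := Real.pi_pos
  have hab : a ≤ b := hsm.le_iff_le.mp (by rw [ha, hb]; linarith)
  set c := h (ampl L i (fun j => Real.tan (z * L j))) + fluxConst L i κ * ε with hcdef
  have hsub : ∫ k in a..b, angularBump ε (phase L k) * phaseDeriv L k = 1 := by
    have := intervalIntegral.integral_comp_mul_deriv (a := a) (b := b) (f := phase L)
      (f' := phaseDeriv L) (g := angularBump ε) (fun x _ => hasDerivAt_phase hL x)
      (continuous_phaseDeriv hL).continuousOn (continuous_angularBump hε)
    rw [ha, hb, integral_angularBump hε] at this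
    exact this
  have hint : IntervalIntegrable (fun k => angularBump ε (phase L k) * phaseDeriv L k * c) volume a b :=
    Continuous.intervalIntegrable ((((continuous_angularBump hε).comp (continuous_phase hL)).mul
      (continuous_phaseDeriv hL)).mul continuous_const) _ _
  calc ∫ k in a..b, fluxFn L i h ε M (fun j => Real.tan (k * L j))
      ≤ ∫ k in a..b, angularBump ε (phase L k) * phaseDeriv L k * c := by
        refine intervalIntegral.integral_mono_on_of_le_Ioo hab
          (intervalIntegrable_tan (fun j => (hpos j).ne') (continuous_fluxFn hpos i hc ε M)
            (fluxFn_eq_zero L i h ε M) a b) hint fun k hk => ?_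
        have hk1 : n * π - π / 2 < phase L k := by rw [← ha]; exact hsm hk.1
        have hk2 : phase L k < n * π + π / 2 := by rw [← hb]; exact hsm hk.2
        have hcos := cos_ne_zero_of_phase hL hk1 hk2
        have hcosΘ : Real.cos (phase L k) ≠ 0 := fun h0 => by
          obtain ⟨j, hj⟩ := (cos_phase_eq_zero_iff hL).mp h0
          exact hcos j hj
        rw [angularBump_eq hcosΘ, tan_phase hL hcos, mul_assoc (bump ε _), mul_comm (1 + _) (phaseDeriv L k),
          phaseDeriv_mul hL hcos]
        change bump ε (tanSum L k) * weight L (fun j => Real.tan (k * L j)) * h _ * cutoff M _ ≤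
          bump ε (tanSum L k) * weight L (fun j => Real.tan (k * L j)) * c
        have hw := (weight_pos hpos (fun j => Real.tan (k * L j))).le
        rcases le_or_gt ε |tanSum L k| with hs | hs
        · rw [bump_eq_zero hε hs]; simp
        · have hclose := fun j => (abs_tan_sub_le hL hpos hz hk1 hk2 j).trans hs.le
          have h1 := abs_ampl_sub_le hpos i hε.le hε1 hclose
          have h2 := hlip (ampl L i (fun j => Real.tan (k * L j)))
            (ampl L i (fun j => Real.tan (z * L j)))
          have h3 : h (ampl L i (fun j => Real.tan (k * L j))) ≤ c := by
            have h4 := (le_abs_self _).trans (h2.trans (mul_le_mul_of_nonneg_left h1 hκ))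
            rw [hcdef, fluxConst]
            linarith
          have h4 : h (ampl L i (fun j => Real.tan (k * L j))) * cutoff M (fun j => Real.tan (k * L j)) ≤ c :=
            (mul_le_of_le_one_right (hnn _) (cutoff_le_one _ _)).trans h3
          rw [mul_assoc _ (h _)]
          exact mul_le_mul_of_nonneg_left h4 (mul_nonneg (bump_nonneg hε _) hw)
    _ = c := by rw [intervalIntegral.integral_mul_const, hsub, one_mul]

/-- The empirical mean of `h` over the scaled maximum amplitudes. -/
def amplMean (L : Fin v → ℝ) (i : Fin v) (h : ℝ → ℝ) (N : ℕ) : ℝ :=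
  (N : ℝ)⁻¹ * ∑ n ∈ Finset.Icc 1 N, h ((v : ℝ) ^ 2 * maxAmplitudeSq L i n)

/-- Add the branch estimates for n = 1, …, N. The flux up to the end B_N of the last branch is B_N
times a convergent mean, and `phase_le` bounds B_N below by about Nπ / Σ L_j. -/
theorem exists_le_amplMean [NeZero v] {L : Fin v → ℝ} (hL : SimplePoles L)
    (hind : ∀ n : Fin v → ℤ, n ≠ 0 → ∑ j, (n j : ℝ) * L j ≠ 0)
    (hpos : ∀ j, 0 < L j) (i : Fin v) {h : ℝ → ℝ} (hc : Continuous h) (hnn : ∀ x, 0 ≤ h x) {κ : ℝ}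
    (hκ : 0 ≤ κ) (hlip : ∀ x y, |h x - h y| ≤ κ * |x - y|) {ε : ℝ} (hε : 0 < ε) (hε1 : ε ≤ 1) (M : ℝ) :
    ∃ s : ℕ → ℝ, Tendsto s atTop
      (𝓝 (π / (∑ j, L j) * (∫ y, fluxFn L i h ε M y ∂(Measure.pi fun _ : Fin v => stdCauchy))
        - fluxConst L i κ * ε)) ∧ ∀ᶠ N in atTop, s N ≤ amplMean L i h N := by
  have hpi := Real.pi_pos
  have hsm := strictMono_phase hL hpos
  set S := ∑ j, L j with hS
  have hSpos : 0 < S := Finset.sum_pos (fun j _ => hpos j) ⟨0, Finset.mem_univ _⟩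
  -- Branch n, containing the n-th eigenvalue, runs from B (n - 1) to B n. The piece before B 0
  -- belongs to n = 0 and is a constant that disappears after division by N.
  have hB : ∀ n : ℕ, ∃ k, 0 ≤ k ∧ phase L k = n * π + π / 2 := fun n =>
    exists_phase_eq hL hpos (by positivity)
  choose B hB0 hB using hB
  set I : ℝ → ℝ := fun K => ∫ k in (0 : ℝ)..K, fluxFn L i h ε M (fun j => Real.tan (k * L j)) with hI
  have hint := intervalIntegrable_tan (fun j => (hpos j).ne') (continuous_fluxFn hpos i hc ε M)
    (fluxFn_eq_zero L i h ε M)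
  have hsum : ∀ N : ℕ, I (B N) ≤ I (B 0) + ∑ n ∈ Finset.Icc 1 N,
      (h ((v : ℝ) ^ 2 * maxAmplitudeSq L i n) + fluxConst L i κ * ε) := by
    intro N
    induction N with
    | zero => simp
    | succ N ih =>
      rw [Finset.sum_Icc_succ_top (by omega), ← add_assoc]
      have h1 : I (B (N + 1)) = I (B N) + ∫ k in (B N)..(B (N + 1)),
          fluxFn L i h ε M (fun j => Real.tan (k * L j)) :=
        (intervalIntegral.integral_add_adjacent_intervals (hint _ _) (hint _ _)).symm
      rw [h1]
      refine add_le_add ih ?_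
      rw [maxAmplitudeSq_eq hL hpos i (Nat.succ_ne_zero N)]
      refine integral_fluxFn_branch_le hL hpos i hc hnn hκ hlip hε hε1 M (n := (N : ℤ) + 1) ?_ ?_ ?_
      · rw [(wavenumber_spec hL hpos (N + 1)).2]; push_cast; ring
      · rw [hB]; push_cast; ring
      · rw [hB]; push_cast; ring
  have hBlow : ∀ N : ℕ, (N * π - (v + 1) * π) / S ≤ B N := by
    intro N
    have := phase_le hL hpos (hB0 N)
    rw [hB, ← hS] at this
    rw [div_le_iff₀ hSpos]
    linarith
  have hBtop : Tendsto B atTop atTop := by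
    refine tendsto_atTop_mono hBlow ?_
    refine Tendsto.atTop_div_const hSpos ?_
    exact tendsto_atTop_add_const_right _ _ (tendsto_natCast_atTop_atTop.atTop_mul_const hpi)
  set J := ∫ y, fluxFn L i h ε M y ∂(Measure.pi fun _ : Fin v => stdCauchy) with hJ
  have hmean : Tendsto (fun N => (B N)⁻¹ * I (B N)) atTop (𝓝 J) :=
    (tendsto_mean_tan hind (continuous_fluxFn hpos i hc ε M) (fluxFn_eq_zero L i h ε M)).comp hBtop
  have hInn : ∀ N, 0 ≤ I (B N) := fun N =>
    intervalIntegral.integral_nonneg (hB0 N) fun k _ => fluxFn_nonneg hpos i hnn hε M _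
  have hinv : Tendsto (fun N : ℕ => ((N : ℝ))⁻¹) atTop (𝓝 0) := tendsto_inv_atTop_nhds_zero_nat
  refine ⟨fun N => (π / S - (v + 1) * π / S * (N : ℝ)⁻¹) * ((B N)⁻¹ * I (B N))
    - I (B 0) * (N : ℝ)⁻¹ - fluxConst L i κ * ε, ?_, ?_⟩
  · have h1 := (((tendsto_const_nhds (x := π / S)).sub (hinv.const_mul ((v + 1) * π / S))).mul hmean).sub
      (hinv.const_mul (I (B 0)))
    have h2 := h1.sub_const (fluxConst L i κ * ε)
    simpa using h2
  · filter_upwards [eventually_gt_atTop 0, hBtop.eventually_gt_atTop 0] with N hN hBN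
    have hN' : (0 : ℝ) < N := by exact_mod_cast hN
    have h1 := hsum N
    rw [Finset.sum_add_distrib, Finset.sum_const, Nat.card_Icc, Nat.add_sub_cancel, nsmul_eq_mul] at h1
    have h2 : (N : ℝ)⁻¹ * I (B N) ≤ I (B 0) * (N : ℝ)⁻¹ + amplMean L i h N + fluxConst L i κ * ε := by
      have := mul_le_mul_of_nonneg_left h1 (inv_nonneg.mpr hN'.le)
      refine this.trans (le_of_eq ?_)
      rw [amplMean]
      field_simp
      ring
    have h3 : (π / S - (v + 1) * π / S * (N : ℝ)⁻¹) * ((B N)⁻¹ * I (B N)) ≤ (N : ℝ)⁻¹ * I (B N) := by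
      have h4 : π / S - (v + 1) * π / S * (N : ℝ)⁻¹ ≤ (N : ℝ)⁻¹ * B N := by
        have := mul_le_mul_of_nonneg_left (hBlow N) (inv_nonneg.mpr hN'.le)
        refine le_trans (le_of_eq ?_) this
        field_simp
      have h5 : 0 ≤ (B N)⁻¹ * I (B N) := mul_nonneg (inv_nonneg.mpr hBN.le) (hInn N)
      refine (mul_le_mul_of_nonneg_right h4 h5).trans (le_of_eq ?_)
      field_simp
    linarith

end FluxBound

/-! ### From Lipschitz test functions to distribution functions. -/

section Ramp

/-- The piecewise linear function that is `1` up to `c` and `0` from `c + δ` on. -/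
def ramp (c δ x : ℝ) : ℝ := min 1 (max 0 ((c + δ - x) / δ))

theorem continuous_ramp (c δ : ℝ) : Continuous (ramp c δ) := by unfold ramp; fun_prop

theorem ramp_nonneg (c δ x : ℝ) : 0 ≤ ramp c δ x := le_min zero_le_one (le_max_left _ _)

theorem ramp_le_one (c δ x : ℝ) : ramp c δ x ≤ 1 := min_le_left _ _

theorem ramp_eq_one {c δ x : ℝ} (hδ : 0 < δ) (hx : x ≤ c) : ramp c δ x = 1 := by
  refine min_eq_left (le_max_of_le_right ?_)
  rw [le_div_iff₀ hδ]; linarith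

theorem ramp_eq_zero {c δ x : ℝ} (hδ : 0 < δ) (hx : c + δ ≤ x) : ramp c δ x = 0 := by
  rw [ramp, max_eq_left, min_eq_right zero_le_one]
  exact div_nonpos_of_nonpos_of_nonneg (by linarith) hδ.le

theorem abs_ramp_sub_le {c δ : ℝ} (hδ : 0 < δ) (x y : ℝ) :
    |ramp c δ x - ramp c δ y| ≤ δ⁻¹ * |x - y| := by
  unfold ramp
  refine (abs_min_sub_min_le_max _ _ _ _).trans ?_
  simp only [sub_self, abs_zero]
  refine max_le (by positivity) ((abs_max_sub_max_le_max _ _ _ _).trans ?_)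
  simp only [sub_self, abs_zero]
  refine max_le (by positivity) (le_of_eq ?_)
  rw [← sub_div, abs_div, abs_of_pos hδ, show c + δ - x - (c + δ - y) = y - x by ring, abs_sub_comm]
  field_simp

/-- The indicator of x < R lies between ramps ending and ramps starting at R. As their width
shrinks, the integrals tend to the mass below R, excluding and including R respectively, and these
agree when R is not an atom. -/
theorem tendsto_of_ramp {ν : Measure ℝ} [IsProbabilityMeasure ν] {R : ℝ} (hR : ν {R} = 0)
    (A : ℕ → (ℝ → ℝ) → ℝ) (a : ℕ → ℝ)
    (hA : ∀ c δ, 0 < δ → Tendsto (fun n => A n (ramp c δ)) atTop (𝓝 (∫ x, ramp c δ x ∂ν)))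
    (hlow : ∀ δ, 0 < δ → ∀ᶠ n in atTop, A n (ramp (R - δ) δ) ≤ a n)
    (hup : ∀ δ, 0 < δ → ∀ᶠ n in atTop, a n ≤ A n (ramp R δ)) :
    Tendsto a atTop (𝓝 (ν.real (Set.Iio R))) := by
  set d : ℕ → ℝ := fun m => 1 / ((m : ℝ) + 1) with hd
  have hdpos : ∀ m, 0 < d m := fun m => by simp only [hd]; positivity
  have hd0 : Tendsto d atTop (𝓝 0) := tendsto_one_div_add_atTop_nhds_zero_nat
  have h1 : Tendsto (fun m => ∫ x, ramp (R - d m) (d m) x ∂ν) atTop (𝓝 (ν.real (Set.Iio R))) := by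
    rw [← integral_indicator_one measurableSet_Iio]
    refine tendsto_integral_of_dominated_convergence (fun _ => 1)
      (fun m => (continuous_ramp _ _).aestronglyMeasurable) (integrable_const 1)
      (fun m => ae_of_all _ fun x => ?_) (ae_of_all _ fun x => ?_)
    · rw [Real.norm_of_nonneg (ramp_nonneg _ _ _)]; exact ramp_le_one _ _ _
    · rcases lt_or_ge x R with hx | hx
      · rw [Set.indicator_of_mem (show x ∈ Set.Iio R from hx)]
        refine tendsto_const_nhds.congr' ?_
        filter_upwards [hd0.eventually_lt_const (sub_pos.mpr hx)] with m hm
        rw [ramp_eq_one (hdpos m) (by linarith)]; rfl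
      · rw [Set.indicator_of_notMem (by simpa using hx)]
        refine tendsto_const_nhds.congr fun m => ?_
        rw [ramp_eq_zero (hdpos m) (by linarith)]
  have h2 : Tendsto (fun m => ∫ x, ramp R (d m) x ∂ν) atTop (𝓝 (ν.real (Set.Iio R))) := by
    have h3 : ν.real (Set.Iio R) = ν.real (Set.Iic R) := by
      have h4 : Set.Iio R =ᵐ[ν] Set.Iic R := Iio_ae_eq_Iic' hR
      exact measureReal_congr h4
    rw [h3, ← integral_indicator_one measurableSet_Iic]
    refine tendsto_integral_of_dominated_convergence (fun _ => 1)
      (fun m => (continuous_ramp _ _).aestronglyMeasurable) (integrable_const 1)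
      (fun m => ae_of_all _ fun x => ?_) (ae_of_all _ fun x => ?_)
    · rw [Real.norm_of_nonneg (ramp_nonneg _ _ _)]; exact ramp_le_one _ _ _
    · rcases le_or_gt x R with hx | hx
      · rw [Set.indicator_of_mem (show x ∈ Set.Iic R from hx)]
        refine tendsto_const_nhds.congr fun m => ?_
        rw [ramp_eq_one (hdpos m) (by linarith)]; rfl
      · rw [Set.indicator_of_notMem (by simpa using hx)]
        refine tendsto_const_nhds.congr' ?_
        filter_upwards [hd0.eventually_lt_const (sub_pos.mpr hx)] with m hm
        rw [ramp_eq_zero (hdpos m) (by linarith)]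
  rw [tendsto_order]
  constructor
  · intro b hb
    obtain ⟨m, hm⟩ := (h1.eventually_const_lt hb).exists
    filter_upwards [(hA (R - d m) (d m) (hdpos m)).eventually_const_lt hm, hlow _ (hdpos m)] with n h3 h4
    linarith
  · intro b hb
    obtain ⟨m, hm⟩ := (h2.eventually_lt_const hb).exists
    filter_upwards [(hA R (d m) (hdpos m)).eventually_lt_const hm, hup _ (hdpos m)] with n h3 h4
    linarith

end Ramp

/-! ### The limiting law for a fixed graph. -/

section LimitLaw

variable {n : ℕ}

/-- The point of the hyperplane `Σ y_j = s` with coordinates `z`, apart from the `l`-th one. -/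
def slice (l : Fin (n + 1)) (s : ℝ) (z : Fin n → ℝ) : Fin (n + 1) → ℝ :=
  l.insertNth (s - ∑ j, z j) z

theorem continuous_insertNth (l : Fin (n + 1)) :
    Continuous fun p : ℝ × (Fin n → ℝ) => (l.insertNth p.1 p.2 : Fin (n + 1) → ℝ) := by
  refine continuous_pi fun j => ?_
  refine Fin.succAboveCases l ?_ ?_ j
  · simpa using continuous_fst
  · intro j'
    simp only [Fin.insertNth_apply_succAbove]
    fun_prop

theorem continuous_slice (l : Fin (n + 1)) :
    Continuous fun p : ℝ × (Fin n → ℝ) => slice l p.1 p.2 :=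
  (continuous_insertNth l).comp (f := fun p : ℝ × (Fin n → ℝ) => (p.1 - ∑ j, p.2 j, p.2)) (by fun_prop)

theorem integral_pi_insertNth (l : Fin (n + 1)) {F : (Fin (n + 1) → ℝ) → ℝ} (hF : Continuous F)
    {M : ℝ} (hM : ∀ y, (∃ j, M ≤ |y j|) → F y = 0) :
    ∫ y, F y ∂(Measure.pi fun _ : Fin (n + 1) => stdCauchy)
      = ∫ z, (∫ t, F (l.insertNth t z) ∂stdCauchy) ∂(Measure.pi fun _ : Fin n => stdCauchy) := by
  have hmp := (measurePreserving_piFinSuccAbove (fun _ : Fin (n + 1) => stdCauchy) l).symm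
  have h1 := hmp.integral_comp' (g := F)
  rw [← h1]
  have hint : Integrable F (Measure.pi fun _ : Fin (n + 1) => stdCauchy) := by
    obtain ⟨C, hC⟩ := (isCompact_univ_pi fun _ : Fin (n + 1) => isCompact_Icc (a := -M) (b := M)).exists_bound_of_continuousOn hF.continuousOn
    refine Integrable.of_bound hF.aestronglyMeasurable (max C 0) (ae_of_all _ fun y => ?_)
    by_cases hy : ∃ j, M ≤ |y j|
    · rw [hM y hy]; simp
    · push Not at hy
      exact (hC y fun j _ => abs_le.mp (hy j).le).trans (le_max_left _ _)
  have h2 := (hmp.integrable_comp_emb (MeasurableEquiv.measurableEmbedding _)).mpr hint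
  exact integral_prod_symm _ h2

/-- Expand the weight. In the l-th term the factor 1 + y_l² cancels the Cauchy density of y_l up to
1/π, so y_l is integrated against Lebesgue measure and the sum s = Σ y_j can replace it as variable.
-/
theorem integral_fluxFn (L : Fin (n + 1) → ℝ) (hpos : ∀ j, 0 < L j) (i : Fin (n + 1)) {h : ℝ → ℝ}
    (hc : Continuous h) {ε : ℝ} (hε : 0 < ε) (M : ℝ) :
    ∫ y, fluxFn L i h ε M y ∂(Measure.pi fun _ : Fin (n + 1) => stdCauchy)
      = ∑ l, L l / π * ∫ z, (∫ u, tent u * (h (ampl L i (slice l (ε * u) z)) *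
          cutoff M (slice l (ε * u) z))) ∂(Measure.pi fun _ : Fin n => stdCauchy) := by
  set F : Fin (n + 1) → (Fin (n + 1) → ℝ) → ℝ := fun l y =>
    bump ε (∑ j, y j) * (1 + y l ^ 2) * (h (ampl L i y) * cutoff M y) with hF
  have hFc : ∀ l, Continuous (F l) := fun l =>
    (((continuous_bump ε).comp (by fun_prop)).mul (by fun_prop)).mul
      ((hc.comp (continuous_ampl hpos i)).mul (continuous_cutoff M))
  have hF0 : ∀ l, ∀ y, (∃ j, M ≤ |y j|) → F l y = 0 := fun l y hy => by
    simp only [hF]; rw [cutoff_eq_zero hy]; simp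
  have hint : ∀ l, Integrable (F l) (Measure.pi fun _ : Fin (n + 1) => stdCauchy) := by
    intro l
    obtain ⟨C, hC⟩ := (isCompact_univ_pi fun _ : Fin (n + 1) => isCompact_Icc (a := -M) (b := M)).exists_bound_of_continuousOn (hFc l).continuousOn
    refine Integrable.of_bound (hFc l).aestronglyMeasurable (max C 0) (ae_of_all _ fun y => ?_)
    by_cases hy : ∃ j, M ≤ |y j|
    · rw [hF0 l y hy]; simp
    · push Not at hy
      exact (hC y fun j _ => abs_le.mp (hy j).le).trans (le_max_left _ _)
  have hsum : ∀ y, fluxFn L i h ε M y = ∑ l, L l * F l y := by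
    intro y
    simp only [fluxFn, weight, hF, Finset.mul_sum, Finset.sum_mul]
    exact Finset.sum_congr rfl fun l _ => by ring
  simp only [hsum]
  rw [integral_finsetSum _ fun l _ => (hint l).const_mul (L l)]
  refine Finset.sum_congr rfl fun l _ => ?_
  rw [integral_const_mul, integral_pi_insertNth l (hFc l) (hF0 l), div_mul_eq_mul_div, mul_div_assoc]
  congr 1
  rw [div_eq_inv_mul, ← integral_const_mul]
  refine integral_congr_ae (ae_of_all _ fun z => ?_)
  simp only
  rw [integral_stdCauchy, ← integral_bump_mul hε (fun s => h (ampl L i (slice l s z)) * cutoff M (slice l s z)),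
    ← integral_const_mul]
  -- Translation invariance: the l-th coordinate becomes s minus the sum of the others.
  rw [← integral_sub_right_eq_self _ (∑ j, z j)]
  refine integral_congr_ae (ae_of_all _ fun s => ?_)
  simp only [hF]
  have h1 : ∑ j, (l.insertNth (s - ∑ j, z j) z : Fin (n + 1) → ℝ) j = s := by
    rw [Fin.sum_univ_succAbove _ l]
    simp
  rw [h1, Fin.insertNth_apply_same]
  change _ = π⁻¹ * (bump ε s * (h (ampl L i (slice l s z)) * cutoff M (slice l s z)))
  change _ * (_ * _ * (h (ampl L i (slice l s z)) * cutoff M (slice l s z))) = _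
  have : (1 + (s - ∑ j, z j) ^ 2) ≠ 0 := by positivity
  have := Real.pi_ne_zero
  field_simp

/-- The limit, for large `N`, of the empirical means. -/
def limMean (L : Fin (n + 1) → ℝ) (i : Fin (n + 1)) (h : ℝ → ℝ) : ℝ :=
  ∑ l, L l / (∑ j, L j) * ∫ z, h (ampl L i (slice l 0 z)) ∂(Measure.pi fun _ : Fin n => stdCauchy)

/-- Bump width and cutoff are tied together, ε = 1/(m+1) and M = m. Dominated convergence is applied
inside, in u, and outside, in z. -/
theorem tendsto_integral_fluxFn (L : Fin (n + 1) → ℝ) (hpos : ∀ j, 0 < L j) (i : Fin (n + 1))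
    {h : ℝ → ℝ} (hc : Continuous h) (hnn : ∀ x, 0 ≤ h x) (h1 : ∀ x, h x ≤ 1) :
    Tendsto (fun m : ℕ => π / (∑ j, L j) *
      ∫ y, fluxFn L i h (1 / ((m : ℝ) + 1)) m y ∂(Measure.pi fun _ : Fin (n + 1) => stdCauchy))
      atTop (𝓝 (limMean L i h)) := by
  have hε : ∀ m : ℕ, (0 : ℝ) < 1 / ((m : ℝ) + 1) := fun m => by positivity
  have hε0 : Tendsto (fun m : ℕ => 1 / ((m : ℝ) + 1)) atTop (𝓝 0) :=
    tendsto_one_div_add_atTop_nhds_zero_nat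
  simp only [integral_fluxFn L hpos i hc (hε _), limMean, Finset.mul_sum]
  refine tendsto_finsetSum _ fun l _ => ?_
  have hcoef : ∀ x : ℝ, π / (∑ j, L j) * (L l / π * x) = L l / (∑ j, L j) * x := fun x => by
    have := Real.pi_ne_zero
    field_simp
  simp only [hcoef]
  refine Tendsto.const_mul _ ?_
  have hbd : ∀ (m : ℕ) (z : Fin n → ℝ) (u : ℝ), ‖tent u * (h (ampl L i (slice l (1 / ((m : ℝ) + 1) * u) z)) *
      cutoff m (slice l (1 / ((m : ℝ) + 1) * u) z))‖ ≤ tent u := by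
    intro m z u
    rw [Real.norm_of_nonneg (mul_nonneg (tent_nonneg _) (mul_nonneg (hnn _) (cutoff_nonneg _ _)))]
    exact mul_le_of_le_one_right (tent_nonneg _)
      (mul_le_one₀ (h1 _) (cutoff_nonneg _ _) (cutoff_le_one _ _))
  have hcont : ∀ m : ℕ, Continuous fun p : (Fin n → ℝ) × ℝ =>
      tent p.2 * (h (ampl L i (slice l (1 / ((m : ℝ) + 1) * p.2) p.1)) *
      cutoff m (slice l (1 / ((m : ℝ) + 1) * p.2) p.1)) := by
    intro m
    have hs : Continuous fun p : (Fin n → ℝ) × ℝ => slice l (1 / ((m : ℝ) + 1) * p.2) p.1 :=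
      (continuous_slice l).comp (f := fun p : (Fin n → ℝ) × ℝ => (1 / ((m : ℝ) + 1) * p.2, p.1))
        (by fun_prop)
    exact (continuous_tent.comp continuous_snd).mul
      ((hc.comp ((continuous_ampl hpos i).comp hs)).mul ((continuous_cutoff m).comp hs))
  refine tendsto_integral_of_dominated_convergence (fun _ => 1) (fun m => ?_) (integrable_const 1)
    (fun m => ae_of_all _ fun z => ?_) (ae_of_all _ fun z => ?_)
  · exact ((hcont m).stronglyMeasurable.integral_prod_right').aestronglyMeasurable
  · calc _ ≤ ∫ u, tent u := norm_integral_le_of_norm_le integrable_tent (ae_of_all _ fun u => hbd m z u)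
      _ = 1 := integral_tent
  · have hlim : h (ampl L i (slice l 0 z)) = ∫ u, tent u * h (ampl L i (slice l 0 z)) := by
      rw [integral_mul_const, integral_tent, one_mul]
    rw [hlim]
    refine tendsto_integral_of_dominated_convergence tent (fun m => ?_) integrable_tent
      (fun m => ae_of_all _ fun u => hbd m z u) (ae_of_all _ fun u => ?_)
    · exact ((hcont m).comp (f := fun u : ℝ => (z, u)) (by fun_prop)).aestronglyMeasurable
    · have hsl : Tendsto (fun m : ℕ => slice l (1 / ((m : ℝ) + 1) * u) z) atTop (𝓝 (slice l 0 z)) := by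
        have h2 : Tendsto (fun m : ℕ => (1 / ((m : ℝ) + 1) * u, z)) atTop (𝓝 ((0 : ℝ), z)) := by
          refine Tendsto.prodMk_nhds ?_ tendsto_const_nhds
          simpa using hε0.mul_const u
        exact ((continuous_slice l).tendsto _).comp h2
      refine Tendsto.const_mul _ ?_
      have h3 := (hc.tendsto _).comp (((continuous_ampl hpos i).tendsto _).comp hsl)
      refine h3.congr' ?_
      have h4 : ∀ᶠ m : ℕ in atTop, ∀ j, |slice l (1 / ((m : ℝ) + 1) * u) z j| + 1 ≤ m := by
        rw [eventually_all]
        intro j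
        have h5 := ((tendsto_pi_nhds.mp hsl j).abs).eventually_lt_const (lt_add_one _)
        filter_upwards [h5, eventually_ge_atTop ⌈|slice l 0 z j| + 2⌉₊] with m h6 h7
        have := Nat.ceil_le.mp h7
        linarith
      filter_upwards [h4] with m hm
      rw [cutoff_eq_one hm, mul_one]
      rfl

theorem limMean_one_sub {L : Fin (n + 1) → ℝ} (hpos : ∀ j, 0 < L j) (i : Fin (n + 1))
    {h : ℝ → ℝ} (hc : Continuous h) (hnn : ∀ x, 0 ≤ h x) (h1 : ∀ x, h x ≤ 1) :
    limMean L i (fun x => 1 - h x) = 1 - limMean L i h := by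
  have hS : 0 < ∑ j, L j := Finset.sum_pos (fun j _ => hpos j) ⟨0, Finset.mem_univ _⟩
  have hterm : ∀ l, ∫ z, (1 - h (ampl L i (slice l 0 z))) ∂(Measure.pi fun _ : Fin n => stdCauchy)
      = 1 - ∫ z, h (ampl L i (slice l 0 z)) ∂(Measure.pi fun _ : Fin n => stdCauchy) := by
    intro l
    rw [integral_sub (integrable_const 1)]
    · simp
    · refine Integrable.of_bound (C := 1) ?_ (ae_of_all _ fun z => ?_)
      · have hs : Continuous fun z : Fin n → ℝ => slice l 0 z :=
          (continuous_slice l).comp (f := fun z : Fin n → ℝ => ((0 : ℝ), z)) (by fun_prop)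
        exact (hc.comp ((continuous_ampl hpos i).comp hs)).aestronglyMeasurable
      · rw [Real.norm_of_nonneg (hnn _)]; exact h1 _
  simp only [limMean, hterm, mul_sub, mul_one]
  rw [Finset.sum_sub_distrib, ← Finset.sum_div, div_self hS.ne']

theorem tendsto_amplMean {L : Fin (n + 1) → ℝ} (hlin : LinearIndependent ℚ L)
    (hpos : ∀ j, 0 < L j) (i : Fin (n + 1)) {h : ℝ → ℝ} (hnn : ∀ x, 0 ≤ h x) (h1 : ∀ x, h x ≤ 1)
    {κ : ℝ} (hκ : 0 ≤ κ) (hlip : ∀ x y, |h x - h y| ≤ κ * |x - y|) :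
    Tendsto (amplMean L i h) atTop (𝓝 (limMean L i h)) := by
  have hcont : ∀ g : ℝ → ℝ, (∀ x y, |g x - g y| ≤ κ * |x - y|) → Continuous g := fun g hg =>
    (LipschitzWith.of_dist_le_mul (K := ⟨κ, hκ⟩) fun x y => by
      rw [Real.dist_eq, Real.dist_eq]; exact hg x y).continuous
  have hlow : ∀ g : ℝ → ℝ, (∀ x, 0 ≤ g x) → (∀ x, g x ≤ 1) → (∀ x y, |g x - g y| ≤ κ * |x - y|) →
      ∀ b < limMean L i g, ∀ᶠ N in atTop, b < amplMean L i g N := by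
    intro g g0 g1 hg b hb
    have hε0 : Tendsto (fun m : ℕ => 1 / ((m : ℝ) + 1)) atTop (𝓝 0) :=
      tendsto_one_div_add_atTop_nhds_zero_nat
    have h2 := (tendsto_integral_fluxFn L hpos i (hcont g hg) g0 g1).sub (hε0.const_mul (fluxConst L i κ))
    rw [mul_zero, sub_zero] at h2
    obtain ⟨m, hm⟩ := (h2.eventually_const_lt hb).exists
    obtain ⟨s, hs, hs2⟩ := exists_le_amplMean (simplePoles_of_linearIndependent hlin)
      (int_sum_ne_zero_of_linearIndependent hlin) hpos i (hcont g hg) g0 hκ hg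
      (ε := 1 / ((m : ℝ) + 1)) (by positivity) (by
        rw [div_le_one (by positivity)]; linarith [(Nat.cast_nonneg m : (0 : ℝ) ≤ m)]) m
    filter_upwards [hs.eventually_const_lt hm, hs2] with N h3 h4
    linarith
  rw [tendsto_order]
  refine ⟨hlow h hnn h1 hlip, fun b hb => ?_⟩
  -- The upper bound is the lower bound for 1 - h, since the limiting weights add up to 1.
  have h2 := hlow (fun x => 1 - h x) (fun x => by linarith [h1 x]) (fun x => by linarith [hnn x])
    (fun x y => by
      have : 1 - h x - (1 - h y) = -(h x - h y) := by ring
      rw [this, abs_neg]; exact hlip x y) (1 - b)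
    (by rw [limMean_one_sub hpos i (hcont h hlip) hnn h1]; linarith)
  filter_upwards [h2, eventually_gt_atTop 0] with N hN hN0
  have hN' : (N : ℝ) ≠ 0 := by exact_mod_cast hN0.ne'
  have h3 : amplMean L i (fun x => 1 - h x) N = 1 - amplMean L i h N := by
    simp only [amplMean]
    rw [Finset.sum_sub_distrib, mul_sub]
    simp [hN']
  rw [h3] at hN
  linarith

/-- The law of the scaled maximum amplitude, in the limit of large `N`. -/
def limLaw (L : Fin (n + 1) → ℝ) (i : Fin (n + 1)) : Measure ℝ :=
  ∑ l, ENNReal.ofReal (L l / (∑ j, L j)) •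
    (Measure.pi fun _ : Fin n => stdCauchy).map (fun z => ampl L i (slice l 0 z))

theorem continuous_ampl_slice {L : Fin (n + 1) → ℝ} (hpos : ∀ j, 0 < L j) (i l : Fin (n + 1)) :
    Continuous fun z : Fin n → ℝ => ampl L i (slice l 0 z) :=
  (continuous_ampl hpos i).comp ((continuous_slice l).comp
    (f := fun z : Fin n → ℝ => ((0 : ℝ), z)) (by fun_prop))

theorem limLaw_apply {L : Fin (n + 1) → ℝ} (hpos : ∀ j, 0 < L j) (i : Fin (n + 1)) {s : Set ℝ}
    (hs : MeasurableSet s) : limLaw L i s = ∑ l, ENNReal.ofReal (L l / (∑ j, L j)) *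
      (Measure.pi fun _ : Fin n => stdCauchy) {z | ampl L i (slice l 0 z) ∈ s} := by
  simp only [limLaw, Measure.coe_finsetSum, Finset.sum_apply, Measure.smul_apply, smul_eq_mul]
  refine Finset.sum_congr rfl fun l _ => ?_
  rw [Measure.map_apply (continuous_ampl_slice hpos i l).measurable hs]
  rfl

theorem limLaw_real {L : Fin (n + 1) → ℝ} (hpos : ∀ j, 0 < L j) (i : Fin (n + 1)) {s : Set ℝ}
    (hs : MeasurableSet s) : (limLaw L i).real s = ∑ l, L l / (∑ j, L j) *
      (Measure.pi fun _ : Fin n => stdCauchy).real {z | ampl L i (slice l 0 z) ∈ s} := by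
  have hS : 0 < ∑ j, L j := Finset.sum_pos (fun j _ => hpos j) ⟨0, Finset.mem_univ _⟩
  rw [Measure.real, limLaw_apply hpos i hs, ENNReal.toReal_sum fun l _ =>
    ENNReal.mul_ne_top ENNReal.ofReal_ne_top (measure_ne_top _ _)]
  refine Finset.sum_congr rfl fun l _ => ?_
  rw [ENNReal.toReal_mul, ENNReal.toReal_ofReal (div_nonneg (hpos l).le hS.le)]
  rfl

theorem isProbabilityMeasure_limLaw {L : Fin (n + 1) → ℝ} (hpos : ∀ j, 0 < L j) (i : Fin (n + 1)) :
    IsProbabilityMeasure (limLaw L i) := by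
  have hS : 0 < ∑ j, L j := Finset.sum_pos (fun j _ => hpos j) ⟨0, Finset.mem_univ _⟩
  refine ⟨?_⟩
  rw [limLaw_apply hpos i MeasurableSet.univ]
  simp only [Set.mem_univ, Set.ofPred_true, measure_univ, mul_one]
  rw [← ENNReal.ofReal_sum_of_nonneg fun l _ => div_nonneg (hpos l).le hS.le, ← Finset.sum_div,
    div_self hS.ne', ENNReal.ofReal_one]

theorem integral_limLaw {L : Fin (n + 1) → ℝ} (hpos : ∀ j, 0 < L j) (i : Fin (n + 1)) {h : ℝ → ℝ}
    (hc : Continuous h) (hnn : ∀ x, 0 ≤ h x) (h1 : ∀ x, h x ≤ 1) :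
    ∫ x, h x ∂(limLaw L i) = limMean L i h := by
  have hS : 0 < ∑ j, L j := Finset.sum_pos (fun j _ => hpos j) ⟨0, Finset.mem_univ _⟩
  have hmap : ∀ l, IsProbabilityMeasure
      ((Measure.pi fun _ : Fin n => stdCauchy).map (fun z => ampl L i (slice l 0 z))) := fun l =>
    Measure.isProbabilityMeasure_map (continuous_ampl_slice hpos i l).aemeasurable
  rw [limLaw, integral_finsetSum_measure]
  · refine Finset.sum_congr rfl fun l _ => ?_
    rw [integral_smul_measure, integral_map (continuous_ampl_slice hpos i l).aemeasurable
      hc.aestronglyMeasurable, ENNReal.toReal_ofReal (div_nonneg (hpos l).le hS.le), smul_eq_mul]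
  · intro l _
    refine Integrable.smul_measure ?_ ENNReal.ofReal_ne_top
    have := hmap l
    refine Integrable.of_bound (C := 1) hc.aestronglyMeasurable (ae_of_all _ fun x => ?_)
    rw [Real.norm_of_nonneg (hnn _)]; exact h1 _

open scoped Classical in
theorem tendsto_card_div {L : Fin (n + 1) → ℝ} (hlin : LinearIndependent ℚ L)
    (hpos : ∀ j, 0 < L j) (i : Fin (n + 1)) {R : ℝ} (hR : limLaw L i {R} = 0) :
    Tendsto (fun N : ℕ => (((Finset.Icc 1 N).filter
          (fun k => ((n + 1 : ℕ) : ℝ) ^ 2 * maxAmplitudeSq L i k < R)).card : ℝ) / (N : ℝ))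
      atTop (𝓝 ((limLaw L i).real (Set.Iio R))) := by
  have := isProbabilityMeasure_limLaw hpos i
  have hcard : ∀ N : ℕ, (((Finset.Icc 1 N).filter
      (fun k => ((n + 1 : ℕ) : ℝ) ^ 2 * maxAmplitudeSq L i k < R)).card : ℝ) / (N : ℝ)
      = (N : ℝ)⁻¹ * ∑ k ∈ Finset.Icc 1 N,
        if ((n + 1 : ℕ) : ℝ) ^ 2 * maxAmplitudeSq L i k < R then (1 : ℝ) else 0 := by
    intro N
    rw [Finset.sum_boole, div_eq_inv_mul]
  refine tendsto_of_ramp hR (fun N h => amplMean L i h N) _ (fun c δ hδ => ?_) (fun δ hδ => ?_) (fun δ hδ => ?_)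
  · rw [integral_limLaw hpos i (continuous_ramp c δ) (ramp_nonneg c δ) (ramp_le_one c δ)]
    exact tendsto_amplMean hlin hpos i (ramp_nonneg c δ) (ramp_le_one c δ) (by positivity) (abs_ramp_sub_le hδ)
  · refine Eventually.of_forall fun N => ?_
    rw [hcard, amplMean]
    refine mul_le_mul_of_nonneg_left (Finset.sum_le_sum fun k _ => ?_) (by positivity)
    split_ifs with h
    · exact ramp_le_one _ _ _
    · rw [ramp_eq_zero hδ (by linarith [not_lt.mp h])]
  · refine Eventually.of_forall fun N => ?_
    rw [hcard, amplMean]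
    refine mul_le_mul_of_nonneg_left (Finset.sum_le_sum fun k _ => ?_) (by positivity)
    split_ifs with h
    · rw [ramp_eq_one hδ h.le]
    · exact ramp_nonneg _ _ _

end LimitLaw

/-! ### Absolute continuity of the limit law for at least three bonds. -/

section Density

/-- The image of the set lies in the null set s, so the change of variables formula makes |φ'|
integrate to zero over a set where it is positive. -/
theorem volume_inter_preimage_eq_zero {φ φ' : ℝ → ℝ} {T s : Set ℝ} (hT : MeasurableSet T)
    (hφ : Measurable φ) (hφ' : Measurable φ') (hd : ∀ t ∈ T, HasDerivAt φ (φ' t) t) (hne : ∀ t ∈ T, φ' t ≠ 0)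
    (hinj : Set.InjOn φ T) (hs : MeasurableSet s) (hs0 : volume s = 0) :
    volume (T ∩ φ ⁻¹' s) = 0 := by
  have hm : MeasurableSet (T ∩ φ ⁻¹' s) := hT.inter (hφ hs)
  have h := lintegral_image_eq_lintegral_abs_deriv_mul hm
    (fun t ht => (hd t ht.1).hasDerivWithinAt) (hinj.mono Set.inter_subset_left) (fun _ => 1)
  have h1 : ∫⁻ _ in φ '' (T ∩ φ ⁻¹' s), (1 : ENNReal) = 0 := by
    rw [setLIntegral_one]
    refine measure_mono_null ?_ hs0
    rintro _ ⟨t, ht, rfl⟩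
    exact ht.2
  rw [h1, eq_comm, lintegral_eq_zero_iff (by fun_prop)] at h
  rw [EventuallyEq, ae_restrict_iff' hm] at h
  rw [measure_eq_zero_iff_ae_notMem]
  filter_upwards [h] with t ht hmem
  have := ht hmem
  simp at this
  exact hne t hmem.1 this

/-- On either side of the vertex -B/(2A) of the parabola the function is injective with nonzero
derivative. -/
theorem volume_preimage_div_quadratic {A B C c : ℝ} (hA : 0 < A) (hc : c ≠ 0)
    (hq : ∀ t, 0 < A * t ^ 2 + B * t + C) {s : Set ℝ} (hs : MeasurableSet s) (hs0 : volume s = 0) :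
    volume ((fun t => c / (A * t ^ 2 + B * t + C)) ⁻¹' s) = 0 := by
  set φ : ℝ → ℝ := fun t => c / (A * t ^ 2 + B * t + C) with hφ
  set φ' : ℝ → ℝ := fun t => -(c * (2 * A * t + B)) / (A * t ^ 2 + B * t + C) ^ 2 with hφ'
  have hd : ∀ t, HasDerivAt φ (φ' t) t := by
    intro t
    have h1 : HasDerivAt (fun t : ℝ => A * t ^ 2 + B * t + C) (2 * A * t + B) t := by
      have := ((((hasDerivAt_id t).pow 2).const_mul A).add ((hasDerivAt_id t).const_mul B)).add_const C
      refine this.congr_deriv ?_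
      simp; ring
    refine ((hasDerivAt_const t c).div h1 (hq t).ne').congr_deriv ?_
    simp only [hφ']; ring
  have hinj : ∀ t u, t ≠ u → φ t = φ u → A * (t + u) + B = 0 := by
    intro t u htu h
    simp only [hφ] at h
    rw [div_eq_div_iff (hq t).ne' (hq u).ne'] at h
    have h2 := mul_left_cancel₀ hc h
    have h3 : (t - u) * (A * (t + u) + B) = 0 := by linear_combination -h2
    exact (mul_eq_zero.mp h3).resolve_left (sub_ne_zero.mpr htu)
  have hne : ∀ t, 2 * A * t + B ≠ 0 → φ' t ≠ 0 := fun t ht =>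
    div_ne_zero (neg_ne_zero.mpr (mul_ne_zero hc ht)) (pow_ne_zero _ (hq t).ne')
  have hm : Measurable φ := by fun_prop
  have hm' : Measurable φ' := by fun_prop
  have h1 := volume_inter_preimage_eq_zero (T := {t | 0 < 2 * A * t + B}) (measurableSet_lt (by fun_prop) (by fun_prop))
    hm hm' (fun t _ => hd t) (fun t ht => hne t (ne_of_gt ht)) (fun t ht u hu h => by
      by_contra htu
      have := hinj t u htu h
      simp only [Set.mem_ofPred_eq] at ht hu
      nlinarith) hs hs0
  have h2 := volume_inter_preimage_eq_zero (T := {t | 2 * A * t + B < 0}) (measurableSet_lt (by fun_prop) (by fun_prop))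
    hm hm' (fun t _ => hd t) (fun t ht => hne t (ne_of_lt ht)) (fun t ht u hu h => by
      by_contra htu
      have := hinj t u htu h
      simp only [Set.mem_ofPred_eq] at ht hu
      nlinarith) hs hs0
  have h3 : volume {(-B / (2 * A))} = 0 := by simp
  refine measure_mono_null (t := ({t | 0 < 2 * A * t + B} ∩ φ ⁻¹' s) ∪ ({t | 2 * A * t + B < 0} ∩ φ ⁻¹' s)
    ∪ {(-B / (2 * A))}) (fun t ht => ?_) (measure_union_null (measure_union_null h1 h2) h3)
  rcases lt_trichotomy (2 * A * t + B) 0 with h | h | h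
  · exact Or.inl (Or.inr ⟨h, ht⟩)
  · right
    rw [Set.mem_singleton_iff, eq_div_iff (by positivity)]
    linarith
  · exact Or.inl (Or.inl ⟨h, ht⟩)

variable {n : ℕ}

theorem slice_add_smul (l : Fin (n + 1)) (z d : Fin n → ℝ) (t : ℝ) (j : Fin (n + 1)) :
    slice l 0 (z + t • d) j = slice l 0 z j + t * slice l 0 d j := by
  refine Fin.succAboveCases l ?_ (fun j' => ?_) j
  · simp [slice, Finset.sum_add_distrib, Finset.mul_sum]
    ring
  · simp [slice]

/-- Two free coordinates are needed. If i is the eliminated coordinate, the difference of two basis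
vectors leaves it fixed; otherwise move a free coordinate other than i, which the eliminated one
compensates. -/
theorem exists_direction (hn : 2 ≤ n) (i l : Fin (n + 1)) :
    ∃ d : Fin n → ℝ, slice l 0 d i = 0 ∧ ∃ j, slice l 0 d j ≠ 0 := by
  obtain ⟨m, rfl⟩ : ∃ m, n = m + 2 := ⟨n - 2, by omega⟩
  rcases Fin.eq_self_or_eq_succAbove l i with rfl | ⟨i', rfl⟩
  · refine ⟨Pi.single 0 1 - Pi.single 1 1, ?_, i.succAbove 0, ?_⟩
    · simp [slice]
    · simp [slice]
  · obtain ⟨j', hj'⟩ := exists_ne i'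
    refine ⟨Pi.single j' 1, ?_, l.succAbove j', ?_⟩
    · simp [slice, hj'.symm]
    · simp [slice]

/-- Along every line in a direction that keeps y_i fixed, the amplitude is a constant over a
positive quadratic polynomial. Preimages of null sets are null on each such line, hence null in ℝⁿ.
-/
theorem limLaw_absolutelyContinuous (hn : 2 ≤ n) {L : Fin (n + 1) → ℝ} (hpos : ∀ j, 0 < L j)
    (i : Fin (n + 1)) : limLaw L i ≪ volume := by
  refine Measure.AbsolutelyContinuous.mk fun s hs hs0 => ?_
  rw [limLaw_apply hpos i hs]
  refine Finset.sum_eq_zero fun l _ => ?_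
  have hm : MeasurableSet {z : Fin n → ℝ | ampl L i (slice l 0 z) ∈ s} :=
    (continuous_ampl_slice hpos i l).measurable hs
  obtain ⟨d, hdi, j₀, hj₀⟩ := exists_direction hn i l
  have hvol : volume {z : Fin n → ℝ | ampl L i (slice l 0 z) ∈ s} = 0 := by
    have h := ae_mem_of_ae_add_linearMap_mem (LinearMap.toSpanSingleton ℝ (Fin n → ℝ) d) volume volume
      hm.compl fun z => ?_
    · rw [measure_eq_zero_iff_ae_notMem]
      exact h
    · have hw : ∀ t : ℝ, weight L (slice l 0 (z + t • d)) = (∑ j, L j * slice l 0 d j ^ 2) * t ^ 2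
          + (∑ j, 2 * L j * slice l 0 z j * slice l 0 d j) * t + weight L (slice l 0 z) := by
        intro t
        simp only [weight, slice_add_smul, Finset.sum_mul]
        rw [← Finset.sum_add_distrib, ← Finset.sum_add_distrib]
        exact Finset.sum_congr rfl fun j _ => by ring
      have hkey : ∀ t : ℝ, ampl L i (slice l 0 (z + t • d)) =
          (((n + 1 : ℕ) : ℝ) ^ 2 * (2 * (1 + slice l 0 z i ^ 2))) /
          ((∑ j, L j * slice l 0 d j ^ 2) * t ^ 2 + (∑ j, 2 * L j * slice l 0 z j * slice l 0 d j) * t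
            + weight L (slice l 0 z)) := by
        intro t
        rw [ampl, hw, slice_add_smul, hdi, mul_zero, add_zero, mul_div_assoc']
      have hA : 0 < ∑ j, L j * slice l 0 d j ^ 2 := by
        refine Finset.sum_pos' (fun j _ => mul_nonneg (hpos j).le (sq_nonneg _))
          ⟨j₀, Finset.mem_univ _, mul_pos (hpos j₀) (by positivity)⟩
      have h0 := volume_preimage_div_quadratic hA
        (c := ((n + 1 : ℕ) : ℝ) ^ 2 * (2 * (1 + slice l 0 z i ^ 2))) (by positivity)
        (B := ∑ j, 2 * L j * slice l 0 z j * slice l 0 d j) (C := weight L (slice l 0 z))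
        (fun t => by rw [← hw]; exact weight_pos hpos _) hs hs0
      rw [measure_eq_zero_iff_ae_notMem] at h0
      filter_upwards [h0] with t ht hmem
      refine ht ?_
      rw [Set.mem_preimage, ← hkey]
      simpa using hmem
  rw [pi_absolutelyContinuous stdCauchy_absolutelyContinuous n hvol, mul_zero]

theorem limLaw_Iic_zero {L : Fin (n + 1) → ℝ} (hpos : ∀ j, 0 < L j) (i : Fin (n + 1)) :
    limLaw L i (Set.Iic 0) = 0 := by
  rw [limLaw_apply hpos i measurableSet_Iic]
  refine Finset.sum_eq_zero fun l _ => ?_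
  have : {z : Fin n → ℝ | ampl L i (slice l 0 z) ∈ Set.Iic 0} = ∅ := by
    ext z
    simpa using ampl_pos hpos i (slice l 0 z)
  rw [this, measure_empty, mul_zero]

theorem integral_eq_limLaw {L : Fin (n + 1) → ℝ} (hlin : LinearIndependent ℚ L)
    (hpos : ∀ j, 0 < L j) (hn : 2 ≤ n) {i : Fin (n + 1)} {q : ℝ → ℝ}
    (hq : IsAmplitudeDensity L i q) {R : ℝ} (hR : 0 < R) :
    ∫ η in (0 : ℝ)..R, q η = (limLaw L i).real (Set.Iio R) :=
  tendsto_nhds_unique (hq.2 R hR) (tendsto_card_div hlin hpos i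
    (limLaw_absolutelyContinuous hn hpos i (by simp)))

/-- The density is the Radon–Nikodym derivative of the limit law, which charges only the positive
half line. -/
theorem exists_isAmplitudeDensity {L : Fin (n + 1) → ℝ} (hlin : LinearIndependent ℚ L)
    (hpos : ∀ j, 0 < L j) (hn : 2 ≤ n) (i : Fin (n + 1)) : ∃ q, IsAmplitudeDensity L i q := by
  have hac := limLaw_absolutelyContinuous hn hpos i
  have := isProbabilityMeasure_limLaw hpos i
  have h0 := limLaw_Iic_zero hpos i
  refine ⟨fun x => ((limLaw L i).rnDeriv volume x).toReal, ⟨fun x _ => ENNReal.toReal_nonneg,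
    Measure.integrable_toReal_rnDeriv.integrableOn, ?_⟩, fun R hR => ?_⟩
  · rw [Measure.setIntegral_toReal_rnDeriv hac]
    have h1 : (limLaw L i).real (Set.Ioi 0) = 1 := by
      rw [← Set.compl_Iic, probReal_compl_eq_one_sub measurableSet_Iic, Measure.real, h0]
      simp
    exact h1
  · rw [intervalIntegral.integral_of_le hR.le, Measure.setIntegral_toReal_rnDeriv hac]
    have h1 : (limLaw L i).real (Set.Ioc 0 R) = (limLaw L i).real (Set.Iio R) := by
      have h2 : Set.Iio R =ᵐ[limLaw L i] Set.Iic R := Iio_ae_eq_Iic' (hac (by simp))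
      rw [measureReal_congr h2, ← Set.Iic_union_Ioc_eq_Iic hR.le, measureReal_union
        (Set.Iic_disjoint_Ioc le_rfl) measurableSet_Ioc]
      rw [Measure.real, Measure.real, h0]
      simp
    rw [h1]
    exact tendsto_card_div hlin hpos i (hac (by simp))

end Density

/-! ### An integral representation of m. -/

section MIntegral

theorem one_sub_exp_mul_cos_nonneg (ξ u : ℝ) : 0 ≤ 1 - Real.exp (-u ^ 2) * Real.cos (ξ * u) := by
  have h1 : Real.exp (-u ^ 2) ≤ 1 := Real.exp_le_one_iff.mpr (by nlinarith [sq_nonneg u])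
  have h2 := Real.cos_le_one (ξ * u)
  have h3 := Real.exp_pos (-u ^ 2)
  nlinarith

theorem one_sub_exp_mul_cos_le (ξ u : ℝ) :
    1 - Real.exp (-u ^ 2) * Real.cos (ξ * u) ≤ (1 + ξ ^ 2 / 2) * u ^ 2 := by
  have h1 : Real.exp (-u ^ 2) ≤ 1 := Real.exp_le_one_iff.mpr (by nlinarith [sq_nonneg u])
  have h2 := Real.one_sub_sq_div_two_le_cos (x := ξ * u)
  have h3 := Real.exp_pos (-u ^ 2)
  have h4 := Real.add_one_le_exp (-u ^ 2)
  have h5 := Real.cos_le_one (ξ * u)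
  have : Real.exp (-u ^ 2) * (1 - Real.cos (ξ * u)) ≤ 1 * ((ξ * u) ^ 2 / 2) :=
    mul_le_mul h1 (by linarith) (by linarith) zero_le_one
  nlinarith

theorem one_sub_exp_mul_cos_le_two (ξ u : ℝ) : 1 - Real.exp (-u ^ 2) * Real.cos (ξ * u) ≤ 2 := by
  have h1 : Real.exp (-u ^ 2) ≤ 1 := Real.exp_le_one_iff.mpr (by nlinarith [sq_nonneg u])
  have h2 := Real.neg_one_le_cos (ξ * u)
  have h3 := Real.exp_pos (-u ^ 2)
  nlinarith

/-- The integrand in the integral representation of `m`. -/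
def mKernel (ξ u : ℝ) : ℝ := (1 - Real.exp (-u ^ 2) * Real.cos (ξ * u)) / u ^ 2

theorem mKernel_nonneg (ξ u : ℝ) : 0 ≤ mKernel ξ u :=
  div_nonneg (one_sub_exp_mul_cos_nonneg ξ u) (sq_nonneg u)

theorem measurable_mKernel (ξ : ℝ) : Measurable (mKernel ξ) := by unfold mKernel; fun_prop

theorem mKernel_le (ξ u : ℝ) : mKernel ξ u ≤ (3 + ξ ^ 2 / 2) * (1 + u ^ 2)⁻¹ := by
  rcases eq_or_ne u 0 with rfl | hu
  · simp [mKernel]; positivity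
  · have hu2 : 0 < u ^ 2 := by positivity
    rw [mKernel, ← div_eq_mul_inv, div_le_div_iff₀ hu2 (by positivity)]
    have h1 := one_sub_exp_mul_cos_le ξ u
    have h2 := one_sub_exp_mul_cos_le_two ξ u
    nlinarith

theorem integrable_mKernel (ξ : ℝ) : Integrable (mKernel ξ) := by
  refine (integrable_inv_one_add_sq.const_mul (3 + ξ ^ 2 / 2)).mono'
    (measurable_mKernel ξ).aestronglyMeasurable (ae_of_all _ fun u => ?_)
  rw [Real.norm_of_nonneg (mKernel_nonneg ξ u)]
  exact mKernel_le ξ u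

/-- Write (1 - exp(-u²)) / u² as the integral of exp(-tu²) over 0 < t ≤ 1 and exchange the
integrals. -/
theorem integral_mKernel_zero : ∫ u, mKernel 0 u = 2 * √π := by
  have hker : ∀ u : ℝ, u ≠ 0 → mKernel 0 u = ∫ t in Set.Ioc (0 : ℝ) 1, Real.exp (-t * u ^ 2) := by
    intro u hu
    rw [← intervalIntegral.integral_of_le zero_le_one]
    have h1 : ∀ t : ℝ, HasDerivAt (fun t => -Real.exp (-t * u ^ 2) / u ^ 2) (Real.exp (-t * u ^ 2)) t := by
      intro t
      have h0 : HasDerivAt (fun t : ℝ => -t * u ^ 2) (-1 * u ^ 2) t :=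
        (hasDerivAt_neg t).mul_const (u ^ 2)
      refine (h0.exp.neg.div_const (u ^ 2)).congr_deriv ?_
      field_simp
    rw [intervalIntegral.integral_eq_sub_of_hasDerivAt (fun t _ => h1 t)
      (Continuous.intervalIntegrable (by fun_prop) _ _)]
    simp [mKernel]
    ring
  have hgauss : ∀ t : ℝ, ∫ u : ℝ, Real.exp (-t * u ^ 2) = √(π / t) := integral_gaussian
  have hsqrt : ∀ t ∈ Set.Ioc (0 : ℝ) 1, √(π / t) = √π * t ^ (-(1 / 2) : ℝ) := by
    intro t ht
    rw [Real.sqrt_div Real.pi_pos.le, Real.sqrt_eq_rpow t, Real.rpow_neg ht.1.le]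
    rfl
  have hint : IntegrableOn (fun t : ℝ => √π * t ^ (-(1 / 2) : ℝ)) (Set.Ioc 0 1) := by
    refine Integrable.const_mul ?_ _
    have := intervalIntegral.intervalIntegrable_rpow' (a := 0) (b := 1) (r := (-(1 / 2) : ℝ)) (by norm_num)
    rwa [intervalIntegrable_iff_integrableOn_Ioc_of_le zero_le_one] at this
  have hprod : Integrable (Function.uncurry fun (u t : ℝ) => Real.exp (-t * u ^ 2))
      (volume.prod (volume.restrict (Set.Ioc (0 : ℝ) 1))) := by
    rw [integrable_prod_iff' (Continuous.aestronglyMeasurable (by fun_prop))]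
    constructor
    · rw [ae_restrict_iff' measurableSet_Ioc]
      exact ae_of_all _ fun t ht => integrable_exp_neg_mul_sq ht.1
    · refine hint.congr ?_
      rw [EventuallyEq, ae_restrict_iff' measurableSet_Ioc]
      refine ae_of_all _ fun t ht => ?_
      simp only [Function.uncurry, Real.norm_eq_abs, Real.abs_exp]
      rw [hgauss, hsqrt t ht]
  have h1 : ∫ u, mKernel 0 u = ∫ u : ℝ, ∫ t in Set.Ioc (0 : ℝ) 1, Real.exp (-t * u ^ 2) := by
    refine integral_congr_ae ?_
    have : ∀ᵐ u : ℝ, u ≠ 0 := by simp [ae_iff]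
    filter_upwards [this] with u hu
    exact hker u hu
  rw [h1, integral_integral_swap hprod]
  simp only [hgauss]
  rw [setIntegral_congr_fun measurableSet_Ioc hsqrt, integral_const_mul,
    ← intervalIntegral.integral_of_le zero_le_one, integral_rpow (Or.inl (by norm_num))]
  norm_num
  ring

theorem integral_gaussian_mul_cos (a : ℝ) :
    ∫ u : ℝ, Real.exp (-u ^ 2) * Real.cos (a * u) = √π * Real.exp (-a ^ 2 / 4) := by
  have h := integral_cexp_quadratic (b := -1) (by norm_num) (Complex.I * a) 0
  have h2 : ∀ u : ℝ, Real.exp (-u ^ 2) * Real.cos (a * u)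
      = (Complex.exp (-1 * u ^ 2 + Complex.I * a * u + 0)).re := by
    intro u
    rw [Complex.exp_re]
    congr 2
    · simp [← Complex.ofReal_pow]
    · simp [← Complex.ofReal_pow]
  simp only [h2]
  have hi : Integrable fun u : ℝ => Complex.exp (-1 * u ^ 2 + Complex.I * a * u + 0) :=
    integrable_cexp_quadratic' (by norm_num) _ _
  have h3 := integral_re hi
  simp only [RCLike.re_eq_complex_re] at h3
  rw [h3, h]
  have h4 : (0 - (Complex.I * a) ^ 2 / (4 * -1) : ℂ) = ((-a ^ 2 / 4 : ℝ) : ℂ) := by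
    rw [mul_pow, Complex.I_sq]; push_cast; ring
  rw [h4]
  have h5 : ((π : ℂ) / (- -1)) ^ (1 / 2 : ℂ) = ((√π : ℝ) : ℂ) := by
    rw [neg_neg, div_one, Real.sqrt_eq_rpow, Complex.ofReal_cpow Real.pi_pos.le]
    norm_num
  rw [h5, ← Complex.ofReal_exp, ← Complex.ofReal_mul, Complex.ofReal_re]

theorem integral_one_sub_mul_cos {a : ℝ} (ha : a ≠ 0) :
    ∫ t in (0 : ℝ)..1, (1 - t) * Real.cos (a * t) = (1 - Real.cos a) / a ^ 2 := by
  have h1 : ∀ t : ℝ, HasDerivAt (fun t => (1 - t) * Real.sin (a * t) / a - Real.cos (a * t) / a ^ 2)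
      ((1 - t) * Real.cos (a * t)) t := by
    intro t
    have h0 := (hasDerivAt_id t).const_mul a
    have := ((((hasDerivAt_id t).const_sub 1).mul h0.sin).div_const a).sub (h0.cos.div_const (a ^ 2))
    refine this.congr_deriv ?_
    simp only [id]
    field_simp
    ring
  rw [intervalIntegral.integral_eq_sub_of_hasDerivAt (fun t _ => h1 t)
    (Continuous.intervalIntegrable (by fun_prop) _ _)]
  simp
  ring

/-- The difference from ξ = 0 is treated with the Taylor remainder (1 - cos a) / a² = ∫ (1 - t)
cos(at) dt over [0, 1]. After exchanging integrals, the Gaussian Fourier transform leaves an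
elementary integral and an error function. -/
theorem integral_mKernel (ξ : ℝ) : ∫ u, mKernel ξ u = π * m ξ := by
  rcases eq_or_ne ξ 0 with rfl | hξ
  · rw [integral_mKernel_zero, m]
    simp
    have := Real.mul_self_sqrt Real.pi_pos.le
    field_simp
    rw [sq, this]
  have hker : ∀ u : ℝ, u ≠ 0 → mKernel ξ u - mKernel 0 u
      = ∫ t in Set.Ioc (0 : ℝ) 1, ξ ^ 2 * (1 - t) * (Real.exp (-u ^ 2) * Real.cos (ξ * t * u)) := by
    intro u hu
    rw [← intervalIntegral.integral_of_le zero_le_one]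
    have h1 : ∀ t : ℝ, ξ ^ 2 * (1 - t) * (Real.exp (-u ^ 2) * Real.cos (ξ * t * u))
        = (ξ ^ 2 * Real.exp (-u ^ 2)) * ((1 - t) * Real.cos ((ξ * u) * t)) := fun t => by
      rw [show ξ * t * u = (ξ * u) * t by ring]; ring
    simp only [h1]
    rw [intervalIntegral.integral_const_mul, integral_one_sub_mul_cos (mul_ne_zero hξ hu)]
    simp only [mKernel, zero_mul, Real.cos_zero]
    field_simp
    ring
  have hprod : Integrable (Function.uncurry fun (u t : ℝ) =>
      ξ ^ 2 * (1 - t) * (Real.exp (-u ^ 2) * Real.cos (ξ * t * u)))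
      (volume.prod (volume.restrict (Set.Ioc (0 : ℝ) 1))) := by
    have hb : Integrable (fun p : ℝ × ℝ => Real.exp (-p.1 ^ 2) * (ξ ^ 2))
        (volume.prod (volume.restrict (Set.Ioc (0 : ℝ) 1))) := by
      refine Integrable.mul_prod (f := fun u : ℝ => Real.exp (-u ^ 2)) (g := fun _ : ℝ => ξ ^ 2) ?_ (integrable_const _)
      simpa using integrable_exp_neg_mul_sq (b := 1) one_pos
    have hs : ∀ᵐ p : ℝ × ℝ ∂(volume.prod (volume.restrict (Set.Ioc (0 : ℝ) 1))), p.2 ∈ Set.Ioc (0 : ℝ) 1 := by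
      have h1 : ∀ᵐ t ∂(volume.restrict (Set.Ioc (0 : ℝ) 1)), t ∈ Set.Ioc (0 : ℝ) 1 :=
        ae_restrict_mem measurableSet_Ioc
      exact Measure.quasiMeasurePreserving_snd.ae h1
    refine hb.mono' (Continuous.aestronglyMeasurable (by fun_prop)) ?_
    filter_upwards [hs] with p hp
    simp only [Function.uncurry]
    rw [norm_mul, norm_mul, norm_mul, Real.norm_of_nonneg (sq_nonneg ξ),
      Real.norm_of_nonneg (by linarith [hp.2] : 0 ≤ 1 - p.2), Real.norm_of_nonneg (Real.exp_pos _).le]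
    have h1 : ‖Real.cos (ξ * p.2 * p.1)‖ ≤ 1 := Real.abs_cos_le_one _
    have h2 : 1 - p.2 ≤ 1 := by linarith [hp.1]
    have h3 := Real.exp_pos (-p.1 ^ 2)
    calc ξ ^ 2 * (1 - p.2) * (Real.exp (-p.1 ^ 2) * ‖Real.cos (ξ * p.2 * p.1)‖)
        ≤ ξ ^ 2 * 1 * (Real.exp (-p.1 ^ 2) * 1) := by gcongr
      _ = _ := by ring
  have h1 : ∫ u, (mKernel ξ u - mKernel 0 u) = ∫ u : ℝ, ∫ t in Set.Ioc (0 : ℝ) 1,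
      ξ ^ 2 * (1 - t) * (Real.exp (-u ^ 2) * Real.cos (ξ * t * u)) := by
    refine integral_congr_ae ?_
    have : ∀ᵐ u : ℝ, u ≠ 0 := by simp [ae_iff]
    filter_upwards [this] with u hu
    exact hker u hu
  rw [integral_integral_swap hprod] at h1
  simp only [integral_const_mul, integral_gaussian_mul_cos] at h1
  rw [← intervalIntegral.integral_of_le zero_le_one, integral_sub (integrable_mKernel ξ)
    (integrable_mKernel 0), integral_mKernel_zero] at h1
  have h2 : ∀ t : ℝ, ξ ^ 2 * (1 - t) * (√π * Real.exp (-(ξ * t) ^ 2 / 4))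
      = √π * ξ ^ 2 * Real.exp (-(ξ * t) ^ 2 / 4) - √π * (ξ ^ 2 * t * Real.exp (-(ξ * t) ^ 2 / 4)) :=
    fun t => by ring
  simp only [h2] at h1
  rw [intervalIntegral.integral_sub (Continuous.intervalIntegrable (by fun_prop) _ _)
    (Continuous.intervalIntegrable (by fun_prop) _ _), intervalIntegral.integral_const_mul,
    intervalIntegral.integral_const_mul] at h1
  have h3 : ∫ t in (0 : ℝ)..1, ξ ^ 2 * t * Real.exp (-(ξ * t) ^ 2 / 4)
      = 2 - 2 * Real.exp (-ξ ^ 2 / 4) := by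
    have hd : ∀ t : ℝ, HasDerivAt (fun t => -2 * Real.exp (-(ξ * t) ^ 2 / 4))
        (ξ ^ 2 * t * Real.exp (-(ξ * t) ^ 2 / 4)) t := by
      intro t
      have := ((((((hasDerivAt_id t).const_mul ξ).pow 2).neg).div_const 4).exp).const_mul (-2)
      refine this.congr_deriv ?_
      simp
      ring
    rw [intervalIntegral.integral_eq_sub_of_hasDerivAt (fun t _ => hd t)
      (Continuous.intervalIntegrable (by fun_prop) _ _)]
    simp
    ring
  have h4 : erf (ξ / 2) = 2 / √π * (ξ / 2 * ∫ t in (0 : ℝ)..1, Real.exp (-(ξ * t) ^ 2 / 4)) := by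
    rw [erf]
    congr 1
    have := intervalIntegral.mul_integral_comp_mul_left (a := 0) (b := 1)
      (f := fun t : ℝ => Real.exp (-t ^ 2)) (ξ / 2)
    rw [mul_zero, mul_one] at this
    rw [← this]
    congr 2
    ext t
    congr 1
    ring
  rw [m, h4]
  rw [h3] at h1
  have hsq := Real.mul_self_sqrt Real.pi_pos.le
  have hs0 : √π ≠ 0 := by positivity
  have hpi : π = √π * √π := hsq.symm
  set J := ∫ t in (0 : ℝ)..1, Real.exp (-(ξ * t) ^ 2 / 4)
  have h5 : ∫ u, mKernel ξ u = 2 * √π * Real.exp (-ξ ^ 2 / 4) + √π * ξ ^ 2 * J := by linarith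
  rw [h5]
  nth_rewrite 3 [hpi]
  field_simp

/-- The kernel is pointwise smallest at ξ = 0, because cos ≤ 1. The uniform lower bound makes the
tail estimate uniform in ξ. -/
theorem m_ge (ξ : ℝ) : 2 / √π ≤ m ξ := by
  have h0 : π * (2 / √π) = ∫ u, mKernel 0 u := by
    rw [integral_mKernel_zero]
    have := Real.mul_self_sqrt Real.pi_pos.le
    field_simp
    rw [sq, this]
  have h1 : ∫ u, mKernel 0 u ≤ ∫ u, mKernel ξ u := by
    refine integral_mono (integrable_mKernel 0) (integrable_mKernel ξ) fun u => ?_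
    simp only [mKernel, zero_mul, Real.cos_zero]
    gcongr
    exact Real.cos_le_one _
  rw [← h0, integral_mKernel] at h1
  exact le_of_mul_le_mul_left h1 Real.pi_pos

theorem m_pos (ξ : ℝ) : 0 < m ξ := lt_of_lt_of_le (by positivity) (m_ge ξ)

theorem continuous_erf : Continuous erf := by
  unfold erf
  refine continuous_const.mul ?_
  have hc : Continuous fun t : ℝ => Real.exp (-t ^ 2) := by fun_prop
  exact continuous_iff_continuousAt.mpr fun x =>
    (hc.integral_hasStrictDerivAt 0 x).hasDerivAt.continuousAt

theorem continuous_m : Continuous m := by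
  unfold m
  exact (by fun_prop : Continuous fun ξ : ℝ => 2 / √π * Real.exp (-ξ ^ 2 / 4)).add
    (continuous_id.mul (continuous_erf.comp (by fun_prop)))

end MIntegral

/-! ### The Laplace transform of the Lévy distribution. -/

section Levy

theorem integral_Ioi_exp_neg_sq_add_inv_sq {c : ℝ} (hc : 0 < c) :
    ∫ x in Set.Ioi (0 : ℝ), Real.exp (-(x ^ 2 / 2 + c ^ 2 / (2 * x ^ 2)))
      = √(2 * π) / 2 * Real.exp (-c) := by
  -- The substitution is the inverse of u = x - c/x, for which x² + c²/x² = u² + 2c.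
  set r : ℝ → ℝ := fun u => √(u ^ 2 + 4 * c) with hr
  have hrpos : ∀ u, 0 < r u := fun u => Real.sqrt_pos.mpr (by positivity)
  have hrsq : ∀ u, r u ^ 2 = u ^ 2 + 4 * c := fun u => Real.sq_sqrt (by positivity)
  have hlt : ∀ u, |u| < r u := fun u => by
    rw [← Real.sqrt_sq_eq_abs]
    exact Real.sqrt_lt_sqrt (sq_nonneg u) (by linarith)
  set x : ℝ → ℝ := fun u => (u + r u) / 2 with hx
  have hxpos : ∀ u, 0 < x u := fun u => by
    have := (abs_lt.mp (hlt u)).1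
    simp only [hx]; linarith [neg_abs_le u, hlt u]
  have hxeq : ∀ u, x u ^ 2 = u * x u + c := fun u => by
    simp only [hx]; linear_combination (1 / 4) * hrsq u
  have hd : ∀ u, HasDerivAt x ((1 + u / r u) / 2) u := by
    intro u
    have h1 : HasDerivAt (fun u : ℝ => u ^ 2 + 4 * c) (2 * u) u := by
      simpa using ((hasDerivAt_id u).pow 2).add_const (4 * c)
    have h2 := h1.sqrt (by positivity : u ^ 2 + 4 * c ≠ 0)
    refine (((hasDerivAt_id u).add h2).div_const 2).congr_deriv ?_
    congr 2
    change 2 * u / (2 * r u) = u / r u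
    have := (hrpos u).ne'
    field_simp
  have himg : x '' Set.univ = Set.Ioi 0 := by
    ext t
    simp only [Set.image_univ, Set.mem_range, Set.mem_Ioi]
    constructor
    · rintro ⟨u, rfl⟩; exact hxpos u
    · intro ht
      refine ⟨t - c / t, ?_⟩
      have h1 : r (t - c / t) = t + c / t := by
        simp only [hr]
        rw [show (t - c / t) ^ 2 + 4 * c = (t + c / t) ^ 2 by field_simp; ring]
        exact Real.sqrt_sq (by positivity)
      simp only [hx, h1]; ring
  have hinj : Set.InjOn x Set.univ := by
    intro u _ w _ h
    have h1 := hxeq u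
    have h2 := hxeq w
    rw [h] at h1
    have h3 : (u - w) * x w = 0 := by linarith
    exact sub_eq_zero.mp ((mul_eq_zero.mp h3).resolve_right (hxpos w).ne')
  rw [← himg, integral_image_eq_integral_abs_deriv_smul MeasurableSet.univ
    (fun u _ => (hd u).hasDerivWithinAt) hinj]
  simp only [Measure.restrict_univ, smul_eq_mul]
  have hval : ∀ u, |(1 + u / r u) / 2| * Real.exp (-(x u ^ 2 / 2 + c ^ 2 / (2 * x u ^ 2)))
      = Real.exp (-c) / 2 * (Real.exp (-(1 / 2) * u ^ 2)) +
        Real.exp (-c) / 2 * (u / r u * Real.exp (-(1 / 2) * u ^ 2)) := by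
    intro u
    have h1 : -1 < u / r u := by
      rw [lt_div_iff₀ (hrpos u)]
      linarith [neg_abs_le u, hlt u]
    have h2 : x u ^ 2 / 2 + c ^ 2 / (2 * x u ^ 2) = c + 1 / 2 * u ^ 2 := by
      have h3 := (hxpos u).ne'
      have h4 : u = (x u ^ 2 - c) / x u := by
        rw [eq_div_iff h3]; linarith [hxeq u]
      generalize x u = y at *
      subst h4
      field_simp
      ring
    rw [abs_of_pos (by linarith), h2, neg_add, Real.exp_add]
    ring_nf
  simp only [hval]
  have hg := integrable_exp_neg_mul_sq (b := 1 / 2) (by norm_num)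
  have hrc : Continuous r := by simp only [hr]; fun_prop
  have hg2 : Integrable fun u : ℝ => u / r u * Real.exp (-(1 / 2) * u ^ 2) := by
    refine hg.mono' (Continuous.aestronglyMeasurable
      ((continuous_id.div hrc fun u => (hrpos u).ne').mul (by fun_prop))) (ae_of_all _ fun u => ?_)
    rw [norm_mul, Real.norm_of_nonneg (Real.exp_pos _).le, Real.norm_eq_abs, abs_div,
      abs_of_pos (hrpos u)]
    exact mul_le_of_le_one_left (Real.exp_pos _).le ((div_le_one (hrpos u)).mpr (hlt u).le)
  -- The derivative of the substitution is 1/2 plus an odd function, and the odd part integrates to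
  -- zero against the Gaussian.
  have hodd : ∫ u : ℝ, u / r u * Real.exp (-(1 / 2) * u ^ 2) = 0 := by
    have h1 := integral_neg_eq_self (fun u : ℝ => u / r u * Real.exp (-(1 / 2) * u ^ 2)) volume
    have h2 : ∀ u : ℝ, (-u) / r (-u) * Real.exp (-(1 / 2) * (-u) ^ 2)
        = -(u / r u * Real.exp (-(1 / 2) * u ^ 2)) := by
      intro u
      simp only [hr, neg_sq]
      ring
    simp only [h2, integral_neg] at h1
    linarith
  rw [integral_add (hg.const_mul _) (hg2.const_mul _), integral_const_mul, integral_const_mul, hodd,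
    integral_gaussian]
  rw [show π / (1 / 2) = 2 * π by ring]
  ring

theorem integral_gaussianReal_zero_one (f : ℝ → ℝ) :
    ∫ x, f x ∂(ProbabilityTheory.gaussianReal 0 1)
      = (√(2 * π))⁻¹ * ∫ x, Real.exp (-(x ^ 2 / 2)) * f x := by
  rw [ProbabilityTheory.integral_gaussianReal_eq_integral_smul one_ne_zero, ← integral_const_mul]
  refine integral_congr_ae (ae_of_all _ fun x => ?_)
  simp [ProbabilityTheory.gaussianPDFReal]
  ring_nf

/-- The Laplace transform of the Lévy distribution. -/
theorem integral_exp_neg_div_sq_gaussianReal {c : ℝ} (hc : 0 < c) :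
    ∫ x, Real.exp (-(c ^ 2 / (2 * x ^ 2))) ∂(ProbabilityTheory.gaussianReal 0 1) = Real.exp (-c) := by
  rw [integral_gaussianReal_zero_one]
  have h1 : ∀ x : ℝ, Real.exp (-(x ^ 2 / 2)) * Real.exp (-(c ^ 2 / (2 * x ^ 2)))
      = Real.exp (-(|x| ^ 2 / 2 + c ^ 2 / (2 * |x| ^ 2))) := by
    intro x
    rw [← Real.exp_add, sq_abs]
    congr 1; ring
  simp only [h1]
  rw [integral_comp_abs (f := fun x => Real.exp (-(x ^ 2 / 2 + c ^ 2 / (2 * x ^ 2)))),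
    integral_Ioi_exp_neg_sq_add_inv_sq hc]
  have : √(2 * π) ≠ 0 := by positivity
  field_simp

end Levy

/-! ### Convergence of moments on the unit interval, by Weierstrass approximation. -/

section Moments

theorem tendsto_integral_of_moments {μ : ℕ → Measure ℝ} {ν : Measure ℝ}
    [∀ n, IsProbabilityMeasure (μ n)] [IsProbabilityMeasure ν]
    (hμ : ∀ n, ∀ᵐ x ∂(μ n), x ∈ Set.Icc (0 : ℝ) 1) (hν : ∀ᵐ x ∂ν, x ∈ Set.Icc (0 : ℝ) 1)
    (hmom : ∀ k : ℕ, Tendsto (fun n => ∫ x, x ^ k ∂(μ n)) atTop (𝓝 (∫ x, x ^ k ∂ν)))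
    {h : ℝ → ℝ} (hc : Continuous h) :
    Tendsto (fun n => ∫ x, h x ∂(μ n)) atTop (𝓝 (∫ x, h x ∂ν)) := by
  have hint : ∀ (ρ : Measure ℝ) [IsProbabilityMeasure ρ], (∀ᵐ x ∂ρ, x ∈ Set.Icc (0 : ℝ) 1) →
      ∀ f : ℝ → ℝ, Continuous f → Integrable f ρ := by
    intro ρ _ hρ f hf
    obtain ⟨C, hC⟩ := (isCompact_Icc (a := (0 : ℝ)) (b := 1)).exists_bound_of_continuousOn hf.continuousOn
    refine Integrable.of_bound hf.aestronglyMeasurable C ?_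
    filter_upwards [hρ] with x hx using hC x hx
  have hpoly : ∀ p : Polynomial ℝ,
      Tendsto (fun n => ∫ x, p.eval x ∂(μ n)) atTop (𝓝 (∫ x, p.eval x ∂ν)) := by
    intro p
    have hrw : ∀ (ρ : Measure ℝ) [IsProbabilityMeasure ρ], (∀ᵐ x ∂ρ, x ∈ Set.Icc (0 : ℝ) 1) →
        ∫ x, p.eval x ∂ρ = ∑ k ∈ Finset.range (p.natDegree + 1), p.coeff k * ∫ x, x ^ k ∂ρ := by
      intro ρ _ hρ
      simp only [Polynomial.eval_eq_sum_range]
      rw [integral_finsetSum _ fun k _ => (hint ρ hρ _ (by fun_prop))]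
      exact Finset.sum_congr rfl fun k _ => integral_const_mul _ _
    rw [hrw ν hν]
    simp only [fun n => hrw (μ n) (hμ n)]
    exact tendsto_finsetSum _ fun k _ => (hmom k).const_mul _
  rw [Metric.tendsto_atTop]
  intro ε hε
  obtain ⟨p, hp⟩ := exists_polynomial_near_of_continuousOn 0 1 h hc.continuousOn (ε / 3) (by positivity)
  obtain ⟨N, hN⟩ := Metric.tendsto_atTop.mp (hpoly p) (ε / 3) (by positivity)
  have hclose : ∀ (ρ : Measure ℝ) [IsProbabilityMeasure ρ], (∀ᵐ x ∂ρ, x ∈ Set.Icc (0 : ℝ) 1) →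
      |∫ x, p.eval x ∂ρ - ∫ x, h x ∂ρ| ≤ ε / 3 := by
    intro ρ _ hρ
    rw [← integral_sub (hint ρ hρ _ p.continuous) (hint ρ hρ _ hc), ← Real.norm_eq_abs]
    refine (norm_integral_le_of_norm_le_const (C := ε / 3) ?_).trans (by simp)
    filter_upwards [hρ] with x hx using (hp x hx).le
  refine ⟨N, fun n hn => ?_⟩
  have h1 := abs_le.mp (hclose (μ n) (hμ n))
  have h2 := abs_le.mp (hclose ν hν)
  have h3 := hN n hn
  rw [Real.dist_eq] at h3 ⊢
  have h4 := abs_lt.mp h3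
  rw [abs_lt]
  constructor <;> linarith [h1.1, h1.2, h2.1, h2.2, h4.1, h4.2]

end Moments

/-! ### The limit of the scaled sum of squares for many bonds. -/

section Stable

open ProbabilityTheory

/-- The limit law of `exp (-S)`, where `S` is the scaled sum of squares. -/
def zLaw : Measure ℝ :=
  ((gaussianReal 0 2).prod (gaussianReal 0 1)).map fun p => Real.exp (-(m p.1 ^ 2 / (2 * p.2 ^ 2)))

theorem measurable_zFun : Measurable fun p : ℝ × ℝ => Real.exp (-(m p.1 ^ 2 / (2 * p.2 ^ 2))) := by
  have := continuous_m.measurable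
  fun_prop

instance : IsProbabilityMeasure zLaw := Measure.isProbabilityMeasure_map measurable_zFun.aemeasurable

theorem zLaw_mem_Icc : ∀ᵐ x ∂zLaw, x ∈ Set.Icc (0 : ℝ) 1 := by
  refine (ae_map_iff (p := fun x => x ∈ Set.Icc (0 : ℝ) 1) measurable_zFun.aemeasurable
    measurableSet_Icc).mpr (ae_of_all _ fun p => ⟨(Real.exp_pos _).le, Real.exp_le_one_iff.mpr ?_⟩)
  rw [neg_nonpos]
  positivity

/-- The k-th power of exp(-S) is exp(-kS), so this is the Lévy Laplace transform with c = √k m(ξ),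
conditionally on ξ. -/
theorem zLaw_moment (k : ℕ) :
    ∫ x, x ^ k ∂zLaw = ∫ ξ, Real.exp (-(√k * m ξ)) ∂(gaussianReal 0 2) := by
  rw [zLaw, integral_map measurable_zFun.aemeasurable (by fun_prop)]
  have hm := continuous_m.measurable
  rw [integral_prod]
  · refine integral_congr_ae (ae_of_all _ fun ξ => ?_)
    rcases Nat.eq_zero_or_pos k with rfl | hk
    · simp
    · simp only
      rw [← integral_exp_neg_div_sq_gaussianReal (c := √k * m ξ)
        (mul_pos (Real.sqrt_pos.mpr (by exact_mod_cast hk)) (m_pos ξ))]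
      refine integral_congr_ae (ae_of_all _ fun x => ?_)
      simp only
      rw [← Real.exp_nat_mul, mul_pow, Real.sq_sqrt (by positivity)]
      congr 1; ring
  · refine Integrable.of_bound (C := 1) (Measurable.aestronglyMeasurable (measurable_zFun.pow_const k))
      (ae_of_all _ fun p => ?_)
    rw [norm_pow, Real.norm_of_nonneg (Real.exp_pos _).le]
    refine pow_le_one₀ (Real.exp_pos _).le (Real.exp_le_one_iff.mpr ?_)
    rw [neg_nonpos]
    positivity

/-- For fixed ξ at most three values of x give the value c, and the Gaussian has no atoms. -/
theorem zLaw_singleton (c : ℝ) : zLaw {c} = 0 := by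
  rw [zLaw, Measure.map_apply measurable_zFun (measurableSet_singleton c),
    Measure.measure_prod_null (measurable_zFun (measurableSet_singleton c))]
  refine ae_of_all _ fun ξ => ?_
  refine measure_mono_null (t := {0, √(m ξ ^ 2 / (2 * -Real.log c)), -√(m ξ ^ 2 / (2 * -Real.log c))})
    (fun x hx => ?_) ?_
  · have hx' : Real.exp (-(m ξ ^ 2 / (2 * x ^ 2))) = c := hx
    by_cases hx0 : x = 0
    · left; exact hx0
    · right
      have h1 : -Real.log c = m ξ ^ 2 / (2 * x ^ 2) := by
        rw [← hx', Real.log_exp, neg_neg]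
      have h2 : m ξ ^ 2 / (2 * -Real.log c) = x ^ 2 := by
        rw [h1]
        have := (m_pos ξ).ne'
        field_simp
      rw [h2, Real.sqrt_sq_eq_abs]
      rcases abs_choice x with h | h <;> simp [h]
  · have := nullSingletonClass_gaussianReal (μ := 0) (v := 1) one_ne_zero
    exact Set.Finite.measure_zero (by simp) _

/-- The characteristic integral of a single bond. -/
def bondChar (b ξ : ℝ) : ℝ := ∫ u, Real.exp (-(b * u) ^ 2) * Real.cos (b * u * ξ) ∂stdCauchy

theorem integrable_bond (b ξ : ℝ) :
    Integrable (fun u => Real.exp (-(b * u) ^ 2) * Real.cos (b * u * ξ)) stdCauchy := by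
  refine Integrable.of_bound (C := 1) (Continuous.aestronglyMeasurable (by fun_prop))
    (ae_of_all _ fun u => ?_)
  rw [norm_mul, Real.norm_of_nonneg (Real.exp_pos _).le]
  exact mul_le_one₀ (Real.exp_le_one_iff.mpr (neg_nonpos.mpr (sq_nonneg _))) (norm_nonneg _)
    (Real.abs_cos_le_one _)

theorem abs_bondChar_le_one (b ξ : ℝ) : |bondChar b ξ| ≤ 1 := by
  rw [bondChar, ← Real.norm_eq_abs]
  refine (norm_integral_le_of_norm_le_const (C := 1) (ae_of_all _ fun u => ?_)).trans (by simp)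
  rw [norm_mul, Real.norm_of_nonneg (Real.exp_pos _).le]
  exact mul_le_one₀ (Real.exp_le_one_iff.mpr (neg_nonpos.mpr (sq_nonneg _))) (norm_nonneg _)
    (Real.abs_cos_le_one _)

theorem integral_bond_complex (b ξ : ℝ) :
    ∫ u, Complex.exp (-((b * u : ℝ) : ℂ) ^ 2 + ((b * u * ξ : ℝ) : ℂ) * Complex.I) ∂stdCauchy
      = (bondChar b ξ : ℂ) := by
  have hval : ∀ u : ℝ, Complex.exp (-((b * u : ℝ) : ℂ) ^ 2 + ((b * u * ξ : ℝ) : ℂ) * Complex.I)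
      = ((Real.exp (-(b * u) ^ 2) * Real.cos (b * u * ξ) : ℝ) : ℂ)
        + ((Real.exp (-(b * u) ^ 2) * Real.sin (b * u * ξ) : ℝ) : ℂ) * Complex.I := by
    intro u
    rw [Complex.exp_add, Complex.exp_mul_I]
    push_cast
    ring
  have hsin : Integrable (fun u => Real.exp (-(b * u) ^ 2) * Real.sin (b * u * ξ)) stdCauchy := by
    refine Integrable.of_bound (C := 1) (Continuous.aestronglyMeasurable (by fun_prop))
      (ae_of_all _ fun u => ?_)
    rw [norm_mul, Real.norm_of_nonneg (Real.exp_pos _).le]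
    exact mul_le_one₀ (Real.exp_le_one_iff.mpr (neg_nonpos.mpr (sq_nonneg _))) (norm_nonneg _)
      (Real.abs_sin_le_one _)
  have hodd : ∫ u, Real.exp (-(b * u) ^ 2) * Real.sin (b * u * ξ) ∂stdCauchy = 0 := by
    rw [integral_stdCauchy]
    have h1 := integral_neg_eq_self
      (fun u : ℝ => (π * (1 + u ^ 2))⁻¹ * (Real.exp (-(b * u) ^ 2) * Real.sin (b * u * ξ))) volume
    have h2 : ∀ u : ℝ, (π * (1 + (-u) ^ 2))⁻¹ * (Real.exp (-(b * -u) ^ 2) * Real.sin (b * -u * ξ))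
        = -((π * (1 + u ^ 2))⁻¹ * (Real.exp (-(b * u) ^ 2) * Real.sin (b * u * ξ))) := by
      intro u
      rw [show b * -u * ξ = -(b * u * ξ) by ring, Real.sin_neg, show b * -u = -(b * u) by ring, neg_sq, neg_sq]
      ring
    simp only [h2, integral_neg] at h1
    linarith
  simp only [hval]
  rw [integral_add (integrable_bond b ξ).ofReal (hsin.ofReal.mul_const _), integral_mul_const]
  rw [integral_complex_ofReal, integral_complex_ofReal, hodd, bondChar]
  simp

/-- Substitute w = bu in the Cauchy integral. The heavy tail makes the deficit of first order in b,
and the last factor increases to 1 as b decreases to 0. -/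
theorem one_sub_bondChar {b : ℝ} (hb : 0 < b) (ξ : ℝ) :
    1 - bondChar b ξ = b * ∫ w, π⁻¹ * (mKernel ξ w * (w ^ 2 / (b ^ 2 + w ^ 2))) := by
  have h1 : 1 - bondChar b ξ
      = ∫ u, (1 - Real.exp (-(b * u) ^ 2) * Real.cos (b * u * ξ)) ∂stdCauchy := by
    rw [integral_sub (integrable_const 1) (integrable_bond b ξ), bondChar]
    simp
  rw [h1, integral_stdCauchy]
  have h2 := Measure.integral_comp_mul_left
    (fun w => π⁻¹ * (mKernel ξ w * (w ^ 2 / (b ^ 2 + w ^ 2)))) b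
  rw [abs_of_pos (inv_pos.mpr hb), smul_eq_mul] at h2
  have h3 : ∫ w, π⁻¹ * (mKernel ξ w * (w ^ 2 / (b ^ 2 + w ^ 2)))
      = b * ∫ u, π⁻¹ * (mKernel ξ (b * u) * ((b * u) ^ 2 / (b ^ 2 + (b * u) ^ 2))) := by
    rw [h2]; field_simp
  rw [h3, ← mul_assoc, ← integral_const_mul]
  refine integral_congr_ae ?_
  have : ∀ᵐ u : ℝ, u ≠ 0 := by simp [ae_iff]
  filter_upwards [this] with u hu
  have hu2 : (1 + u ^ 2) ≠ 0 := by positivity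
  have hpi := Real.pi_ne_zero
  have h4 : b ^ 2 + (b * u) ^ 2 = b ^ 2 * (1 + u ^ 2) := by ring
  rw [mKernel, h4, show ξ * (b * u) = b * u * ξ by ring]
  field_simp

theorem tendsto_one_sub_bondChar (ξ : ℝ) {b : ℕ → ℝ} (hb : ∀ n, 0 < b n) (hb0 : Tendsto b atTop (𝓝 0)) :
    Tendsto (fun n => (1 - bondChar (b n) ξ) / b n) atTop (𝓝 (m ξ)) := by
  have h1 : ∀ n, (1 - bondChar (b n) ξ) / b n
      = ∫ w, π⁻¹ * (mKernel ξ w * (w ^ 2 / ((b n) ^ 2 + w ^ 2))) := fun n => by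
    rw [one_sub_bondChar (hb n), mul_div_cancel_left₀ _ (hb n).ne']
  have h2 : m ξ = ∫ w, π⁻¹ * mKernel ξ w := by
    rw [integral_const_mul, integral_mKernel]
    have := Real.pi_ne_zero
    field_simp
  simp only [h1]
  rw [h2]
  have hmeas := measurable_mKernel ξ
  refine tendsto_integral_of_dominated_convergence (fun w => π⁻¹ * mKernel ξ w)
    (fun n => Measurable.aestronglyMeasurable (by fun_prop)) ((integrable_mKernel ξ).const_mul _)
    (fun n => ae_of_all _ fun w => ?_) ?_
  · have h3 : 0 ≤ w ^ 2 / ((b n) ^ 2 + w ^ 2) := by positivity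
    have h4 : w ^ 2 / ((b n) ^ 2 + w ^ 2) ≤ 1 := by
      have := hb n
      rw [div_le_one (by positivity)]
      nlinarith
    have h5 := mKernel_nonneg ξ w
    rw [Real.norm_of_nonneg (by positivity)]
    gcongr
    exact mul_le_of_le_one_right h5 h4
  · have : ∀ᵐ w : ℝ, w ≠ 0 := by simp [ae_iff]
    filter_upwards [this] with w hw
    have h3 : Tendsto (fun n => w ^ 2 / ((b n) ^ 2 + w ^ 2)) atTop (𝓝 1) := by
      have h4 : Tendsto (fun n => w ^ 2 / ((b n) ^ 2 + w ^ 2)) atTop (𝓝 (w ^ 2 / (0 ^ 2 + w ^ 2))) :=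
        (tendsto_const_nhds).div ((hb0.pow 2).add_const _) (by positivity)
      have h5 : w ^ 2 / (0 ^ 2 + w ^ 2) = 1 := by field_simp; simp
      rwa [h5] at h4
    simpa using (h3.const_mul (mKernel ξ w)).const_mul π⁻¹

/-- Of the n + 2 bonds, one carries the fixed value y and one is eliminated, so n factors remain.
Here n (bondChar - 1) tends to -√s m(ξ). -/
theorem tendsto_bondChar_pow (ξ : ℝ) {s : ℝ} (hs : 0 < s) :
    Tendsto (fun n : ℕ => bondChar (√s / (n + 2)) ξ ^ n) atTop (𝓝 (Real.exp (-(√s * m ξ)))) := by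
  have hsq := Real.sqrt_pos.mpr hs
  have hb : ∀ n : ℕ, 0 < √s / ((n : ℝ) + 2) := fun n => by positivity
  have hN : Tendsto (fun n : ℕ => ((n : ℝ) + 2)) atTop atTop :=
    tendsto_atTop_add_const_right _ _ tendsto_natCast_atTop_atTop
  have hb0 : Tendsto (fun n : ℕ => √s / ((n : ℝ) + 2)) atTop (𝓝 0) :=
    tendsto_const_nhds.div_atTop hN
  have h1 := tendsto_one_sub_bondChar ξ hb hb0
  have h2 : Tendsto (fun n : ℕ => (n : ℝ) / (n + 2)) atTop (𝓝 1) := by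
    have h3 : Tendsto (fun n : ℕ => 1 - 2 / ((n : ℝ) + 2)) atTop (𝓝 (1 - 0)) :=
      tendsto_const_nhds.sub (tendsto_const_nhds.div_atTop hN)
    rw [sub_zero] at h3
    refine h3.congr fun n => ?_
    have : (n : ℝ) + 2 ≠ 0 := by positivity
    field_simp
    ring
  have h3 : Tendsto (fun n : ℕ => (n : ℝ) * (bondChar (√s / (n + 2)) ξ - 1)) atTop (𝓝 (-(√s * m ξ))) := by
    have h4 := ((h2.mul h1).const_mul (√s)).neg
    rw [one_mul] at h4
    refine h4.congr fun n => ?_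
    have : (n : ℝ) + 2 ≠ 0 := by positivity
    field_simp
    ring
  have h5 := Real.tendsto_one_add_pow_exp_of_tendsto h3
  simpa using h5

variable {n : ℕ}

/-- The scaled sum `Σ (1 + y_j²) / v²`, with `v = n + 2` bonds, on the hyperplane `Σ y_j = 0`. -/
def scaledSum (n : ℕ) (y : ℝ) (u : Fin n → ℝ) : ℝ :=
  ((n + 2 : ℝ) + y ^ 2 + ∑ j, u j ^ 2 + (y + ∑ j, u j) ^ 2) / (n + 2 : ℝ) ^ 2

theorem scaledSum_nonneg (y : ℝ) (u : Fin n → ℝ) : 0 ≤ scaledSum n y u := by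
  have : 0 ≤ ∑ j, u j ^ 2 := Finset.sum_nonneg fun j _ => sq_nonneg _
  unfold scaledSum
  positivity

theorem continuous_scaledSum : Continuous fun p : ℝ × (Fin n → ℝ) => scaledSum n p.1 p.2 := by
  unfold scaledSum
  fun_prop

theorem integral_exp_mul_I_gaussianReal (a : ℝ) :
    ∫ ξ, Complex.exp (((a * ξ : ℝ) : ℂ) * Complex.I) ∂(gaussianReal 0 2) = ((Real.exp (-a ^ 2) : ℝ) : ℂ) := by
  have h := charFun_gaussianReal (μ := 0) (v := 2) a
  rw [charFun_apply_real] at h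
  push_cast at h ⊢
  rw [h]
  congr 1
  simp

/-- The square (y + Σ u_j)² couples the bonds. Writing exp(-a²) as the Gaussian average of exp(iaξ),
with variance 2, makes the integrand a product over the bonds, and Fubini leaves the n-th power of a
single-bond integral. -/
theorem integral_exp_neg_scaledSum (y : ℝ) {s : ℝ} (hs : 0 ≤ s) :
    ((∫ u, Real.exp (-(s * scaledSum n y u)) ∂(Measure.pi fun _ : Fin n => stdCauchy) : ℝ) : ℂ)
      = (Real.exp (-(s * ((n + 2 : ℝ) + y ^ 2) / (n + 2 : ℝ) ^ 2)) : ℂ) *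
        ∫ ξ, Complex.exp (((√s / (n + 2) * y * ξ : ℝ) : ℂ) * Complex.I) *
          (bondChar (√s / (n + 2)) ξ : ℂ) ^ n ∂(gaussianReal 0 2) := by
  set b : ℝ := √s / (n + 2) with hb
  have hb2 : b ^ 2 = s / (n + 2 : ℝ) ^ 2 := by rw [hb, div_pow, Real.sq_sqrt hs]
  have hn2 : (n : ℝ) + 2 ≠ 0 := by positivity
  have h1 : ∀ u : Fin n → ℝ, ((Real.exp (-(s * scaledSum n y u)) : ℝ) : ℂ)
      = (Real.exp (-(s * ((n + 2 : ℝ) + y ^ 2) / (n + 2 : ℝ) ^ 2)) : ℂ) *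
        ∫ ξ, Complex.exp (((b * y * ξ : ℝ) : ℂ) * Complex.I) *
          ∏ j, Complex.exp (-((b * u j : ℝ) : ℂ) ^ 2 + ((b * u j * ξ : ℝ) : ℂ) * Complex.I)
          ∂(gaussianReal 0 2) := by
    intro u
    have h2 : ∀ ξ : ℝ, Complex.exp (((b * y * ξ : ℝ) : ℂ) * Complex.I) *
          ∏ j, Complex.exp (-((b * u j : ℝ) : ℂ) ^ 2 + ((b * u j * ξ : ℝ) : ℂ) * Complex.I)
        = ((Real.exp (-(b ^ 2 * ∑ j, u j ^ 2)) : ℝ) : ℂ) *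
          Complex.exp (((b * (y + ∑ j, u j) * ξ : ℝ) : ℂ) * Complex.I) := by
      intro ξ
      rw [← Complex.exp_sum, ← Complex.exp_add, Complex.ofReal_exp, ← Complex.exp_add]
      congr 1
      rw [Finset.sum_add_distrib, ← Finset.sum_mul]
      push_cast
      simp only [mul_pow]
      rw [Finset.sum_neg_distrib, ← Finset.mul_sum, ← Finset.sum_mul, ← Finset.mul_sum]
      ring
    simp only [h2]
    rw [integral_const_mul, integral_exp_mul_I_gaussianReal, ← Complex.ofReal_mul, ← Complex.ofReal_mul,
      ← Real.exp_add, ← Real.exp_add, mul_pow, hb2, scaledSum]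
    congr 2
    field_simp
    ring
  rw [← integral_complex_ofReal]
  simp only [h1]
  rw [integral_const_mul, integral_integral_swap]
  · congr 1
    refine integral_congr_ae (ae_of_all _ fun ξ => ?_)
    simp only
    rw [integral_const_mul, integral_fintype_prod_eq_pow (fun u : ℝ =>
      Complex.exp (-((b * u : ℝ) : ℂ) ^ 2 + ((b * u * ξ : ℝ) : ℂ) * Complex.I)), integral_bond_complex]
    simp
  · refine Integrable.of_bound (C := 1) (Continuous.aestronglyMeasurable ?_) (ae_of_all _ fun p => ?_)
    · unfold Function.uncurry
      fun_prop
    · simp only [Function.uncurry]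
      rw [norm_mul, Complex.norm_exp_ofReal_mul_I, one_mul, norm_prod]
      refine Finset.prod_le_one (fun _ _ => norm_nonneg _) fun j _ => ?_
      rw [Complex.norm_exp, Real.exp_le_one_iff]
      rw [Complex.add_re, Complex.re_ofReal_mul, Complex.I_re, mul_zero, add_zero, Complex.neg_re,
        ← Complex.ofReal_pow, Complex.ofReal_re, neg_nonpos]
      positivity

theorem tendsto_integral_exp_neg_scaledSum (y : ℝ) {s : ℝ} (hs : 0 < s) :
    Tendsto (fun n : ℕ => ∫ u, Real.exp (-(s * scaledSum n y u)) ∂(Measure.pi fun _ : Fin n => stdCauchy))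
      atTop (𝓝 (∫ ξ, Real.exp (-(√s * m ξ)) ∂(gaussianReal 0 2))) := by
  have hN : Tendsto (fun n : ℕ => ((n : ℝ) + 2)) atTop atTop :=
    tendsto_atTop_add_const_right _ _ tendsto_natCast_atTop_atTop
  have hinv : Tendsto (fun n : ℕ => ((n : ℝ) + 2)⁻¹) atTop (𝓝 0) := tendsto_inv_atTop_zero.comp hN
  have hm := continuous_m.measurable
  have h1 : Tendsto (fun n : ℕ => Real.exp (-(s * ((n + 2 : ℝ) + y ^ 2) / (n + 2 : ℝ) ^ 2))) atTop (𝓝 1) := by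
    have h2 : Tendsto (fun n : ℕ => -(s * (((n : ℝ) + 2)⁻¹ + y ^ 2 * ((n : ℝ) + 2)⁻¹ ^ 2))) atTop (𝓝 0) := by
      have := ((hinv.add ((hinv.pow 2).const_mul (y ^ 2))).const_mul s).neg
      simpa using this
    rw [← Real.exp_zero]
    refine (Real.continuous_exp.tendsto _).comp (h2.congr fun n => ?_)
    have : (n : ℝ) + 2 ≠ 0 := by positivity
    field_simp
  have hb0 : Tendsto (fun n : ℕ => √s / ((n : ℝ) + 2)) atTop (𝓝 0) :=
    tendsto_const_nhds.div_atTop hN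
  have hbm : ∀ b, Measurable (bondChar b) := by
    intro b
    have h3 : StronglyMeasurable (Function.uncurry fun ξ u : ℝ => Real.exp (-(b * u) ^ 2) * Real.cos (b * u * ξ)) :=
      Continuous.stronglyMeasurable (by unfold Function.uncurry; fun_prop)
    exact h3.integral_prod_right.measurable
  have h2 : Tendsto (fun n : ℕ => ∫ ξ, Complex.exp (((√s / (n + 2) * y * ξ : ℝ) : ℂ) * Complex.I) *
          (bondChar (√s / (n + 2)) ξ : ℂ) ^ n ∂(gaussianReal 0 2)) atTop
      (𝓝 (∫ ξ, ((Real.exp (-(√s * m ξ)) : ℝ) : ℂ) ∂(gaussianReal 0 2))) := by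
    refine tendsto_integral_of_dominated_convergence (fun _ => 1) (fun n => ?_) (integrable_const 1)
      (fun n => ae_of_all _ fun ξ => ?_) (ae_of_all _ fun ξ => ?_)
    · have := hbm (√s / (n + 2))
      exact Measurable.aestronglyMeasurable (by fun_prop)
    · rw [norm_mul, Complex.norm_exp_ofReal_mul_I, one_mul, norm_pow, Complex.norm_real]
      exact pow_le_one₀ (norm_nonneg _) (abs_bondChar_le_one _ _)
    · have h3 := (Complex.continuous_ofReal.tendsto _).comp (tendsto_bondChar_pow ξ hs)
      have h4 : Tendsto (fun n : ℕ => Complex.exp (((√s / ((n : ℝ) + 2) * y * ξ : ℝ) : ℂ) * Complex.I))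
          atTop (𝓝 1) := by
        have h5 : Tendsto (fun n : ℕ => (√s / ((n : ℝ) + 2) * y * ξ : ℝ)) atTop (𝓝 0) := by
          simpa using (hb0.mul_const y).mul_const ξ
        have h6 := (by fun_prop : Continuous fun t : ℝ => Complex.exp ((t : ℂ) * Complex.I)).tendsto 0
        simp only [Complex.ofReal_zero, zero_mul, Complex.exp_zero] at h6
        exact h6.comp h5
      have h7 := h4.mul h3
      rw [one_mul] at h7
      refine h7.congr fun n => ?_
      simp
  have h3 := ((Complex.continuous_ofReal.tendsto _).comp h1).mul h2
  simp only [Complex.ofReal_one, one_mul] at h3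
  rw [integral_complex_ofReal] at h3
  have h4 := (Complex.continuous_re.tendsto _).comp h3
  rw [Complex.ofReal_re] at h4
  refine h4.congr fun n => ?_
  have h5 := integral_exp_neg_scaledSum (n := n) y hs.le
  simp only [Function.comp_apply]
  rw [← h5, Complex.ofReal_re]

/-- Passing to exp(-S) in [0, 1] turns the event into an inequality for a bounded variable, whose
moments are the Laplace transforms of S at natural numbers. -/
theorem tendsto_measure_scaledSum (y : ℝ) {t : ℝ} :
    Tendsto (fun n : ℕ => (Measure.pi fun _ : Fin n => stdCauchy).real {u | t < scaledSum n y u})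
      atTop (𝓝 (zLaw.real (Set.Iio (Real.exp (-t))))) := by
  have hmeas : ∀ n : ℕ, Measurable fun u : Fin n → ℝ => Real.exp (-scaledSum n y u) := fun n =>
    (Real.continuous_exp.comp (continuous_scaledSum.comp (f := fun u : Fin n → ℝ => (y, u))
      (by fun_prop)).neg).measurable
  set μ : ℕ → Measure ℝ := fun n =>
    (Measure.pi fun _ : Fin n => stdCauchy).map fun u => Real.exp (-scaledSum n y u) with hμ
  have hprob : ∀ n, IsProbabilityMeasure (μ n) := fun n =>
    Measure.isProbabilityMeasure_map (hmeas n).aemeasurable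
  have hIcc : ∀ n, ∀ᵐ x ∂(μ n), x ∈ Set.Icc (0 : ℝ) 1 := by
    intro n
    exact (ae_map_iff (p := fun x => x ∈ Set.Icc (0 : ℝ) 1) (hmeas n).aemeasurable
      measurableSet_Icc).mpr (ae_of_all _ fun u => ⟨(Real.exp_pos _).le, Real.exp_le_one_iff.mpr
      (neg_nonpos.mpr (scaledSum_nonneg y u))⟩)
  have hmom : ∀ k : ℕ, Tendsto (fun n => ∫ x, x ^ k ∂(μ n)) atTop (𝓝 (∫ x, x ^ k ∂zLaw)) := by
    intro k
    rcases Nat.eq_zero_or_pos k with rfl | hk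
    · simp
    · rw [zLaw_moment]
      refine (tendsto_integral_exp_neg_scaledSum y (s := k) (by exact_mod_cast hk)).congr fun n => ?_
      rw [hμ, integral_map (hmeas n).aemeasurable (by fun_prop)]
      refine integral_congr_ae (ae_of_all _ fun u => ?_)
      simp only
      rw [← Real.exp_nat_mul]
      congr 1; ring
  have hval : ∀ n, (Measure.pi fun _ : Fin n => stdCauchy).real {u | t < scaledSum n y u}
      = (μ n).real (Set.Iio (Real.exp (-t))) := by
    intro n
    rw [hμ, Measure.real, Measure.real, Measure.map_apply (hmeas n) measurableSet_Iio]
    congr 2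
    ext u
    simp
  simp only [hval]
  refine tendsto_of_ramp (zLaw_singleton _) (fun n h => ∫ x, h x ∂(μ n)) _
    (fun c δ _ => tendsto_integral_of_moments hIcc zLaw_mem_Icc hmom (continuous_ramp c δ)) ?_ ?_
  · refine fun δ hδ => Eventually.of_forall fun n => ?_
    rw [← integral_indicator_one measurableSet_Iio]
    refine integral_mono (Integrable.of_bound (C := 1) (continuous_ramp _ _).aestronglyMeasurable
      (ae_of_all _ fun x => ?_)) ((integrable_const 1).indicator measurableSet_Iio) fun x => ?_
    · rw [Real.norm_of_nonneg (ramp_nonneg _ _ _)]; exact ramp_le_one _ _ _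
    · by_cases hx : x < Real.exp (-t)
      · rw [Set.indicator_of_mem (show x ∈ Set.Iio _ from hx)]; exact ramp_le_one _ _ _
      · rw [Set.indicator_of_notMem (by simpa using hx), ramp_eq_zero hδ (by linarith [not_lt.mp hx])]
  · refine fun δ hδ => Eventually.of_forall fun n => ?_
    rw [← integral_indicator_one measurableSet_Iio]
    refine integral_mono ((integrable_const 1).indicator measurableSet_Iio)
      (Integrable.of_bound (C := 1) (continuous_ramp _ _).aestronglyMeasurable
      (ae_of_all _ fun x => ?_)) fun x => ?_
    · rw [Real.norm_of_nonneg (ramp_nonneg _ _ _)]; exact ramp_le_one _ _ _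
    · by_cases hx : x < Real.exp (-t)
      · rw [Set.indicator_of_mem (show x ∈ Set.Iio _ from hx), ramp_eq_one hδ hx.le]; rfl
      · rw [Set.indicator_of_notMem (by simpa using hx)]; exact ramp_nonneg _ _ _

/-- The distribution function of the model amplitude with `n + 2` bonds of equal length. -/
def modelCdf (n : ℕ) (r : ℝ) : ℝ :=
  ∫ y, (Measure.pi fun _ : Fin n => stdCauchy).real {u | 2 * (1 + y ^ 2) / r < scaledSum n y u} ∂stdCauchy

/-- The limit of `modelCdf` for a large number of bonds. -/
def limCdf (r : ℝ) : ℝ := ∫ y, zLaw.real (Set.Iio (Real.exp (-(2 * (1 + y ^ 2) / r)))) ∂stdCauchy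

theorem measurable_modelCdf_integrand (n : ℕ) (r : ℝ) : Measurable fun y : ℝ =>
    (Measure.pi fun _ : Fin n => stdCauchy).real {u | 2 * (1 + y ^ 2) / r < scaledSum n y u} := by
  have hs : MeasurableSet {p : ℝ × (Fin n → ℝ) | 2 * (1 + p.1 ^ 2) / r < scaledSum n p.1 p.2} :=
    measurableSet_lt (by fun_prop) continuous_scaledSum.measurable
  exact (measurable_measure_prodMk_left hs).ennreal_toReal

theorem tendsto_modelCdf (r : ℝ) : Tendsto (fun n => modelCdf n r) atTop (𝓝 (limCdf r)) := by
  refine tendsto_integral_of_dominated_convergence (fun _ => 1)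
    (fun n => (measurable_modelCdf_integrand n r).aestronglyMeasurable) (integrable_const 1)
    (fun n => ae_of_all _ fun y => ?_) (ae_of_all _ fun y => ?_)
  · rw [Real.norm_of_nonneg measureReal_nonneg]; exact measureReal_le_one
  · exact tendsto_measure_scaledSum y

end Stable

/-! ### The Dawson function. -/

section Dawson

/-- The Dawson function, on the nonnegative half line. -/
def dawson (a : ℝ) : ℝ := a * ∫ s in (0 : ℝ)..1, Real.exp (-(a ^ 2 * (1 - s ^ 2)))

theorem continuous_dawson : Continuous dawson := by
  unfold dawson
  refine continuous_id.mul ?_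
  exact intervalIntegral.continuous_parametric_intervalIntegral_of_continuous' (by fun_prop) 0 1

theorem dawson_nonneg {a : ℝ} (ha : 0 ≤ a) : 0 ≤ dawson a :=
  mul_nonneg ha (intervalIntegral.integral_nonneg zero_le_one fun _ _ => (Real.exp_pos _).le)

/-- With b = a², inserting a factor s into the integrand 2b exp(-b(1 - s²)) makes it an exact
derivative with integral 1 - exp(-b). The error carries 1 - s, and replacing 1 - s² by 1 - s in its
exponent gives the bound 2/b. -/
theorem abs_two_mul_dawson_sub_one_le {a : ℝ} (ha : 0 < a) : |2 * a * dawson a - 1| ≤ 2 / a ^ 2 := by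
  have hb : 0 < a ^ 2 := by positivity
  set b := a ^ 2 with hbdef
  have h1 : 2 * a * dawson a = ∫ s in (0 : ℝ)..1, 2 * b * Real.exp (-(b * (1 - s ^ 2))) := by
    rw [intervalIntegral.integral_const_mul, dawson, ← hbdef, hbdef]; ring
  have h2 : ∫ s in (0 : ℝ)..1, 2 * b * s * Real.exp (-(b * (1 - s ^ 2))) = 1 - Real.exp (-b) := by
    have hd : ∀ s : ℝ, HasDerivAt (fun s => Real.exp (-(b * (1 - s ^ 2))))
        (2 * b * s * Real.exp (-(b * (1 - s ^ 2)))) s := by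
      intro s
      have := (((((hasDerivAt_id s).pow 2).const_sub 1).const_mul b).neg).exp
      refine this.congr_deriv ?_
      simp
      ring
    rw [intervalIntegral.integral_eq_sub_of_hasDerivAt (fun s _ => hd s)
      (Continuous.intervalIntegrable (by fun_prop) _ _)]
    simp
  have h3 : 2 * a * dawson a - (1 - Real.exp (-b))
      = ∫ s in (0 : ℝ)..1, 2 * b * (1 - s) * Real.exp (-(b * (1 - s ^ 2))) := by
    rw [h1, ← h2, ← intervalIntegral.integral_sub (Continuous.intervalIntegrable (by fun_prop) _ _)
      (Continuous.intervalIntegrable (by fun_prop) _ _)]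
    refine intervalIntegral.integral_congr fun s _ => ?_
    ring
  have h4 : 0 ≤ ∫ s in (0 : ℝ)..1, 2 * b * (1 - s) * Real.exp (-(b * (1 - s ^ 2))) :=
    intervalIntegral.integral_nonneg zero_le_one fun s hs =>
      mul_nonneg (mul_nonneg (by positivity) (by linarith [hs.2])) (Real.exp_pos _).le
  have h5 : ∫ s in (0 : ℝ)..1, 2 * b * (1 - s) * Real.exp (-(b * (1 - s ^ 2))) ≤ 2 / b := by
    calc _ ≤ ∫ s in (0 : ℝ)..1, 2 * b * (1 - s) * Real.exp (-(b * (1 - s))) := by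
          refine intervalIntegral.integral_mono_on zero_le_one (Continuous.intervalIntegrable (by fun_prop) _ _)
            (Continuous.intervalIntegrable (by fun_prop) _ _) fun s hs => ?_
          have h6 : 0 ≤ 1 - s := by linarith [hs.2]
          refine mul_le_mul_of_nonneg_left (Real.exp_le_exp.mpr ?_) (by positivity)
          have : b * (1 - s) ≤ b * (1 - s ^ 2) := by
            refine mul_le_mul_of_nonneg_left ?_ hb.le
            nlinarith [hs.1]
          linarith
      _ ≤ 2 / b := by
          have hd : ∀ s : ℝ, HasDerivAt (fun s => (2 * (1 - s) + 2 / b) * Real.exp (-(b * (1 - s))))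
              (2 * b * (1 - s) * Real.exp (-(b * (1 - s)))) s := by
            intro s
            have h0 := (hasDerivAt_id s).const_sub 1
            have := ((h0.const_mul 2).add_const (2 / b)).mul ((h0.const_mul b).neg.exp)
            refine this.congr_deriv ?_
            simp only [id, Pi.neg_apply]
            field_simp
            ring
          rw [intervalIntegral.integral_eq_sub_of_hasDerivAt (fun s _ => hd s)
            (Continuous.intervalIntegrable (by fun_prop) _ _)]
          simp
          positivity
  have h6 : Real.exp (-b) ≤ 2 / b := by
    rw [Real.exp_neg, ← one_div]
    have := Real.add_one_le_exp b
    rw [div_le_div_iff₀ (Real.exp_pos _) hb]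
    nlinarith
  have h7 := Real.exp_pos (-b)
  rw [abs_le]
  constructor <;> linarith

theorem dawson_le_two {a : ℝ} (ha : 0 ≤ a) : dawson a ≤ 2 := by
  rcases le_or_gt a 1 with h | h
  · have h1 : ∫ s in (0 : ℝ)..1, Real.exp (-(a ^ 2 * (1 - s ^ 2))) ≤ ∫ _ in (0 : ℝ)..1, (1 : ℝ) := by
      refine intervalIntegral.integral_mono_on zero_le_one (Continuous.intervalIntegrable (by fun_prop) _ _)
        (by simp) fun s hs => Real.exp_le_one_iff.mpr ?_
      have : 0 ≤ 1 - s ^ 2 := by nlinarith [hs.1, hs.2]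
      have := mul_nonneg (sq_nonneg a) this
      linarith
    simp at h1
    rw [dawson]
    nlinarith
  · have h1 := (abs_le.mp (abs_two_mul_dawson_sub_one_le (by linarith : 0 < a))).2
    have h2 : 2 / a ^ 2 ≤ 2 := by
      rw [div_le_iff₀ (by positivity)]; nlinarith
    have := dawson_nonneg ha
    nlinarith

/-- Substitute s = y / √(1 + y²), so that 1 - s² = 1 / (1 + y²) and ds = dy / (1 + y²)^(3/2). -/
theorem integral_stdCauchy_eq_dawson {a : ℝ} :
    ∫ y, a / √(1 + y ^ 2) * Real.exp (-(a ^ 2 / (1 + y ^ 2))) ∂stdCauchy = 2 / π * dawson a := by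
  set r : ℝ → ℝ := fun y => √(1 + y ^ 2) with hr
  have hrpos : ∀ y, 0 < r y := fun y => Real.sqrt_pos.mpr (by positivity)
  have hrsq : ∀ y, r y ^ 2 = 1 + y ^ 2 := fun y => Real.sq_sqrt (by positivity)
  have hd : ∀ y, HasDerivAt (fun y => y / r y) (1 / ((1 + y ^ 2) * r y)) y := by
    intro y
    have h1 : HasDerivAt (fun y : ℝ => 1 + y ^ 2) (2 * y) y := by
      simpa using ((hasDerivAt_id y).pow 2).const_add 1
    have h2 : HasDerivAt r (y / r y) y := by
      refine (h1.sqrt (by positivity : 1 + y ^ 2 ≠ 0)).congr_deriv ?_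
      change 2 * y / (2 * r y) = _
      have := (hrpos y).ne'
      field_simp
    refine ((hasDerivAt_id y).div h2 (hrpos y).ne').congr_deriv ?_
    have h3 := (hrpos y).ne'
    simp only [id]
    rw [← hrsq y]
    field_simp
    rw [hrsq]; ring
  have hlt : ∀ y, |y| < r y := fun y => by
    rw [← Real.sqrt_sq_eq_abs]
    exact Real.sqrt_lt_sqrt (sq_nonneg y) (by linarith)
  have hs2 : ∀ y, 1 - (y / r y) ^ 2 = 1 / (1 + y ^ 2) := fun y => by
    rw [div_pow, hrsq]
    have : 1 + y ^ 2 ≠ 0 := by positivity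
    field_simp
    ring
  have himg : (fun y => y / r y) '' Set.univ = Set.Ioo (-1) 1 := by
    ext s
    simp only [Set.image_univ, Set.mem_range, Set.mem_Ioo]
    constructor
    · rintro ⟨y, rfl⟩
      rw [← abs_lt, abs_div, abs_of_pos (hrpos y), div_lt_one (hrpos y)]
      exact hlt y
    · intro hs
      have h1 : 0 < 1 - s ^ 2 := by nlinarith [hs.1, hs.2]
      have h2 := Real.sqrt_pos.mpr h1
      refine ⟨s / √(1 - s ^ 2), ?_⟩
      have h3 : r (s / √(1 - s ^ 2)) = 1 / √(1 - s ^ 2) := by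
        simp only [hr]
        rw [div_pow, Real.sq_sqrt h1.le]
        rw [show 1 + s ^ 2 / (1 - s ^ 2) = 1 / (1 - s ^ 2) by field_simp; ring, Real.sqrt_div zero_le_one,
          Real.sqrt_one]
      rw [h3]
      field_simp
  have hinj : Set.InjOn (fun y => y / r y) Set.univ := by
    intro y _ w _ h
    simp only at h
    have h1 := hs2 y
    rw [h, hs2 w] at h1
    have h2 : (1 + w ^ 2) = 1 + y ^ 2 := by
      have h3 : (0 : ℝ) < 1 + w ^ 2 := by positivity
      have h4 : (0 : ℝ) < 1 + y ^ 2 := by positivity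
      field_simp at h1
      linarith
    have h3 : r w = r y := by simp only [hr, h2]
    rw [h3] at h
    exact (div_left_inj' (hrpos y).ne').mp h
  have h1 := integral_image_eq_integral_abs_deriv_smul MeasurableSet.univ
    (fun y _ => (hd y).hasDerivWithinAt) hinj (fun s => a * Real.exp (-(a ^ 2 * (1 - s ^ 2))))
  rw [himg] at h1
  have h2 : ∫ s in Set.Ioo (-1 : ℝ) 1, a * Real.exp (-(a ^ 2 * (1 - s ^ 2))) = 2 * dawson a := by
    rw [← integral_Ioc_eq_integral_Ioo, ← intervalIntegral.integral_of_le (by norm_num),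
      intervalIntegral.integral_const_mul, ← intervalIntegral.integral_add_adjacent_intervals (b := 0)
      (Continuous.intervalIntegrable (by fun_prop) _ _) (Continuous.intervalIntegrable (by fun_prop) _ _)]
    have h3 := intervalIntegral.integral_comp_neg (a := 0) (b := 1)
      (fun s : ℝ => Real.exp (-(a ^ 2 * (1 - s ^ 2))))
    simp only [neg_sq, neg_zero] at h3
    rw [← h3, dawson]
    ring
  rw [h2] at h1
  rw [integral_stdCauchy, div_mul_eq_mul_div, h1, eq_div_iff Real.pi_ne_zero, mul_comm, ← integral_const_mul]
  simp only [Measure.restrict_univ, smul_eq_mul]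
  refine integral_congr_ae (ae_of_all _ fun y => ?_)
  simp only
  rw [hs2, abs_of_pos (by have := hrpos y; positivity)]
  have h4 := (hrpos y).ne'
  have h5 := Real.pi_ne_zero
  have h6 : (1 + y ^ 2) ≠ 0 := by positivity
  change π * ((π * (1 + y ^ 2))⁻¹ * (a / r y * _)) = _
  rw [mul_one_div]
  field_simp

end Dawson

/-! ### Q as a Gaussian average of the Dawson function. -/

section LimitDensity

open ProbabilityTheory

/-- The argument of the Dawson function in the limit density. -/
def dawsonArg (Lbar η ξ : ℝ) : ℝ := √(Lbar * η) * m ξ / (2 * √2)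

theorem dawsonArg_nonneg (Lbar η ξ : ℝ) : 0 ≤ dawsonArg Lbar η ξ :=
  div_nonneg (mul_nonneg (Real.sqrt_nonneg _) (m_pos ξ).le) (by positivity)

theorem dawsonArg_pos {Lbar η : ℝ} (hL : 0 < Lbar) (hη : 0 < η) (ξ : ℝ) : 0 < dawsonArg Lbar η ξ := by
  have := m_pos ξ
  unfold dawsonArg
  positivity

theorem dawsonArg_sq {Lbar η : ℝ} (hL : 0 < Lbar) (hη : 0 < η) (ξ : ℝ) :
    dawsonArg Lbar η ξ ^ 2 = Lbar * η * m ξ ^ 2 / 8 := by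
  rw [dawsonArg, div_pow, mul_pow, mul_pow, Real.sq_sqrt (by positivity), Real.sq_sqrt (by norm_num)]
  ring

theorem continuous_dawsonArg (Lbar : ℝ) : Continuous fun p : ℝ × ℝ => dawsonArg Lbar p.1 p.2 := by
  unfold dawsonArg
  have := continuous_m
  fun_prop

theorem cerfc_neg_I_mul (a : ℝ) :
    cerfc (-(Complex.I * a)) = 1 + ((2 / √π * (a * ∫ t in (0 : ℝ)..1, Real.exp (a ^ 2 * t ^ 2)) : ℝ) : ℂ)
      * Complex.I := by
  have h1 : ∀ t : ℝ, -(Complex.I * a) * Complex.exp (-((t : ℂ) * -(Complex.I * a)) ^ 2)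
      = -(Complex.I * a) * ((Real.exp (a ^ 2 * t ^ 2) : ℝ) : ℂ) := by
    intro t
    rw [Complex.ofReal_exp]
    congr 2
    push_cast
    linear_combination -(a : ℂ) ^ 2 * t ^ 2 * Complex.I_sq
  rw [cerfc]
  simp only [h1]
  rw [intervalIntegral.integral_const_mul, intervalIntegral.integral_ofReal]
  push_cast
  ring

theorem integrable_exp_mul_dawson (Lbar η : ℝ) :
    Integrable fun ξ => Real.exp (-ξ ^ 2 / 4) * dawson (dawsonArg Lbar η ξ) := by
  have hg : Integrable fun ξ : ℝ => Real.exp (-ξ ^ 2 / 4) * 2 := by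
    have := (integrable_exp_neg_mul_sq (b := 1 / 4) (by norm_num)).mul_const 2
    refine this.congr (ae_of_all _ fun ξ => ?_)
    simp only
    congr 2
    ring
  refine hg.mono' (Continuous.aestronglyMeasurable ?_) (ae_of_all _ fun ξ => ?_)
  · exact (by fun_prop : Continuous fun ξ : ℝ => Real.exp (-ξ ^ 2 / 4)).mul (continuous_dawson.comp
      ((continuous_dawsonArg Lbar).comp (f := fun ξ : ℝ => (η, ξ)) (by fun_prop)))
  · have h1 := dawson_nonneg (dawsonArg_nonneg Lbar η ξ)
    rw [Real.norm_of_nonneg (mul_nonneg (Real.exp_pos _).le h1)]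
    exact mul_le_mul_of_nonneg_left (dawson_le_two (dawsonArg_nonneg Lbar η ξ)) (Real.exp_pos _).le

/-- The argument of `cerfc` is -ia with a = `dawsonArg`, so the real part of `cerfc` is 1 and drops
out. The imaginary part, multiplied by exp(-a²), is the Dawson function up to 2/√π. -/
theorem Q_eq {Lbar η : ℝ} (hL : 0 < Lbar) (hη : 0 < η) :
    Q Lbar η = (π ^ 2 * η)⁻¹ * ∫ ξ, Real.exp (-ξ ^ 2 / 4) * dawson (dawsonArg Lbar η ξ) := by
  have hint : ∀ ξ : ℝ, ((Real.exp (-ξ ^ 2 / 4 - Lbar * η * m ξ ^ 2 / 8) : ℝ) : ℂ) *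
      cerfc (((√(Lbar * η) * m ξ : ℝ) : ℂ) / (2 * Complex.I * ((√2 : ℝ) : ℂ)))
      = ((Real.exp (-ξ ^ 2 / 4 - Lbar * η * m ξ ^ 2 / 8) : ℝ) : ℂ) +
        ((2 / √π * (Real.exp (-ξ ^ 2 / 4) * dawson (dawsonArg Lbar η ξ)) : ℝ) : ℂ) * Complex.I := by
    intro ξ
    have h1 : ((√(Lbar * η) * m ξ : ℝ) : ℂ) / (2 * Complex.I * ((√2 : ℝ) : ℂ))
        = -(Complex.I * (dawsonArg Lbar η ξ : ℂ)) := by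
      have h2 : ((√2 : ℝ) : ℂ) ≠ 0 := by
        exact_mod_cast (by positivity : √2 ≠ 0)
      rw [dawsonArg]
      push_cast
      field_simp
      rw [Complex.I_sq]
      ring
    rw [h1, cerfc_neg_I_mul, mul_add, mul_one, ← mul_assoc, ← Complex.ofReal_mul]
    congr 3
    rw [dawson, ← dawsonArg_sq hL hη]
    set a := dawsonArg Lbar η ξ
    rw [sub_eq_add_neg, Real.exp_add]
    have h3 : ∫ s in (0 : ℝ)..1, Real.exp (-(a ^ 2 * (1 - s ^ 2)))
        = Real.exp (-a ^ 2) * ∫ t in (0 : ℝ)..1, Real.exp (a ^ 2 * t ^ 2) := by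
      rw [← intervalIntegral.integral_const_mul]
      refine intervalIntegral.integral_congr fun s _ => ?_
      rw [← Real.exp_add]
      congr 1; ring
    rw [h3]
    ring
  have hi1 : Integrable fun ξ : ℝ => Real.exp (-ξ ^ 2 / 4 - Lbar * η * m ξ ^ 2 / 8) := by
    have hg : Integrable fun ξ : ℝ => Real.exp (-ξ ^ 2 / 4) := by
      refine (integrable_exp_neg_mul_sq (b := 1 / 4) (by norm_num)).congr (ae_of_all _ fun ξ => ?_)
      simp only
      congr 1
      ring
    have := continuous_m
    refine hg.mono' (Continuous.aestronglyMeasurable (by fun_prop)) (ae_of_all _ fun ξ => ?_)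
    rw [Real.norm_of_nonneg (Real.exp_pos _).le]
    refine Real.exp_le_exp.mpr ?_
    have : 0 ≤ Lbar * η * m ξ ^ 2 / 8 := by positivity
    linarith
  have hi2 := (integrable_exp_mul_dawson Lbar η).const_mul (2 / √π)
  rw [Q]
  simp only [hint]
  rw [integral_add hi1.ofReal (hi2.ofReal.mul_const _), integral_mul_const, integral_complex_ofReal,
    integral_complex_ofReal, integral_const_mul]
  simp only [Complex.add_im, Complex.ofReal_im, zero_add, Complex.mul_im, Complex.ofReal_re,
    Complex.I_im, mul_one, Complex.I_re, mul_zero, add_zero]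
  have h3 : π ^ (3 / 2 : ℝ) = π * √π := by
    rw [Real.sqrt_eq_rpow, show (3 / 2 : ℝ) = 1 + 1 / 2 by norm_num, Real.rpow_add Real.pi_pos,
      Real.rpow_one]
  rw [h3]
  have h4 := Real.mul_self_sqrt Real.pi_pos.le
  have h5 : √π ≠ 0 := by positivity
  have h6 := Real.pi_ne_zero
  field_simp
  rw [sq, h4]

theorem Q_nonneg {Lbar η : ℝ} (hL : 0 < Lbar) (hη : 0 < η) : 0 ≤ Q Lbar η := by
  rw [Q_eq hL hη]
  refine mul_nonneg (by positivity) (integral_nonneg fun ξ => ?_)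
  exact mul_nonneg (Real.exp_pos _).le (dawson_nonneg (dawsonArg_nonneg _ _ _))

theorem continuousOn_Q {Lbar : ℝ} (hL : 0 < Lbar) : ContinuousOn (Q Lbar) (Set.Ioi 0) := by
  have hG : Continuous fun η => ∫ ξ, Real.exp (-ξ ^ 2 / 4) * dawson (dawsonArg Lbar η ξ) := by
    have hg : Integrable fun ξ : ℝ => Real.exp (-ξ ^ 2 / 4) * 2 := by
      refine ((integrable_exp_neg_mul_sq (b := 1 / 4) (by norm_num)).mul_const 2).congr
        (ae_of_all _ fun ξ => ?_)
      simp only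
      congr 2
      ring
    refine continuous_of_dominated (fun η => (integrable_exp_mul_dawson Lbar η).aestronglyMeasurable)
      (fun η => ae_of_all _ fun ξ => ?_) hg (ae_of_all _ fun ξ => ?_)
    · have h1 := dawson_nonneg (dawsonArg_nonneg Lbar η ξ)
      rw [Real.norm_of_nonneg (mul_nonneg (Real.exp_pos _).le h1)]
      exact mul_le_mul_of_nonneg_left (dawson_le_two (dawsonArg_nonneg Lbar η ξ)) (Real.exp_pos _).le
    · exact continuous_const.mul (continuous_dawson.comp
        ((continuous_dawsonArg Lbar).comp (f := fun η : ℝ => (η, ξ)) (by fun_prop)))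
  have h1 : ContinuousOn (fun η => (π ^ 2 * η)⁻¹ *
      ∫ ξ, Real.exp (-ξ ^ 2 / 4) * dawson (dawsonArg Lbar η ξ)) (Set.Ioi 0) := by
    refine ContinuousOn.mul (ContinuousOn.inv₀ (by fun_prop) fun η hη => ?_) hG.continuousOn
    have : (0 : ℝ) < η := hη
    positivity
  exact h1.congr fun η hη => Q_eq hL hη

/-- The density of `c x²` for a standard Gaussian `x`. -/
def sqDensity (c η : ℝ) : ℝ := (√(2 * π))⁻¹ * (√(η / c) / η) * Real.exp (-(η / c / 2))

theorem sqDensity_nonneg (c : ℝ) {η : ℝ} (hη : 0 ≤ η) : 0 ≤ sqDensity c η := by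
  unfold sqDensity; positivity

/-- Change of variables on the two branches x = ±√(η/c), which contribute equally. -/
theorem gaussianReal_sq_mem {c : ℝ} (hc : 0 < c) {B : Set ℝ} (hB : MeasurableSet B) (hB0 : B ⊆ Set.Ioi 0) :
    gaussianReal 0 1 {x | c * x ^ 2 ∈ B} = ∫⁻ η in B, ENNReal.ofReal (sqDensity c η) := by
  have hpre : MeasurableSet {x : ℝ | c * x ^ 2 ∈ B} := (by fun_prop : Measurable fun x : ℝ => c * x ^ 2) hB
  have hd : ∀ η ∈ B, HasDerivAt (fun η => √(η / c)) (√(η / c) / (2 * η)) η := by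
    intro η hη
    have hη0 : 0 < η := hB0 hη
    have h0 : 0 < η / c := by positivity
    refine (((hasDerivAt_id η).div_const c).sqrt h0.ne').congr_deriv ?_
    simp only [id]
    have h1 := Real.sqrt_pos.mpr h0
    have h2 : √(η / c) ^ 2 = η / c := Real.sq_sqrt h0.le
    rw [div_div, div_eq_div_iff (by positivity) (by positivity)]
    field_simp
    rw [h2]
    field_simp
  have himg : (fun η => √(η / c)) '' B = {x | c * x ^ 2 ∈ B} ∩ Set.Ioi 0 := by
    ext x
    constructor
    · rintro ⟨η, hη, rfl⟩
      have hη0 : 0 < η := hB0 hη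
      have h0 : 0 < η / c := by positivity
      refine ⟨?_, Real.sqrt_pos.mpr h0⟩
      change c * √(η / c) ^ 2 ∈ B
      rw [Real.sq_sqrt h0.le, mul_div_cancel₀ _ hc.ne']
      exact hη
    · rintro ⟨hx, hx0⟩
      refine ⟨c * x ^ 2, hx, ?_⟩
      simp only
      rw [mul_div_cancel_left₀ _ hc.ne', Real.sqrt_sq (le_of_lt hx0)]
  have himg2 : (fun η => -√(η / c)) '' B = {x | c * x ^ 2 ∈ B} ∩ Set.Iio 0 := by
    ext x
    constructor
    · rintro ⟨η, hη, rfl⟩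
      have hη0 : 0 < η := hB0 hη
      have h0 : 0 < η / c := by positivity
      refine ⟨?_, neg_lt_zero.mpr (Real.sqrt_pos.mpr h0)⟩
      change c * (-√(η / c)) ^ 2 ∈ B
      rw [neg_sq, Real.sq_sqrt h0.le, mul_div_cancel₀ _ hc.ne']
      exact hη
    · rintro ⟨hx, hx0⟩
      refine ⟨c * x ^ 2, hx, ?_⟩
      simp only
      rw [mul_div_cancel_left₀ _ hc.ne', Real.sqrt_sq_eq_abs, abs_of_neg hx0, neg_neg]
  have hinj : Set.InjOn (fun η => √(η / c)) B := by
    intro a ha b hb h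
    have ha0 : 0 < a := hB0 ha
    have hb0 : 0 < b := hB0 hb
    have := (Real.sqrt_inj (by positivity) (by positivity)).mp h
    exact (div_left_inj' hc.ne').mp this
  have hsplit : {x : ℝ | c * x ^ 2 ∈ B} =
      ({x | c * x ^ 2 ∈ B} ∩ Set.Ioi 0) ∪ ({x | c * x ^ 2 ∈ B} ∩ Set.Iio 0) := by
    ext x
    constructor
    · intro hx
      rcases lt_trichotomy x 0 with h | h | h
      · exact Or.inr ⟨hx, h⟩
      · have hx' : c * x ^ 2 ∈ B := hx
        have := hB0 hx'
        rw [h] at this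
        simp at this
      · exact Or.inl ⟨hx, h⟩
    · rintro (h | h) <;> exact h.1
  have hdisj : Disjoint ({x : ℝ | c * x ^ 2 ∈ B} ∩ Set.Ioi 0) ({x | c * x ^ 2 ∈ B} ∩ Set.Iio 0) :=
    Set.disjoint_left.mpr fun x hx hx2 => lt_asymm (show (0:ℝ) < x from hx.2) (show x < 0 from hx2.2)
  rw [hsplit, measure_union hdisj (hpre.inter measurableSet_Iio), gaussianReal_apply _ one_ne_zero,
    gaussianReal_apply _ one_ne_zero, ← himg, ← himg2,
    lintegral_image_eq_lintegral_abs_deriv_mul hB (fun η hη => (hd η hη).hasDerivWithinAt) hinj,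
    lintegral_image_eq_lintegral_abs_deriv_mul (f := fun η => -√(η / c))
      (f' := fun η => -(√(η / c) / (2 * η))) hB (fun η hη => (hd η hη).neg.hasDerivWithinAt)
      (fun a ha b hb h => hinj ha hb (neg_injective h)), ← lintegral_add_left (by fun_prop)]
  refine setLIntegral_congr_fun hB fun η hη => ?_
  have hη0 : 0 < η := hB0 hη
  have h0 : 0 < η / c := by positivity
  have hpdf : gaussianPDFReal 0 1 √(η / c) = (√(2 * π))⁻¹ * Real.exp (-(η / c / 2)) := by
    rw [gaussianPDFReal]
    simp only [sub_zero, NNReal.coe_one, mul_one]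
    rw [Real.sq_sqrt h0.le, neg_div]
  have hpdf2 : gaussianPDFReal 0 1 (-√(η / c)) = (√(2 * π))⁻¹ * Real.exp (-(η / c / 2)) := by
    rw [gaussianPDFReal]
    simp only [sub_zero, NNReal.coe_one, mul_one]
    rw [neg_sq, Real.sq_sqrt h0.le, neg_div]
  simp only [gaussianPDF, abs_neg]
  rw [hpdf, hpdf2, ← ENNReal.ofReal_mul (abs_nonneg _), ← ENNReal.ofReal_add (by positivity) (by positivity)]
  congr 1
  rw [abs_of_nonneg (by positivity), sqDensity]
  field_simp
  ring

end LimitDensity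

/-! ### Q as the density of a mixture of scaled squares of Gaussians. -/

section Mixture

open ProbabilityTheory

/-- The limit law is that of `sqScale * x²` with a standard Gaussian `x`. -/
def sqScale (Lbar ξ y : ℝ) : ℝ := 4 * (1 + y ^ 2) / (Lbar * m ξ ^ 2)

theorem sqScale_pos {Lbar : ℝ} (hL : 0 < Lbar) (ξ y : ℝ) : 0 < sqScale Lbar ξ y := by
  have := m_pos ξ
  unfold sqScale
  positivity

theorem measurable_sqDensity_sqScale (Lbar : ℝ) :
    Measurable fun p : ℝ × ℝ × ℝ => sqDensity (sqScale Lbar p.2.2 p.2.1) p.1 := by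
  have := continuous_m.measurable
  unfold sqDensity sqScale
  fun_prop

theorem sqDensity_sqScale {Lbar η : ℝ} (hL : 0 < Lbar) (hη : 0 < η) (ξ y : ℝ) :
    sqDensity (sqScale Lbar ξ y) η = (√π * η)⁻¹ * (dawsonArg Lbar η ξ / √(1 + y ^ 2) *
      Real.exp (-(dawsonArg Lbar η ξ ^ 2 / (1 + y ^ 2)))) := by
  have hm := m_pos ξ
  have hA := dawsonArg_pos hL hη ξ
  have h1 : η / sqScale Lbar ξ y = 2 * (dawsonArg Lbar η ξ ^ 2 / (1 + y ^ 2)) := by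
    rw [dawsonArg_sq hL hη, sqScale]
    field_simp
    ring
  have h2 : √(2 * (dawsonArg Lbar η ξ ^ 2 / (1 + y ^ 2))) = √2 * (dawsonArg Lbar η ξ / √(1 + y ^ 2)) := by
    rw [Real.sqrt_mul (by norm_num), Real.sqrt_div (by positivity), Real.sqrt_sq hA.le]
  rw [sqDensity, h1, h2, Real.sqrt_mul (by norm_num), mul_div_cancel_left₀ _ (two_ne_zero)]
  have h3 : √2 ≠ 0 := by positivity
  have h4 : √π ≠ 0 := by positivity
  field_simp

theorem lintegral_sqDensity_stdCauchy {Lbar η : ℝ} (hL : 0 < Lbar) (hη : 0 < η) (ξ : ℝ) :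
    ∫⁻ y, ENNReal.ofReal (sqDensity (sqScale Lbar ξ y) η) ∂stdCauchy
      = ENNReal.ofReal (2 / (π * √π * η) * dawson (dawsonArg Lbar η ξ)) := by
  have hA := dawsonArg_pos hL hη ξ
  have hint : Integrable (fun y : ℝ => sqDensity (sqScale Lbar ξ y) η) stdCauchy := by
    refine Integrable.of_bound (C := (√π * η)⁻¹ * dawsonArg Lbar η ξ) ?_ (ae_of_all _ fun y => ?_)
    · exact ((measurable_sqDensity_sqScale Lbar).comp
        (g := fun p : ℝ × ℝ × ℝ => sqDensity (sqScale Lbar p.2.2 p.2.1) p.1)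
        (f := fun y : ℝ => (η, y, ξ)) (by fun_prop)).aestronglyMeasurable
    · rw [Real.norm_of_nonneg (sqDensity_nonneg _ hη.le), sqDensity_sqScale hL hη]
      refine mul_le_mul_of_nonneg_left ?_ (by positivity)
      have h1 : 1 ≤ √(1 + y ^ 2) := Real.one_le_sqrt.mpr (by nlinarith [sq_nonneg y])
      have h2 : dawsonArg Lbar η ξ / √(1 + y ^ 2) ≤ dawsonArg Lbar η ξ := div_le_self hA.le h1
      have h3 : Real.exp (-(dawsonArg Lbar η ξ ^ 2 / (1 + y ^ 2))) ≤ 1 :=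
        Real.exp_le_one_iff.mpr (neg_nonpos.mpr (by positivity))
      exact (mul_le_of_le_one_right (by positivity) h3).trans h2
  rw [← ofReal_integral_eq_lintegral_ofReal hint (ae_of_all _ fun y => sqDensity_nonneg _ hη.le)]
  congr 1
  simp only [sqDensity_sqScale hL hη]
  rw [integral_const_mul, integral_stdCauchy_eq_dawson]
  have h4 : √π ≠ 0 := by positivity
  field_simp

theorem lintegral_sqDensity {Lbar η : ℝ} (hL : 0 < Lbar) (hη : 0 < η) :
    ∫⁻ ξ, ∫⁻ y, ENNReal.ofReal (sqDensity (sqScale Lbar ξ y) η) ∂stdCauchy ∂(gaussianReal 0 2)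
      = ENNReal.ofReal (Q Lbar η) := by
  have hd : ∀ ξ, 0 ≤ dawson (dawsonArg Lbar η ξ) := fun ξ => dawson_nonneg (dawsonArg_nonneg _ _ _)
  have hc : Continuous fun ξ => dawson (dawsonArg Lbar η ξ) :=
    continuous_dawson.comp ((continuous_dawsonArg Lbar).comp (f := fun ξ : ℝ => (η, ξ)) (by fun_prop))
  simp only [lintegral_sqDensity_stdCauchy hL hη]
  have hint : Integrable (fun ξ => 2 / (π * √π * η) * dawson (dawsonArg Lbar η ξ)) (gaussianReal 0 2) := by
    refine (Integrable.of_bound (C := 2) hc.aestronglyMeasurable (ae_of_all _ fun ξ => ?_)).const_mul _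
    rw [Real.norm_of_nonneg (hd ξ)]
    exact dawson_le_two (dawsonArg_nonneg _ _ _)
  rw [← ofReal_integral_eq_lintegral_ofReal hint (ae_of_all _ fun ξ => mul_nonneg (by positivity) (hd ξ)),
    integral_const_mul, integral_gaussianReal_eq_integral_smul two_ne_zero, Q_eq hL hη]
  congr 1
  have h1 : ∀ ξ : ℝ, gaussianPDFReal 0 2 ξ • dawson (dawsonArg Lbar η ξ)
      = (2 * √π)⁻¹ * (Real.exp (-ξ ^ 2 / 4) * dawson (dawsonArg Lbar η ξ)) := by
    intro ξ
    rw [gaussianPDFReal, smul_eq_mul]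
    have h2 : √(2 * π * ((2 : NNReal) : ℝ)) = 2 * √π := by
      rw [NNReal.coe_ofNat, show 2 * π * 2 = 2 ^ 2 * π by ring, Real.sqrt_mul (by positivity),
        Real.sqrt_sq (by norm_num)]
    rw [h2, NNReal.coe_ofNat, sub_zero]
    norm_num
    ring
  simp only [h1]
  rw [integral_const_mul, ← mul_assoc]
  congr 1
  have h3 := Real.mul_self_sqrt Real.pi_pos.le
  have h4 : √π ≠ 0 := by positivity
  have h5 := Real.pi_ne_zero
  field_simp
  nlinarith

/-- Tonelli, after averaging the density of a scaled squared Gaussian over y and then ξ. The half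
line B = (0, ∞) gives the total mass, and B = (0, R) the distribution function. -/
theorem setLIntegral_Q {Lbar : ℝ} (hL : 0 < Lbar) {B : Set ℝ} (hB : MeasurableSet B) (hB0 : B ⊆ Set.Ioi 0) :
    ∫⁻ η in B, ENNReal.ofReal (Q Lbar η)
      = ∫⁻ y, ∫⁻ ξ, gaussianReal 0 1 {x | sqScale Lbar ξ y * x ^ 2 ∈ B} ∂(gaussianReal 0 2) ∂stdCauchy := by
  have hmeas := (measurable_sqDensity_sqScale Lbar).ennreal_ofReal
  have h1 : ∫⁻ η in B, ENNReal.ofReal (Q Lbar η)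
      = ∫⁻ η in B, ∫⁻ y, ∫⁻ ξ, ENNReal.ofReal (sqDensity (sqScale Lbar ξ y) η)
        ∂(gaussianReal 0 2) ∂stdCauchy := by
    refine setLIntegral_congr_fun hB fun η hη => ?_
    rw [← lintegral_sqDensity hL (hB0 hη), lintegral_lintegral_swap]
    exact (hmeas.comp (f := fun p : ℝ × ℝ => (η, p.2, p.1)) (by fun_prop)).aemeasurable
  have h2 : Measurable (Function.uncurry fun η y : ℝ =>
      ∫⁻ ξ, ENNReal.ofReal (sqDensity (sqScale Lbar ξ y) η) ∂(gaussianReal 0 2)) :=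
    Measurable.lintegral_prod_right' (f := fun q : (ℝ × ℝ) × ℝ =>
      ENNReal.ofReal (sqDensity (sqScale Lbar q.2 q.1.2) q.1.1))
      (hmeas.comp (f := fun q : (ℝ × ℝ) × ℝ => (q.1.1, q.1.2, q.2)) (by fun_prop))
  rw [h1, lintegral_lintegral_swap h2.aemeasurable]
  refine lintegral_congr fun y => ?_
  rw [lintegral_lintegral_swap]
  · exact lintegral_congr fun ξ => (gaussianReal_sq_mem (sqScale_pos hL ξ y) hB hB0).symm
  · exact (hmeas.comp (f := fun p : ℝ × ℝ => (p.1, y, p.2)) (by fun_prop)).aemeasurable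

theorem setLIntegral_Q_Ioi {Lbar : ℝ} (hL : 0 < Lbar) :
    ∫⁻ η in Set.Ioi 0, ENNReal.ofReal (Q Lbar η) = 1 := by
  rw [setLIntegral_Q hL measurableSet_Ioi subset_rfl]
  have h1 : ∀ y ξ : ℝ, gaussianReal 0 1 {x | sqScale Lbar ξ y * x ^ 2 ∈ Set.Ioi (0 : ℝ)} = 1 := by
    intro y ξ
    have hc := sqScale_pos hL ξ y
    have h2 : {x : ℝ | sqScale Lbar ξ y * x ^ 2 ∈ Set.Ioi (0 : ℝ)} = {0}ᶜ := by
      ext x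
      simp only [Set.mem_ofPred_eq, Set.mem_Ioi, Set.mem_compl_iff, Set.mem_singleton_iff]
      constructor
      · rintro h rfl
        simp at h
      · intro h
        positivity
    have := nullSingletonClass_gaussianReal (μ := 0) (one_ne_zero : (1 : NNReal) ≠ 0)
    rw [h2, prob_compl_eq_one_sub (measurableSet_singleton 0), measure_singleton, tsub_zero]
  simp only [h1, lintegral_const, measure_univ, mul_one]

theorem aestronglyMeasurable_Q {Lbar : ℝ} (hL : 0 < Lbar) :
    AEStronglyMeasurable (Q Lbar) (volume.restrict (Set.Ioi 0)) :=
  (continuousOn_Q hL).aestronglyMeasurable measurableSet_Ioi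

theorem isProbDensity_Q {Lbar : ℝ} (hL : 0 < Lbar) : IsProbDensity (Q Lbar) := by
  have h0 : 0 ≤ᵐ[volume.restrict (Set.Ioi 0)] Q Lbar :=
    (ae_restrict_iff' measurableSet_Ioi).mpr (ae_of_all _ fun η hη => Q_nonneg hL hη)
  refine ⟨fun η hη => Q_nonneg hL hη, ⟨aestronglyMeasurable_Q hL, ?_⟩, ?_⟩
  · rw [hasFiniteIntegral_iff_ofReal h0, setLIntegral_Q_Ioi hL]
    exact ENNReal.one_lt_top
  · rw [integral_eq_lintegral_of_nonneg_ae h0 (aestronglyMeasurable_Q hL), setLIntegral_Q_Ioi hL]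
    simp

/-- For x ≠ 0, the limit m(ξ)² / (2x²) of S exceeds 2(1 + y²) / (R Lbar) exactly when the scaled
square is below R. The point x = 0 lies in neither event. -/
theorem zLaw_Iio {Lbar R : ℝ} (hL : 0 < Lbar) (hR : 0 < R) (y : ℝ) :
    zLaw (Set.Iio (Real.exp (-(2 * (1 + y ^ 2) / (R * Lbar)))))
      = ∫⁻ ξ, gaussianReal 0 1 {x | sqScale Lbar ξ y * x ^ 2 ∈ Set.Ioo 0 R} ∂(gaussianReal 0 2) := by
  rw [zLaw, Measure.map_apply measurable_zFun measurableSet_Iio,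
    Measure.prod_apply (measurable_zFun measurableSet_Iio)]
  refine lintegral_congr fun ξ => ?_
  congr 1
  ext x
  have hm := m_pos ξ
  simp only [Set.mem_preimage, Set.mem_Iio, Real.exp_lt_exp, neg_lt_neg_iff, Set.mem_ofPred_eq,
    Set.mem_Ioo, sqScale]
  rcases eq_or_ne x 0 with rfl | hx
  · simp
    positivity
  · have hx2 : 0 < x ^ 2 := by positivity
    rw [and_iff_right (by positivity), div_lt_div_iff₀ (by positivity) (by positivity), div_mul_eq_mul_div,
      div_lt_iff₀ (by positivity)]
    constructor <;> intro h <;> nlinarith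

theorem integral_Q_eq_limCdf {Lbar R : ℝ} (hL : 0 < Lbar) (hR : 0 < R) :
    ∫ η in (0 : ℝ)..R, Q Lbar η = limCdf (R * Lbar) := by
  have h0 : 0 ≤ᵐ[volume.restrict (Set.Ioo 0 R)] Q Lbar :=
    (ae_restrict_iff' measurableSet_Ioo).mpr (ae_of_all _ fun η hη => Q_nonneg hL hη.1)
  rw [intervalIntegral.integral_of_le hR.le, integral_Ioc_eq_integral_Ioo,
    integral_eq_lintegral_of_nonneg_ae h0 ((aestronglyMeasurable_Q hL).mono_set Set.Ioo_subset_Ioi_self),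
    setLIntegral_Q hL measurableSet_Ioo Set.Ioo_subset_Ioi_self, limCdf]
  simp only [← zLaw_Iio hL hR]
  rw [integral_eq_lintegral_of_nonneg_ae (ae_of_all _ fun y => measureReal_nonneg)]
  · congr 1
    exact lintegral_congr fun y => (ofReal_measureReal (measure_ne_top _ _)).symm
  · have h1 : Antitone fun t : ℝ => zLaw.real (Set.Iio (Real.exp (-t))) := fun s t hst =>
      measureReal_mono (Set.Iio_subset_Iio (Real.exp_le_exp.mpr (neg_le_neg hst)))
    exact (h1.measurable.comp (f := fun y : ℝ => 2 * (1 + y ^ 2) / (R * Lbar))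
      (by fun_prop)).aestronglyMeasurable

end Mixture

/-! ### The algebraic tail and the comparison with Porter–Thomas. -/

section Tail

theorem integrable_exp_neg_sq_div_four : Integrable fun ξ : ℝ => Real.exp (-ξ ^ 2 / 4) := by
  refine (integrable_exp_neg_mul_sq (b := 1 / 4) (by norm_num)).congr (ae_of_all _ fun ξ => ?_)
  simp only
  congr 1
  ring

theorem integrable_exp_div_m : Integrable fun ξ : ℝ => Real.exp (-ξ ^ 2 / 4) / m ξ := by
  have hc : Continuous fun ξ : ℝ => Real.exp (-ξ ^ 2 / 4) / m ξ :=
    (by fun_prop : Continuous fun ξ : ℝ => Real.exp (-ξ ^ 2 / 4)).div continuous_m fun ξ => (m_pos ξ).ne'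
  refine (integrable_exp_neg_sq_div_four.div_const (2 / √π)).mono' hc.aestronglyMeasurable
    (ae_of_all _ fun ξ => ?_)
  rw [Real.norm_of_nonneg (div_nonneg (Real.exp_pos _).le (m_pos ξ).le)]
  exact div_le_div_of_nonneg_left (Real.exp_pos _).le (by positivity) (m_ge ξ)

theorem integral_exp_div_m_pos : 0 < ∫ ξ : ℝ, Real.exp (-ξ ^ 2 / 4) / m ξ := by
  have hpos : ∀ ξ : ℝ, 0 < Real.exp (-ξ ^ 2 / 4) / m ξ := fun ξ => div_pos (Real.exp_pos _) (m_pos ξ)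
  refine (integral_pos_iff_support_of_nonneg (fun ξ => (hpos ξ).le) integrable_exp_div_m).mpr ?_
  have : Function.support (fun ξ : ℝ => Real.exp (-ξ ^ 2 / 4) / m ξ) = Set.univ :=
    Set.eq_univ_of_forall fun ξ => (hpos ξ).ne'
  rw [this]
  simp

theorem rpow_three_halves {η : ℝ} (hη : 0 < η) : η ^ (3 / 2 : ℝ) = η * √η := by
  rw [Real.sqrt_eq_rpow, show (3 / 2 : ℝ) = 1 + 1 / 2 by norm_num, Real.rpow_add hη, Real.rpow_one]

theorem rpow_neg_five_halves {η : ℝ} (hη : 0 < η) : η ^ (-(5 / 2) : ℝ) = (η ^ 2 * √η)⁻¹ := by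
  rw [Real.rpow_neg hη.le, Real.sqrt_eq_rpow, show (5 / 2 : ℝ) = 2 + 1 / 2 by norm_num,
    Real.rpow_add hη, Real.rpow_two]

theorem Q_sub_tail {Lbar η : ℝ} (hL : 0 < Lbar) (hη : 0 < η) :
    Q Lbar η - √2 / (√Lbar * π ^ 2 * η ^ (3 / 2 : ℝ)) * ∫ ξ : ℝ, Real.exp (-ξ ^ 2 / 4) / m ξ
      = (π ^ 2 * η)⁻¹ * ∫ ξ, Real.exp (-ξ ^ 2 / 4) *
        (dawson (dawsonArg Lbar η ξ) - (2 * dawsonArg Lbar η ξ)⁻¹) := by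
  have h1 : ∀ ξ, Real.exp (-ξ ^ 2 / 4) * (2 * dawsonArg Lbar η ξ)⁻¹
      = √2 / (√Lbar * √η) * (Real.exp (-ξ ^ 2 / 4) / m ξ) := by
    intro ξ
    have hm := m_pos ξ
    rw [dawsonArg, Real.sqrt_mul hL.le]
    field_simp
  simp only [mul_sub, h1]
  rw [integral_sub (integrable_exp_mul_dawson Lbar η) (integrable_exp_div_m.const_mul _),
    integral_const_mul, mul_sub, ← Q_eq hL hη, rpow_three_halves hη]
  congr 1
  field_simp

theorem Q_tail {Lbar : ℝ} (hL : 0 < Lbar) :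
    (fun η : ℝ => Q Lbar η - √2 / (√Lbar * π ^ 2 * η ^ (3 / 2 : ℝ)) *
        ∫ ξ : ℝ, Real.exp (-ξ ^ 2 / 4) / m ξ) =O[atTop] (fun η : ℝ => η ^ (-(5 / 2) : ℝ)) := by
  -- By `m_ge`, κ√η bounds the Dawson argument below for every ξ. The Dawson remainder a⁻³ is then
  -- O(η^(-3/2)) uniformly in ξ, and the prefactor of Q supplies another 1/η.
  set κ : ℝ := √Lbar * (2 / √π) / (2 * √2) with hκ
  have hκ0 : 0 < κ := by positivity
  refine IsBigO.of_bound ((π ^ 2)⁻¹ * ((κ ^ 3)⁻¹ * ∫ ξ : ℝ, Real.exp (-ξ ^ 2 / 4))) ?_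
  filter_upwards [eventually_gt_atTop 0] with η hη
  have hs := Real.sqrt_pos.mpr hη
  have hbound : ∀ ξ, |dawson (dawsonArg Lbar η ξ) - (2 * dawsonArg Lbar η ξ)⁻¹|
      ≤ (κ ^ 3)⁻¹ * (η * √η)⁻¹ := by
    intro ξ
    have ha := dawsonArg_pos hL hη ξ
    have hge : κ * √η ≤ dawsonArg Lbar η ξ := by
      have h1 : κ * √η = √(Lbar * η) * (2 / √π) / (2 * √2) := by
        rw [hκ, Real.sqrt_mul hL.le]; ring
      rw [h1, dawsonArg]
      have := m_ge ξ
      gcongr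
    set a := dawsonArg Lbar η ξ
    have h2 : dawson a - (2 * a)⁻¹ = (2 * a * dawson a - 1) / (2 * a) := by field_simp
    rw [h2, abs_div, abs_of_pos (by positivity : 0 < 2 * a)]
    calc |2 * a * dawson a - 1| / (2 * a) ≤ (2 / a ^ 2) / (2 * a) := by
          gcongr
          exact abs_two_mul_dawson_sub_one_le ha
      _ = (a ^ 3)⁻¹ := by field_simp
      _ ≤ ((κ * √η) ^ 3)⁻¹ := by gcongr
      _ = (κ ^ 3)⁻¹ * (η * √η)⁻¹ := by
          rw [mul_pow, mul_inv, pow_succ √η 2, Real.sq_sqrt hη.le]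
  rw [Q_sub_tail hL hη, rpow_neg_five_halves hη, norm_mul,
    Real.norm_of_nonneg (by positivity : 0 ≤ (π ^ 2 * η)⁻¹),
    Real.norm_of_nonneg (by positivity : 0 ≤ (η ^ 2 * √η)⁻¹)]
  have h3 : ‖∫ ξ, Real.exp (-ξ ^ 2 / 4) * (dawson (dawsonArg Lbar η ξ) - (2 * dawsonArg Lbar η ξ)⁻¹)‖
      ≤ ∫ ξ : ℝ, Real.exp (-ξ ^ 2 / 4) * ((κ ^ 3)⁻¹ * (η * √η)⁻¹) := by
    refine norm_integral_le_of_norm_le (integrable_exp_neg_sq_div_four.mul_const _)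
      (ae_of_all _ fun ξ => ?_)
    rw [norm_mul, Real.norm_of_nonneg (Real.exp_pos _).le]
    exact mul_le_mul_of_nonneg_left (hbound ξ) (Real.exp_pos _).le
  rw [integral_mul_const] at h3
  calc _ ≤ (π ^ 2 * η)⁻¹ * ((∫ ξ : ℝ, Real.exp (-ξ ^ 2 / 4)) * ((κ ^ 3)⁻¹ * (η * √η)⁻¹)) :=
        mul_le_mul_of_nonneg_left h3 (by positivity)
    _ = _ := by field_simp

/-- The tail coefficient is strictly positive, so Q is asymptotic to a multiple of η^(-3/2), which
dominates exp(-η/2). -/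
theorem gammaPDFReal_isLittleO_Q {Lbar : ℝ} (hL : 0 < Lbar) :
    ProbabilityTheory.gammaPDFReal (1 / 2) (1 / 2) =o[atTop] Q Lbar := by
  set C : ℝ := √2 / (√Lbar * π ^ 2) * ∫ ξ : ℝ, Real.exp (-ξ ^ 2 / 4) / m ξ with hC
  have hC0 : 0 < C := by
    have := integral_exp_div_m_pos
    positivity
  have h1 : (fun η : ℝ => √2 / (√Lbar * π ^ 2 * η ^ (3 / 2 : ℝ)) * ∫ ξ : ℝ, Real.exp (-ξ ^ 2 / 4) / m ξ)
      =ᶠ[atTop] fun η => C * η ^ (-(3 / 2) : ℝ) := by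
    filter_upwards [eventually_gt_atTop 0] with η hη
    rw [hC, Real.rpow_neg hη.le]
    field_simp
  have h2 : (fun η : ℝ => η ^ (-(5 / 2) : ℝ)) =o[atTop] fun η : ℝ => C * η ^ (-(3 / 2) : ℝ) := by
    refine IsLittleO.const_mul_right' hC0.ne'.isUnit ?_
    refine isLittleO_of_tendsto' ?_ (tendsto_inv_atTop_zero.congr' ?_)
    · filter_upwards [eventually_gt_atTop 0] with η hη h
      exact absurd h (Real.rpow_pos_of_pos hη _).ne'
    · filter_upwards [eventually_gt_atTop 0] with η hη
      rw [← Real.rpow_sub hη, ← Real.rpow_neg_one]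
      norm_num
  have h3 : Q Lbar ~[atTop] fun η : ℝ => C * η ^ (-(3 / 2) : ℝ) := by
    refine ((Q_tail hL).trans_isLittleO h2).congr' ?_ EventuallyEq.rfl
    filter_upwards [h1] with η hη
    rw [Pi.sub_apply, hη]
  have h4 : (fun η : ℝ => Real.exp (-(1 / 2) * η)) =o[atTop] fun η : ℝ => C * η ^ (-(3 / 2) : ℝ) :=
    IsLittleO.const_mul_right' hC0.ne'.isUnit (isLittleO_exp_neg_mul_rpow_atTop (by norm_num) _)
  have h5 : ProbabilityTheory.gammaPDFReal (1 / 2) (1 / 2) =O[atTop] fun η : ℝ => Real.exp (-(1 / 2) * η) := by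
    refine IsBigO.of_bound ((1 / 2 : ℝ) ^ (1 / 2 : ℝ) / Real.Gamma (1 / 2)) ?_
    filter_upwards [eventually_ge_atTop 1] with η hη
    have hη0 : 0 ≤ η := by linarith
    have h6 : η ^ (1 / 2 - 1 : ℝ) ≤ 1 := Real.rpow_le_one_of_one_le_of_nonpos hη (by norm_num)
    have h7 : 0 < Real.Gamma (1 / 2) := Real.Gamma_pos_of_pos (by norm_num)
    rw [ProbabilityTheory.gammaPDFReal, if_pos hη0, Real.norm_of_nonneg (by positivity),
      Real.norm_of_nonneg (by positivity), ← neg_mul]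
    refine mul_le_mul_of_nonneg_right ?_ (Real.exp_pos _).le
    exact mul_le_of_le_one_right (by positivity) h6
  exact (h5.trans_isLittleO h4).trans_isBigO h3.isBigO_symm

end Tail

/-! ### Comparison with equal bond lengths, and the limit of many bonds. -/

section ManyBonds

theorem measurableSet_lt_scaledSum (n : ℕ) (r : ℝ) :
    MeasurableSet {p : ℝ × (Fin n → ℝ) | 2 * (1 + p.1 ^ 2) / r < scaledSum n p.1 p.2} :=
  measurableSet_lt (by fun_prop) continuous_scaledSum.measurable

theorem modelCdf_eq_prod (n : ℕ) (r : ℝ) : modelCdf n r =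
    (stdCauchy.prod (Measure.pi fun _ : Fin n => stdCauchy)).real
      {p | 2 * (1 + p.1 ^ 2) / r < scaledSum n p.1 p.2} := by
  rw [Measure.real, Measure.prod_apply (measurableSet_lt_scaledSum n r), modelCdf,
    integral_eq_lintegral_of_nonneg_ae (ae_of_all _ fun y => measureReal_nonneg)
    (measurable_modelCdf_integrand n r).aestronglyMeasurable]
  congr 1
  exact lintegral_congr fun y => ofReal_measureReal (measure_ne_top _ _)

theorem modelCdf_nonneg (n : ℕ) (r : ℝ) : 0 ≤ modelCdf n r := by
  rw [modelCdf_eq_prod]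
  exact measureReal_nonneg

theorem modelCdf_mono (n : ℕ) {r s : ℝ} (hr : 0 < r) (hrs : r ≤ s) : modelCdf n r ≤ modelCdf n s := by
  rw [modelCdf_eq_prod, modelCdf_eq_prod]
  refine measureReal_mono fun p hp => ?_
  have hp2 : 2 * (1 + p.1 ^ 2) / r < scaledSum n p.1 p.2 := hp
  exact (div_le_div_of_nonneg_left (by positivity) hr hrs).trans_lt hp2

variable {n : ℕ} {L : Fin (n + 2) → ℝ} {a b R : ℝ}

theorem sum_slice_insertNth (l : Fin (n + 2)) (i : Fin (n + 1)) (y : ℝ) (u : Fin n → ℝ) :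
    ∑ j, (1 + slice l 0 (i.insertNth y u) j ^ 2) = (n + 2 : ℝ) ^ 2 * scaledSum n y u := by
  have hn : (n : ℝ) + 2 ≠ 0 := by positivity
  rw [scaledSum, mul_div_cancel₀ _ (pow_ne_zero 2 hn), Finset.sum_add_distrib,
    Fin.sum_univ_succAbove (fun j => slice l 0 (i.insertNth y u) j ^ 2) l]
  simp only [slice, Fin.insertNth_apply_same, Fin.insertNth_apply_succAbove]
  rw [Fin.sum_univ_succAbove _ i, Fin.sum_univ_succAbove _ i]
  simp only [Fin.insertNth_apply_same, Fin.insertNth_apply_succAbove]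
  simp
  ring

theorem weight_mem_Icc (hL : ∀ j, L j ∈ Set.Icc a b) (y : Fin (n + 2) → ℝ) :
    weight L y ∈ Set.Icc (a * ∑ j, (1 + y j ^ 2)) (b * ∑ j, (1 + y j ^ 2)) := by
  rw [weight, Finset.mul_sum, Finset.mul_sum]
  constructor <;> refine Finset.sum_le_sum fun j _ => mul_le_mul_of_nonneg_right ?_ (by positivity)
  exacts [(hL j).1, (hL j).2]

/-- When the eliminated bond l differs from the observed one, the observed tangent is a Cauchy
variable and is split off from the n remaining ones, as in `modelCdf`. -/
theorem measureReal_ampl_slice (ha : 0 < a) (hL : ∀ j, L j ∈ Set.Icc a b) (l : Fin (n + 2)) (i : Fin (n + 1)) :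
    (Measure.pi fun _ : Fin (n + 1) => stdCauchy).real {z | ampl L (l.succAbove i) (slice l 0 z) < R}
      = (stdCauchy.prod (Measure.pi fun _ : Fin n => stdCauchy)).real
        {p | 2 * (1 + p.1 ^ 2) * (n + 2 : ℝ) ^ 2 < R * weight L (slice l 0 (i.insertNth p.1 p.2))} := by
  have hpos : ∀ j, 0 < L j := fun j => ha.trans_le (hL j).1
  have hmeas : MeasurableSet {z : Fin (n + 1) → ℝ | ampl L (l.succAbove i) (slice l 0 z) < R} :=
    measurableSet_lt (continuous_ampl_slice hpos _ _).measurable measurable_const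
  have hmp := (measurePreserving_piFinSuccAbove (fun _ : Fin (n + 1) => stdCauchy) i).symm
  rw [← hmp.measureReal_preimage hmeas.nullMeasurableSet]
  congr 1
  ext p
  change ampl L (l.succAbove i) (slice l 0 (i.insertNth p.1 p.2)) < R ↔
    2 * (1 + p.1 ^ 2) * (n + 2 : ℝ) ^ 2 < R * weight L (slice l 0 (i.insertNth p.1 p.2))
  have hw := weight_pos hpos (slice l 0 (i.insertNth p.1 p.2))
  have hi : slice l 0 (i.insertNth p.1 p.2 : Fin (n + 1) → ℝ) (l.succAbove i) = p.1 := by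
    simp [slice]
  rw [ampl, hi, ← mul_div_assoc, div_lt_iff₀ hw, mul_comm]
  push_cast
  rfl

theorem modelCdf_le_measureReal (ha : 0 < a) (hL : ∀ j, L j ∈ Set.Icc a b) (hR : 0 < R)
    (l : Fin (n + 2)) (i : Fin (n + 1)) : modelCdf n (R * a) ≤
      (Measure.pi fun _ : Fin (n + 1) => stdCauchy).real
        {z | ampl L (l.succAbove i) (slice l 0 z) < R} := by
  rw [measureReal_ampl_slice ha hL, modelCdf_eq_prod]
  refine measureReal_mono fun p hp => ?_
  have hp2 : 2 * (1 + p.1 ^ 2) / (R * a) < scaledSum n p.1 p.2 := hp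
  rw [div_lt_iff₀ (by positivity)] at hp2
  have h1 := (weight_mem_Icc hL (slice l 0 (i.insertNth p.1 p.2))).1
  rw [sum_slice_insertNth] at h1
  change 2 * (1 + p.1 ^ 2) * (n + 2 : ℝ) ^ 2 < R * weight L (slice l 0 (i.insertNth p.1 p.2))
  calc 2 * (1 + p.1 ^ 2) * (n + 2 : ℝ) ^ 2 < scaledSum n p.1 p.2 * (R * a) * (n + 2 : ℝ) ^ 2 := by gcongr
    _ = R * (a * ((n + 2 : ℝ) ^ 2 * scaledSum n p.1 p.2)) := by ring
    _ ≤ _ := by gcongr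

theorem measureReal_le_modelCdf (ha : 0 < a) (hL : ∀ j, L j ∈ Set.Icc a b) (hR : 0 < R)
    (l : Fin (n + 2)) (i : Fin (n + 1)) :
      (Measure.pi fun _ : Fin (n + 1) => stdCauchy).real
        {z | ampl L (l.succAbove i) (slice l 0 z) < R} ≤ modelCdf n (R * b) := by
  have hb : 0 < b := ha.trans_le ((hL 0).1.trans (hL 0).2)
  rw [measureReal_ampl_slice ha hL, modelCdf_eq_prod]
  refine measureReal_mono fun p hp => ?_
  have hp2 : 2 * (1 + p.1 ^ 2) * (n + 2 : ℝ) ^ 2 < R * weight L (slice l 0 (i.insertNth p.1 p.2)) := hp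
  have h1 := (weight_mem_Icc hL (slice l 0 (i.insertNth p.1 p.2))).2
  rw [sum_slice_insertNth] at h1
  change 2 * (1 + p.1 ^ 2) / (R * b) < scaledSum n p.1 p.2
  rw [div_lt_iff₀ (by positivity)]
  refine lt_of_mul_lt_mul_right (a := (n + 2 : ℝ) ^ 2) ?_ (by positivity)
  calc 2 * (1 + p.1 ^ 2) * (n + 2 : ℝ) ^ 2 < R * weight L (slice l 0 (i.insertNth p.1 p.2)) := hp2
    _ ≤ R * (b * ((n + 2 : ℝ) ^ 2 * scaledSum n p.1 p.2)) := by gcongr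
    _ = _ := by ring

/-- Comparison of the limit law with the model of equal bond lengths. -/
theorem limLaw_bounds (ha : 0 < a) (hL : ∀ j, L j ∈ Set.Icc a b) (hR : 0 < R) (i : Fin (n + 2)) :
    (1 - b / ((n + 2) * a)) * modelCdf n (R * a) ≤ (limLaw L i).real (Set.Iio R) ∧
      (limLaw L i).real (Set.Iio R) ≤ modelCdf n (R * b) + b / ((n + 2) * a) := by
  have hpos : ∀ j, 0 < L j := fun j => ha.trans_le (hL j).1
  have hsum : ((n : ℝ) + 2) * a ≤ ∑ j, L j := by
    calc ((n : ℝ) + 2) * a = ∑ _j : Fin (n + 2), a := by simp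
      _ ≤ _ := Finset.sum_le_sum fun j _ => (hL j).1
  have hsum0 : 0 < ∑ j, L j := lt_of_lt_of_le (by positivity) hsum
  -- In the term l = i of the mixture the observed coordinate is the eliminated one and the model
  -- does not apply. Its weight is of order 1/n, so the trivial bounds 0 and 1 suffice for it.
  have hp : L i / (∑ j, L j) ≤ b / ((n + 2) * a) :=
    div_le_div₀ ((hpos i).le.trans (hL i).2) (hL i).2 (by positivity) hsum
  set p : Fin (n + 2) → ℝ := fun l => L l / ∑ j, L j with hpdef
  have hp0 : ∀ l, 0 ≤ p l := fun l => div_nonneg (hpos l).le hsum0.le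
  have hpsum : p i + ∑ k, p (i.succAbove k) = 1 := by
    rw [← Fin.sum_univ_succAbove p i, hpdef, ← Finset.sum_div, div_self hsum0.ne']
  set q : Fin (n + 2) → ℝ := fun l =>
    (Measure.pi fun _ : Fin (n + 1) => stdCauchy).real {z | ampl L i (slice l 0 z) < R} with hq
  have hlaw : (limLaw L i).real (Set.Iio R) = p i * q i + ∑ k, p (i.succAbove k) * q (i.succAbove k) := by
    rw [limLaw_real hpos i measurableSet_Iio, ← Fin.sum_univ_succAbove (fun l => p l * q l) i]
    rfl
  have hqi0 : 0 ≤ q i := measureReal_nonneg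
  have hqi1 : q i ≤ 1 := measureReal_le_one
  have hex : ∀ k : Fin (n + 1), ∃ i₀, i = (i.succAbove k).succAbove i₀ := fun k =>
    (Fin.exists_succAbove_eq (Fin.ne_succAbove i k)).imp fun _ h => h.symm
  have hlo : ∀ k, modelCdf n (R * a) ≤ q (i.succAbove k) := by
    intro k
    obtain ⟨i₀, h⟩ := hex k
    have := modelCdf_le_measureReal ha hL hR (i.succAbove k) i₀
    rwa [← h] at this
  have hhi : ∀ k, q (i.succAbove k) ≤ modelCdf n (R * b) := by
    intro k
    obtain ⟨i₀, h⟩ := hex k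
    have := measureReal_le_modelCdf ha hL hR (i.succAbove k) i₀
    rwa [← h] at this
  have h1 : (∑ k, p (i.succAbove k)) * modelCdf n (R * a) ≤ ∑ k, p (i.succAbove k) * q (i.succAbove k) := by
    rw [Finset.sum_mul]
    exact Finset.sum_le_sum fun k _ => mul_le_mul_of_nonneg_left (hlo k) (hp0 _)
  have h2 : ∑ k, p (i.succAbove k) * q (i.succAbove k) ≤ (∑ k, p (i.succAbove k)) * modelCdf n (R * b) := by
    rw [Finset.sum_mul]
    exact Finset.sum_le_sum fun k _ => mul_le_mul_of_nonneg_left (hhi k) (hp0 _)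
  have h3 := modelCdf_nonneg n (R * a)
  have h4 := modelCdf_nonneg n (R * b)
  have hpi : p i ≤ b / ((n + 2) * a) := hp
  have hs : ∑ k, p (i.succAbove k) = 1 - p i := by linarith
  rw [hlaw]
  rw [hs] at h1 h2
  have h5 := hp0 i
  constructor
  · have h6 := mul_nonneg h5 hqi0
    have h7 : (1 - b / ((n + 2) * a)) * modelCdf n (R * a) ≤ (1 - p i) * modelCdf n (R * a) := by gcongr
    linarith
  · have h6 : p i * q i ≤ p i := mul_le_of_le_one_right h5 hqi1
    have h7 : (1 - p i) * modelCdf n (R * b) ≤ modelCdf n (R * b) :=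
      mul_le_of_le_one_left h4 (by linarith)
    linarith

theorem tendsto_limLaw {Lbar : ℝ} (hLbar : 0 < Lbar) {δ : ℕ → ℝ} (hδ : Tendsto δ atTop (𝓝 0))
    {L : (n : ℕ) → Fin (n + 2) → ℝ} (hL : ∀ n j, L n j ∈ Set.Icc Lbar (Lbar + δ n))
    (i : (n : ℕ) → Fin (n + 2)) {R : ℝ} (hR : 0 < R) :
    Tendsto (fun n => (limLaw (L n) (i n)).real (Set.Iio R)) atTop (𝓝 (∫ η in (0 : ℝ)..R, Q Lbar η)) := by
  have hN : Tendsto (fun n : ℕ => ((n : ℝ) + 2)) atTop atTop :=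
    tendsto_atTop_add_const_right _ _ tendsto_natCast_atTop_atTop
  have hsmall : Tendsto (fun n : ℕ => (Lbar + δ n) / (((n : ℝ) + 2) * Lbar)) atTop (𝓝 0) :=
    (hδ.const_add Lbar).div_atTop (hN.atTop_mul_const hLbar)
  have hlow : Tendsto (fun n : ℕ => (1 - (Lbar + δ n) / (((n : ℝ) + 2) * Lbar)) * modelCdf n (R * Lbar))
      atTop (𝓝 (∫ η in (0 : ℝ)..R, Q Lbar η)) := by
    have := (hsmall.const_sub 1).mul (tendsto_modelCdf (R * Lbar))
    rwa [sub_zero, one_mul, ← integral_Q_eq_limCdf hLbar hR] at this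
  have hcont : ContinuousWithinAt (fun s => ∫ η in (0 : ℝ)..s, Q Lbar η) (Set.Ioi R) R := by
    have h1 : IntervalIntegrable (Q Lbar) volume 0 (R + 1) := by
      rw [intervalIntegrable_iff_integrableOn_Ioc_of_le (by linarith)]
      exact (isProbDensity_Q hLbar).2.1.mono_set Set.Ioc_subset_Ioi_self
    have h2 := intervalIntegral.continuousOn_primitive_interval' h1 Set.left_mem_uIcc
    have h3 := h2 R (by rw [Set.uIcc_of_le (by linarith)]; constructor <;> linarith)
    rw [Set.uIcc_of_le (by linarith)] at h3
    exact (h3.continuousAt (Icc_mem_nhds hR (by linarith))).continuousWithinAt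
  refine tendsto_order.mpr ⟨fun c hc => ?_, fun c hc => ?_⟩
  · filter_upwards [(tendsto_order.mp hlow).1 c hc] with n hn
    exact hn.trans_le (limLaw_bounds hLbar (hL n) hR (i n)).1
  -- The upper bound involves R(Lbar + δ n), which varies with n. It is absorbed by monotonicity
  -- into S Lbar for a fixed S > R close to R.
  · obtain ⟨S, hSc, hS⟩ := (((tendsto_order.mp hcont).2 c hc).and self_mem_nhdsWithin).exists
    have hS0 : R < S := hS
    have hup : Tendsto (fun n : ℕ => modelCdf n (S * Lbar) + (Lbar + δ n) / (((n : ℝ) + 2) * Lbar))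
        atTop (𝓝 (∫ η in (0 : ℝ)..S, Q Lbar η)) := by
      have := (tendsto_modelCdf (S * Lbar)).add hsmall
      rwa [add_zero, ← integral_Q_eq_limCdf hLbar (hR.trans hS0)] at this
    have hle : ∀ᶠ n in atTop, R * (Lbar + δ n) < S * Lbar := by
      have h1 : Tendsto (fun n => R * (Lbar + δ n)) atTop (𝓝 (R * (Lbar + 0))) :=
        (hδ.const_add Lbar).const_mul R
      refine (tendsto_order.mp h1).2 _ ?_
      rw [add_zero]
      exact mul_lt_mul_of_pos_right hS0 hLbar
    filter_upwards [(tendsto_order.mp hup).2 c hSc, hle] with n h1 h2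
    have hb : 0 < Lbar + δ n := hLbar.trans_le ((hL n 0).1.trans (hL n 0).2)
    refine lt_of_le_of_lt ((limLaw_bounds hLbar (hL n) hR (i n)).2.trans ?_) h1
    gcongr
    exact modelCdf_mono n (by positivity) h2.le

end ManyBonds

end StarGraph

end

/-! ### Assembly. -/

theorem theorem6 (Lbar : ℝ) (hLbar : 0 < Lbar) (ΔL : ℕ → ℝ) (L : (v : ℕ) → Fin v → ℝ)
    (hL : ∀ v j, L v j ∈ Set.Icc Lbar (Lbar + ΔL v))
    (hind : ∀ v, LinearIndependent ℚ (L v))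
    (hΔ : Tendsto (fun v : ℕ => (v : ℝ) * ΔL v) atTop (𝓝 0)) :
    -- the densities `Q_v` exist (for one or two bonds the distribution is a point mass)
    (∀ v : ℕ, 3 ≤ v → ∀ i : Fin v, ∃ q : ℝ → ℝ, StarGraph.IsAmplitudeDensity (L v) i q) ∧
    -- `Q` is a probability density, continuous on `(0, ∞)`
    StarGraph.IsProbDensity (StarGraph.Q Lbar) ∧
    ContinuousOn (StarGraph.Q Lbar) (Set.Ioi 0) ∧
    -- convergence, for any choice of a bond in each graph
    (∀ (i : (v : ℕ) → 3 ≤ v → Fin v) (q : ℕ → ℝ → ℝ),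
      (∀ (v : ℕ) (hv : 3 ≤ v), StarGraph.IsAmplitudeDensity (L v) (i v hv) (q v)) →
      ∀ R : ℝ, 0 < R →
        Tendsto (fun v : ℕ => ∫ η in (0 : ℝ)..R, q v η) atTop
          (𝓝 (∫ η in (0 : ℝ)..R, StarGraph.Q Lbar η))) ∧
    -- the algebraic tail
    (fun η : ℝ => StarGraph.Q Lbar η -
        √2 / (√Lbar * π ^ 2 * η ^ (3 / 2 : ℝ)) *
          ∫ ξ : ℝ, Real.exp (-ξ ^ 2 / 4) / StarGraph.m ξ)
      =O[atTop] (fun η : ℝ => η ^ (-(5 / 2) : ℝ)) ∧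
    -- the tail dominates that of the Porter–Thomas (chi-squared, one degree of freedom) density
    ProbabilityTheory.gammaPDFReal (1 / 2) (1 / 2) =o[atTop] StarGraph.Q Lbar := by
  have hpos : ∀ v j, 0 < L v j := fun v j => hLbar.trans_le (hL v j).1
  refine ⟨fun v hv i => ?_, StarGraph.isProbDensity_Q hLbar, StarGraph.continuousOn_Q hLbar,
    fun i q hq R hR => ?_, StarGraph.Q_tail hLbar, StarGraph.gammaPDFReal_isLittleO_Q hLbar⟩
  · obtain ⟨n, rfl⟩ : ∃ n, v = n + 1 := ⟨v - 1, by omega⟩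
    exact StarGraph.exists_isAmplitudeDensity (hind _) (hpos _) (by omega) i
  · have hΔ0 : Tendsto ΔL atTop (𝓝 0) := by
      have h1 := hΔ.mul tendsto_inv_atTop_nhds_zero_nat
      rw [zero_mul] at h1
      refine h1.congr' ?_
      filter_upwards [eventually_ge_atTop 1] with v hv
      have : (v : ℝ) ≠ 0 := by positivity
      field_simp
    rw [← tendsto_add_atTop_iff_nat 2]
    have h2 := StarGraph.tendsto_limLaw hLbar (hΔ0.comp (tendsto_add_atTop_nat 2))
      (L := fun n => L (n + 2)) (fun n j => hL (n + 2) j)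
      (fun n => if h : 3 ≤ n + 2 then i (n + 2) h else 0) hR
    refine h2.congr' ?_
    filter_upwards [eventually_ge_atTop 1] with n hn
    have h3 : 3 ≤ n + 2 := by omega
    rw [dif_pos h3]
    exact (StarGraph.integral_eq_limLaw (hind (n + 2)) (hpos (n + 2)) (by omega) (hq (n + 2) h3) hR).symm
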